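/- Let $K\ge 0$ and let $\mathcal X,\mathcal W,\mathcal Y_k,\mathcal V_k,\mathcal U_k$ ($1\le k\le K$) be finite alphabets. Let $(X,Y_1,\dots,Y_K,V_1,\dots,V_K)$ have an arbitrary joint pmf, and let $T(u_1,\dots,u_K\mid w)$ be a broadcast channel (a conditional pmf on $\mathcal U_1\times\dots\times\mathcal U_K$ given $w\in\mathcal W$). Fix a rational $\kappa>0$ and $\boldsymbol R=(R_1,\dots,R_K)\in\mathbb R^K$. All entropies and mutual informations are in bits. Let $(\mathbf X,\mathbf Y_1,\dots,\mathbf Y_K,\mathbf V_1,\dots,\mathbf V_K)$ consist of $n_{\rm s}$ i.i.d. copies of $(X,Y_1,\dots,Y_K,V_1,\dots,V_K)$. An $(n_{\rm s},n_{\rm c},\boldsymbol R)$-code consists of an encoder $f:\mathcal X^{n_{\rm s}}\to\mathcal W^{n_{\rm c}}$, helper encoders $f_k:\mathcal V_k^{n_{\rm s}}\to\{1,\dots,\lfloor 2^{n_{\rm s}R_k}\rfloor\}$ and decoders $g_k:\mathcal U_k^{n_{\rm c}}\times\mathcal Y_k^{n_{\rm s}}\times\{1,\dots,\lfloor 2^{n_{\rm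 s}R_k}\rfloor\}\to\mathcal X^{n_{\rm s}}$, for $1\le k\le K$. The codeword $\mathbf W=f(\mathbf X)$ is sent over $n_{\rm c}$ memoryless uses of $T$ (the outputs depending on the source and side information only through $\mathbf W$), receiver $k$ observes its output sequence $\mathbf U_k$ and forms $\hat{\mathbf X}_k=g_k(\mathbf U_k,\mathbf Y_k,f_k(\mathbf V_k))$. The tuple $(X,Y_1,\dots,Y_K,V_1,\dots,V_K)$ is called $(\kappa,\boldsymbol R)$-achievable if for every $\epsilon>0$, for all sufficiently large $n_{\rm s},n_{\rm c}$ with $n_{\rm c}/n_{\rm s}=\kappa$, there is an $(n_{\rm s},n_{\rm c},\boldsymbol R)$-code with $\Pr[\hat{\mathbf X}_k\ne\mathbf X]\le\epsilon$ for all $k$. **Theorem.** (i) (Achievability.) Suppose that there exist a pmf $P_W$ on $\mathcal W$ and auxiliary random variables $A_1,\dots,A_K$ with finite alphabets, jointly distributed with $(X,Y_1,\dots,Y_K,V_1,\dots,V_K)$, such that for every $k$ the Markov chain $(X,Y_k)\leftrightarrow V_k\leftrightarrow A_k$ holds and $$R_k>I(V_k;A_k\mid Y_k),\qquad H(X\mid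 A_k,Y_k)<\kappa\, I(W;U_k),$$ where $(W,U_1,\dots,U_K)\sim P_W(\cdot)\,T(\cdot\mid\cdot)$. Then the tuple is $(\kappa,\boldsymbol R)$-achievable. (ii) (Converse.) Conversely, if the tuple is $(\kappa,\boldsymbol R)$-achievable, then there exist such $P_W$ and $A_1,\dots,A_K$ with both strict inequalities replaced by the non-strict ones, $R_k\ge I(V_k;A_k\mid Y_k)$ and $H(X\mid A_k,Y_k)\le\kappa\, I(W;U_k)$ for every $k$. The same conclusion holds already if, for every $\epsilon>0$, codes with $n_{\rm c}/n_{\rm s}=\kappa$ and error probabilities at most $\epsilon$ exist for arbitrarily large $n_{\rm s},n_{\rm c}$ (instead of all sufficiently large ones). -/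

import Mathlib

noncomputable section

namespace BSCoop

/-! ### Random variables on a finite probability space

A pmf on a finite set `Ω` is an element `p` of `stdSimplex ℝ Ω`, i.e. a nonnegative function with
sum `1`; a random variable is a function on `Ω`. All logarithms are to base `2`. -/

section Information

variable {Ω α β γ : Type*} [Fintype Ω]

open Classical in
/-- The law (marginal pmf) of the random variable `f` under the pmf `p`. -/
def law (p : Ω → ℝ) (f : Ω → α) (a : α) : ℝ :=
  ∑ ω with f ω = a, p ω

/-- Conditional entropy `H(f | g) = - ∑ p(a,b) log (p(a,b) / p(b))`, in bits. -/
def condEntropy [Fintype α] [Fintype β] (p : Ω → ℝ) (f : Ω → α) (g : Ω → β) : ℝ :=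
  -∑ a, ∑ b, law p (fun ω => (f ω, g ω)) (a, b) *
    Real.logb 2 (law p (fun ω => (f ω, g ω)) (a, b) / law p g b)

/-- Mutual information `I(f ; g) = ∑ p(a,b) log (p(a,b) / (p(a) p(b)))`, in bits. -/
def mutualInfo [Fintype α] [Fintype β] (p : Ω → ℝ) (f : Ω → α) (g : Ω → β) : ℝ :=
  ∑ a, ∑ b, law p (fun ω => (f ω, g ω)) (a, b) *
    Real.logb 2 (law p (fun ω => (f ω, g ω)) (a, b) / (law p f a * law p g b))

/-- Conditional mutual information
`I(f ; g | h) = ∑ p(a,b,c) log (p(a,b,c) p(c) / (p(a,c) p(b,c)))`, in bits. -/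
def condMutualInfo [Fintype α] [Fintype β] [Fintype γ]
    (p : Ω → ℝ) (f : Ω → α) (g : Ω → β) (h : Ω → γ) : ℝ :=
  ∑ a, ∑ b, ∑ c, law p (fun ω => (f ω, g ω, h ω)) (a, b, c) *
    Real.logb 2 (law p (fun ω => (f ω, g ω, h ω)) (a, b, c) * law p h c /
      (law p (fun ω => (f ω, h ω)) (a, c) * law p (fun ω => (g ω, h ω)) (b, c)))

/-- The Markov chain `f ↔ g ↔ h`: `f` and `h` are conditionally independent given `g`, i.e.
`p(a,b,c) p(b) = p(a,b) p(b,c)`. -/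
def IsMarkovChain (p : Ω → ℝ) (f : Ω → α) (g : Ω → β) (h : Ω → γ) : Prop :=
  ∀ a b c, law p (fun ω => (f ω, g ω, h ω)) (a, b, c) * law p g b =
    law p (fun ω => (f ω, g ω)) (a, b) * law p (fun ω => (g ω, h ω)) (b, c)

end Information

/-! ### The communication model -/

section Model

variable {K : ℕ} {X W : Type*} {Y V U : Fin K → Type*}

/-- One letter `(X, Y₁, …, Y_K, V₁, …, V_K)` of the source with side information. -/
abbrev Letter {K : ℕ} (X : Type*) (Y V : Fin K → Type*) :=
  X × (∀ k, Y k) × (∀ k, V k)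

/-- The number `⌊2 ^ (n R)⌋` of helper messages at rate `R` and source blocklength `n`. -/
def numMessages (ns : ℕ) (R : ℝ) : ℕ :=
  ⌊(2 : ℝ) ^ ((ns : ℝ) * R)⌋₊

/-- An `(ns, nc, R₁, …, R_K)`-code: the encoder of the main base station, the encoders of the
helper base stations, and the decoders of the receivers. -/
structure Code {K : ℕ} (X W : Type*) (Y V U : Fin K → Type*) (ns nc : ℕ) (R : Fin K → ℝ) where
  enc : (Fin ns → X) → (Fin nc → W)
  helper : ∀ k, (Fin ns → V k) → Fin (numMessages ns (R k))
  dec : ∀ k, (Fin nc → U k) → (Fin ns → Y k) → Fin (numMessages ns (R k)) → (Fin ns → X)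

open Classical in
/-- The probability that receiver `k` does not recover the source sequence: the source letters
`s 1, …, s ns` are iid with pmf `P`, and the channel outputs `u 1, …, u nc` are drawn from the
codeword through the memoryless channel `T`. -/
def Code.errorProb [Fintype X] [∀ k, Fintype (Y k)] [∀ k, Fintype (V k)] [∀ k, Fintype (U k)]
    {ns nc : ℕ} {R : Fin K → ℝ} (c : Code X W Y V U ns nc R)
    (P : Letter X Y V → ℝ) (T : W → (∀ k, U k) → ℝ) (k : Fin K) : ℝ :=
  ∑ s : Fin ns → Letter X Y V, ∑ u : Fin nc → (∀ k, U k),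
    if c.dec k (fun i => u i k) (fun i => (s i).2.1 k) (c.helper k (fun i => (s i).2.2 k))
        ≠ (fun i => (s i).1)
    then (∏ i, P (s i)) * ∏ i, T (c.enc (fun j => (s j).1) i) (u i)
    else 0

/-- The source with pmf `P` is `(κ, R)`-achievable over the channel `T`: for every `ε > 0`, for all
sufficiently large `ns` and `nc` with `nc / ns = κ` there is an `(ns, nc, R₁, …, R_K)`-code with
error probability at most `ε` at every receiver. -/
def Achievable [Fintype X] [∀ k, Fintype (Y k)] [∀ k, Fintype (V k)] [∀ k, Fintype (U k)]
    (P : Letter X Y V → ℝ) (T : W → (∀ k, U k) → ℝ) (κ : ℚ) (R : Fin K → ℝ) : Prop :=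
  ∀ ε : ℝ, 0 < ε → ∃ N : ℕ, ∀ ns nc : ℕ, N ≤ ns → N ≤ nc → (nc : ℚ) / ns = κ →
    ∃ c : Code X W Y V U ns nc R, ∀ k, c.errorProb P T k ≤ ε

/-- The weaker notion of achievability that asks for such codes only at arbitrarily large
blocklengths, instead of at all sufficiently large ones. -/
def AchievableInfinitelyOften
    [Fintype X] [∀ k, Fintype (Y k)] [∀ k, Fintype (V k)] [∀ k, Fintype (U k)]
    (P : Letter X Y V → ℝ) (T : W → (∀ k, U k) → ℝ) (κ : ℚ) (R : Fin K → ℝ) : Prop :=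
  ∀ ε : ℝ, 0 < ε → ∀ N : ℕ, ∃ ns nc : ℕ, N ≤ ns ∧ N ≤ nc ∧ (nc : ℚ) / ns = κ ∧
    ∃ c : Code X W Y V U ns nc R, ∀ k, c.errorProb P T k ≤ ε

/-- The joint pmf `P_W(w) T(u₁, …, u_K | w)` of `(W, U₁, …, U_K)`. -/
def channelJoint (PW : W → ℝ) (T : W → (∀ k, U k) → ℝ) (z : W × (∀ k, U k)) : ℝ :=
  PW z.1 * T z.1 z.2

/-- The mutual information `I(W ; U_k)` for `(W, U₁, …, U_K) ∼ P_W T`. -/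
def channelInfo [Fintype W] [∀ k, Fintype (U k)]
    (PW : W → ℝ) (T : W → (∀ k, U k) → ℝ) (k : Fin K) : ℝ :=
  mutualInfo (channelJoint PW T) (fun z => z.1) (fun z => z.2 k)

/-- `Q` is a joint pmf of the source letter and auxiliary random variables `A₁, …, A_K` with finite
alphabets of sizes `m 1, …, m K`, such that the source letter has pmf `P` and
`(X, Y_k) ↔ V_k ↔ A_k` is a Markov chain for every `k`. -/
def IsAuxiliary [Fintype X] [∀ k, Fintype (Y k)] [∀ k, Fintype (V k)]
    (P : Letter X Y V → ℝ) (m : Fin K → ℕ) (Q : Letter X Y V × (∀ k, Fin (m k)) → ℝ) : Prop :=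
  Q ∈ stdSimplex ℝ (Letter X Y V × (∀ k, Fin (m k))) ∧
  law Q Prod.fst = P ∧
  ∀ k, IsMarkovChain Q (fun z => (z.1.1, z.1.2.1 k)) (fun z => z.1.2.2 k) (fun z => z.2 k)

/-- The quantity `I(V_k ; A_k | Y_k)`. -/
def helperInfo [Fintype X] [∀ k, Fintype (Y k)] [∀ k, Fintype (V k)]
    (m : Fin K → ℕ) (Q : Letter X Y V × (∀ k, Fin (m k)) → ℝ) (k : Fin K) : ℝ :=
  condMutualInfo Q (fun z => z.1.2.2 k) (fun z => z.2 k) (fun z => z.1.2.1 k)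

/-- The quantity `H(X | A_k, Y_k)`. -/
def equivocation [Fintype X] [∀ k, Fintype (Y k)] [∀ k, Fintype (V k)]
    (m : Fin K → ℕ) (Q : Letter X Y V × (∀ k, Fin (m k)) → ℝ) (k : Fin K) : ℝ :=
  condEntropy Q (fun z => z.1.1) (fun z => (z.2 k, z.1.2.1 k))

end Model

end BSCoop

end

/-! Achievability is random coding: quantize and bin at the helpers, joint source-channel coding at
the encoder. Every source block receives its own iid channel codeword. Helper `k` covers the
`V_k`-block by an iid codebook for `A_k` whose entries are indexed by (bin, position), and sends
only the bin. Covering needs about 2^(n I(V;A)) entries, and side information resolves about 2^(n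
I(A;Y)) entries per bin, so the rate is I(V;A) - I(A;Y), which equals I(V;A|Y) by the Markov chain
(`helperInfo_eq`). Given A and Y about 2^(n H(X|A,Y)) source blocks remain plausible, and the
channel separates them when H(X|A,Y) < κ I(W;U). `exists_code_of_codebook` is a one-shot form of
this argument, built on soft covering (`sum_iid_mul_abs_le`) and a comparison with the likelihood
encoder (`exists_helper`); the law of large numbers then makes each error term small
(`exists_forall_codebook_bound`). The error bound of each receiver depends only on the shared
channel codebook, so summing the bounds over receivers before averaging yields one encoder that
suits all of them.

The converse works with entropies of unnormalized measures (`hEnt`), which are homogeneous and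
superadditive; conditional entropies become sums over fibres. A helper message m is a density ρ_m(v)
on blocks of `V_k`, with ∑ ρ_m = 1. Peeling off one letter at a time writes a lower bound for
H(X^n|M,Y^n) and an upper bound for H(X^n,V^n|M,Y^n) as one sum over single-letter densities
(`exists_mem_tiltCone`); the same auxiliary variable serves both since both are split by the same
chain rule. Fano's inequality and concavity of mutual information bound the first quantity by the
channel, and counting messages bounds the second by the rate (`exists_tiltCone_of_code`).

After normalization, the single-letter data lie in the convex hull of a compact set, which is
compact by Carathéodory. Hence the input law and the data of all receivers converge along a common
subsequence, and a limit point over the uniform density is again a test channel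
(`exists_testChannel_of_mem_hull`). This removes the vanishing error terms without losing finiteness
of the auxiliary alphabets, and uses only infinitely many blocklengths. -/

noncomputable section

set_option linter.unusedSectionVars false

namespace BSCoop

open Finset Real

/-! ### Indicators and products of a pmf -/

section Indicator

open Classical in
/-- The indicator of a proposition, as a real number. -/
def ind (q : Prop) : ℝ := if q then 1 else 0

lemma ind_nonneg (q : Prop) : 0 ≤ ind q := by
  unfold ind; split_ifs <;> norm_num

lemma ind_le_one (q : Prop) : ind q ≤ 1 := by
  unfold ind; split_ifs <;> norm_num

lemma ind_of {q : Prop} (h : q) : ind q = 1 := if_pos h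

lemma ind_of_not {q : Prop} (h : ¬q) : ind q = 0 := if_neg h

lemma ind_le {q : Prop} {a : ℝ} (ha : 0 ≤ a) (h : q → 1 ≤ a) : ind q ≤ a := by
  by_cases hq : q
  · rw [ind_of hq]; exact h hq
  · rw [ind_of_not hq]; exact ha

end Indicator

/-! ### Moments and typicality of iid sequences -/

section Iid

variable {ι α β : Type*} [Fintype ι] [DecidableEq ι] [Fintype α] [Fintype β]

lemma sum_prod_pi (f : ι → α → ℝ) : ∑ c : ι → α, ∏ i, f i (c i) = ∏ i, ∑ a, f i a := by
  classical
  rw [Finset.prod_univ_sum, Fintype.piFinset_univ]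

lemma sum_iid {p : α → ℝ} (hp : ∑ a, p a = 1) : ∑ c : ι → α, ∏ i, p (c i) = 1 := by
  rw [sum_prod_pi (fun _ => p)]; simp [hp]

lemma sum_iid_mul_apply {p : α → ℝ} (hp : ∑ a, p a = 1) (i : ι) (F : α → ℝ) :
    ∑ c : ι → α, (∏ j, p (c j)) * F (c i) = ∑ a, p a * F a := by
  classical
  have h := sum_prod_pi (fun (j : ι) a => p a * if j = i then F a else 1)
  have h1 : ∀ c : ι → α, ∏ j, (p (c j) * if j = i then F (c j) else 1)
      = (∏ j, p (c j)) * F (c i) := by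
    intro c; rw [prod_mul_distrib]; simp
  simp only [h1] at h
  rw [h, Finset.prod_eq_single i]
  · simp
  · intro j _ hj; simp [hj, hp]
  · simp

lemma sum_iid_mul_apply_mul_apply {p : α → ℝ} (hp : ∑ a, p a = 1) {i j : ι} (hij : i ≠ j)
    (F G : α → ℝ) :
    ∑ c : ι → α, (∏ l, p (c l)) * (F (c i) * G (c j))
      = (∑ a, p a * F a) * ∑ a, p a * G a := by
  classical
  have h := sum_prod_pi
    (fun (l : ι) a => p a * ((if l = i then F a else 1) * if l = j then G a else 1))
  have h1 : ∀ c : ι → α, ∏ l, (p (c l) * ((if l = i then F (c l) else 1) *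
      if l = j then G (c l) else 1)) = (∏ l, p (c l)) * (F (c i) * G (c j)) := by
    intro c; rw [prod_mul_distrib, prod_mul_distrib]; simp
  simp only [h1] at h
  rw [h, Finset.prod_eq_mul i j hij]
  · simp [hij, hij.symm]
  · intro l _ hl; simp [hl.1, hl.2, hp]
  · simp
  · simp

/-- The second moment of a sum of iid centred random variables. -/
lemma sum_iid_mul_sq {p : α → ℝ} (hp : ∑ a, p a = 1) {g : α → ℝ} (hg : ∑ a, p a * g a = 0) :
    ∑ c : ι → α, (∏ j, p (c j)) * (∑ i, g (c i)) ^ 2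
      = Fintype.card ι * ∑ a, p a * g a ^ 2 := by
  classical
  have h : ∀ c : ι → α, (∏ j, p (c j)) * (∑ i, g (c i)) ^ 2
      = ∑ i, ∑ j, (∏ l, p (c l)) * (g (c i) * g (c j)) := by
    intro c
    rw [sq, sum_mul_sum, mul_sum]
    simp only [mul_sum]
  simp only [h]
  rw [sum_comm]
  have h2 : ∀ i : ι, ∑ c : ι → α, ∑ j, (∏ l, p (c l)) * (g (c i) * g (c j))
      = ∑ a, p a * g a ^ 2 := by
    intro i
    rw [sum_comm, Finset.sum_eq_single i]
    · have := sum_iid_mul_apply hp i (fun a => g a ^ 2)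
      simpa only [sq] using this
    · intro j _ hj
      rw [sum_iid_mul_apply_mul_apply hp hj.symm, hg, zero_mul]
    · simp
  simp [h2]

/-- The law of a letterwise image of a sequence of independent letters. -/
lemma sum_indep_comp (p : ι → α → ℝ) (φ : α → β) (F : (ι → β) → ℝ) :
    ∑ s : ι → α, (∏ i, p i (s i)) * F (fun i => φ (s i))
      = ∑ t : ι → β, (∏ i, law (p i) φ (t i)) * F t := by
  classical
  have h : ∀ t : ι → β, ∏ i, law (p i) φ (t i)
      = ∑ s : ι → α, if (fun i => φ (s i)) = t then ∏ i, p i (s i) else 0 := by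
    intro t
    have h1 : ∀ i, law (p i) φ (t i) = ∑ a, if φ a = t i then p i a else 0 := by
      intro i; unfold law; rw [Finset.sum_filter]
    simp only [h1]
    rw [← sum_prod_pi (fun i a => if φ a = t i then p i a else 0)]
    refine Finset.sum_congr rfl fun s _ => ?_
    rw [Finset.prod_ite_zero]
    simp [funext_iff]
  simp only [h, sum_mul, ite_mul, zero_mul]
  rw [sum_comm]
  simp

/-- Asymptotic equipartition: for an iid sequence, the product of likelihood ratios is unlikely to
be exponentially smaller than its typical value. -/
lemma exists_forall_sum_iid_ind_le {p : α → ℝ} (hp : p ∈ stdSimplex ℝ α) {num den : α → ℝ}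
    (hnum : ∀ a, p a ≠ 0 → 0 < num a) (hden : ∀ a, p a ≠ 0 → 0 < den a)
    {μ : ℝ} (hμ : ∑ a, p a * Real.logb 2 (num a / den a) = μ)
    {δ η : ℝ} (hδ : 0 < δ) (hη : 0 < η) :
    ∃ N : ℕ, ∀ n, N ≤ n → ∑ s : Fin n → α, (∏ i, p (s i)) *
      ind (∏ i, num (s i) ≤ 2 ^ ((n : ℝ) * (μ - δ)) * ∏ i, den (s i)) ≤ η := by
  -- Chebyshev's inequality for the centred log-likelihood ratio `g`: the event forces `∑ g ≤ -nδ`,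
  -- so its indicator is at most `(∑ g)² / (nδ)²`, whose mean is `σ / (nδ²)`.
  set g : α → ℝ := fun a => Real.logb 2 (num a / den a) - μ with hgdef
  have hg : ∑ a, p a * g a = 0 := by
    simp only [hgdef, mul_sub, sum_sub_distrib, hμ, ← sum_mul, hp.2]; ring
  set σ := ∑ a, p a * g a ^ 2
  have hσ : 0 ≤ σ := sum_nonneg fun a _ => mul_nonneg (hp.1 a) (sq_nonneg _)
  obtain ⟨N, hN⟩ := exists_nat_gt (σ / (η * δ ^ 2))
  refine ⟨N + 1, fun n hn => ?_⟩
  have hn0 : (0 : ℝ) < n := by exact_mod_cast (by omega : 0 < n)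
  have hnN : σ / (η * δ ^ 2) < n := hN.trans_le (by exact_mod_cast (by omega : N ≤ n))
  have key : ∀ s : Fin n → α, (∏ i, p (s i)) *
      ind (∏ i, num (s i) ≤ 2 ^ ((n : ℝ) * (μ - δ)) * ∏ i, den (s i))
      ≤ ((∏ i, p (s i)) * (∑ i, g (s i)) ^ 2) * (1 / (n * δ) ^ 2) := by
    intro s
    by_cases h0 : ∏ i, p (s i) = 0
    · simp [h0]
    have hpos : ∀ i, p (s i) ≠ 0 := fun i h => h0 (prod_eq_zero (mem_univ i) h)
    rw [mul_assoc]
    refine mul_le_mul_of_nonneg_left ?_ (prod_nonneg fun i _ => hp.1 _)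
    refine ind_le (by positivity) fun hle => ?_
    have hdp : 0 < ∏ i, den (s i) := prod_pos fun i _ => hden _ (hpos i)
    have hnp : 0 < ∏ i, num (s i) := prod_pos fun i _ => hnum _ (hpos i)
    have h1 : Real.logb 2 (∏ i, (num (s i) / den (s i))) ≤ n * (μ - δ) := by
      rw [prod_div_distrib, Real.logb_le_iff_le_rpow (by norm_num) (by positivity),
        div_le_iff₀ hdp]
      exact hle
    rw [Real.logb_prod _ (fun i => num (s i) / den (s i))
      fun i _ => (div_pos (hnum _ (hpos i)) (hden _ (hpos i))).ne'] at h1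
    have h2 : ∑ i, g (s i) ≤ -(n * δ) := by
      simp only [hgdef, sum_sub_distrib, sum_const, card_univ, Fintype.card_fin, nsmul_eq_mul]
      linarith
    have h3 : 0 < (n : ℝ) * δ := by positivity
    rw [mul_one_div, le_div_iff₀ (by positivity), one_mul]
    nlinarith
  refine (sum_le_sum fun s _ => key s).trans ?_
  rw [← sum_mul, sum_iid_mul_sq hp.2 hg, Fintype.card_fin]
  rw [div_lt_iff₀ (by positivity)] at hnN
  rw [mul_one_div, div_le_iff₀ (by positivity)]
  change (n : ℝ) * σ ≤ _
  nlinarith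

end Iid

/-! ### Averaging and soft covering -/

section Covering

variable {ι α : Type*} [Fintype ι] [DecidableEq ι] [Fintype α]

/-- The minimum does not exceed the mean; this derandomizes both codebooks. -/
lemma exists_le_of_sum_mul_le {w F : α → ℝ} (hw : ∀ a, 0 ≤ w a) (hw1 : ∑ a, w a = 1) {τ : ℝ}
    (h : ∑ a, w a * F a ≤ τ) : ∃ a, F a ≤ τ := by
  by_contra! hc
  have h1 : ∀ a ∈ univ, w a * τ ≤ w a * F a :=
    fun a _ => mul_le_mul_of_nonneg_left (hc a).le (hw a)
  have h2 : ∃ a, 0 < w a := by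
    by_contra! h0
    have : ∑ a, w a ≤ 0 := sum_nonpos fun a _ => h0 a
    linarith
  obtain ⟨a, ha⟩ := h2
  have h3 := sum_lt_sum h1 ⟨a, mem_univ a, mul_lt_mul_of_pos_left (hc a) ha⟩
  rw [← sum_mul, hw1] at h3
  linarith

/-- Soft covering: the empirical mean of a nonnegative `f` with mean `1` along an iid codebook is
close to `1` in mean, if `f` rarely exceeds a threshold that is small against the codebook size. -/
lemma sum_iid_mul_abs_le {p : α → ℝ} (hp : p ∈ stdSimplex ℝ α) {f : α → ℝ} (hf : ∀ a, 0 ≤ f a)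
    (hf1 : ∑ a, p a * f a = 1) {N γ s : ℝ} (hN : N = Fintype.card ι) (hN0 : 0 < N) (hs : 0 < s)
    (hγ0 : 0 ≤ γ) (hγ : γ ≤ s ^ 2 * N) :
    ∑ c : ι → α, (∏ j, p (c j)) * |1 - N⁻¹ * ∑ j, f (c j)|
      ≤ s + 2 * ∑ a, p a * (f a * ind (γ < f a)) := by
  -- Truncation at `γ`: the bounded part `f1` has second moment at most `γ`, while the tail `f2` is
  -- controlled only through its mean `m2`.
  set f2 : α → ℝ := fun a => f a * ind (γ < f a) with hf2
  set f1 : α → ℝ := fun a => f a - f2 a with hf1d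
  set m2 := ∑ a, p a * f2 a with hm2
  have hm1 : ∑ a, p a * f1 a = 1 - m2 := by
    simp only [hf1d, mul_sub, sum_sub_distrib, hf1, ← hm2]
  have hf2n : ∀ a, 0 ≤ f2 a := fun a => mul_nonneg (hf a) (ind_nonneg _)
  have hm2n : 0 ≤ m2 := sum_nonneg fun a _ => mul_nonneg (hp.1 a) (hf2n a)
  have hf1b : ∀ a, 0 ≤ f1 a ∧ f1 a ≤ γ := by
    intro a
    by_cases h : γ < f a
    · simp [hf1d, hf2, ind_of h, hγ0]
    · simp only [hf1d, hf2, ind_of_not h]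
      exact ⟨by simpa using hf a, by simpa using not_lt.1 h⟩
  set g : α → ℝ := fun a => f1 a - (1 - m2) with hg
  have hg0 : ∑ a, p a * g a = 0 := by
    simp only [hg, mul_sub (p _) (f1 _), sum_sub_distrib, hm1, ← sum_mul, hp.2]; ring
  have hvar : ∑ a, p a * g a ^ 2 ≤ γ := by
    have h1 : ∑ a, p a * g a ^ 2 = ∑ a, p a * f1 a ^ 2 - (1 - m2) ^ 2 := by
      have : ∀ a, p a * g a ^ 2
          = p a * f1 a ^ 2 - 2 * (1 - m2) * (p a * f1 a) + (1 - m2) ^ 2 * p a := by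
        intro a; simp only [hg]; ring
      simp only [this, sum_add_distrib, sum_sub_distrib, ← mul_sum, hm1, hp.2]; ring
    have h2 : ∑ a, p a * f1 a ^ 2 ≤ ∑ a, γ * (p a * f1 a) :=
      sum_le_sum fun a _ => by
        have := mul_le_mul_of_nonneg_left (mul_le_mul_of_nonneg_right (hf1b a).2 (hf1b a).1)
          (hp.1 a)
        linarith [this, sq (f1 a)]
    rw [← mul_sum, hm1] at h2
    nlinarith [sq_nonneg (1 - m2)]
  -- The inequality `|z| ≤ s/2 + z²/(2s)` replaces Cauchy–Schwarz, so only a second moment has to be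
  -- averaged. The tail enters twice: through its mean and through its empirical mean.
  have hpt : ∀ c : ι → α, |1 - N⁻¹ * ∑ j, f (c j)|
      ≤ (s / 2 + (∑ j, g (c j)) ^ 2 * (N⁻¹ ^ 2 / (2 * s))) + (m2 + ∑ j, N⁻¹ * f2 (c j)) := by
    intro c
    have h1 : 1 - N⁻¹ * ∑ j, f (c j)
        = -(N⁻¹ * ∑ j, g (c j)) + (m2 - ∑ j, N⁻¹ * f2 (c j)) := by
      have : ∑ j, g (c j) = ∑ j, f (c j) - ∑ j, f2 (c j) - N * (1 - m2) := by
        simp only [hg, hf1d, sum_sub_distrib, sum_const, card_univ, nsmul_eq_mul, hN]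
        ring
      rw [this, ← mul_sum]; field_simp; ring
    have h2 : 0 ≤ ∑ j, N⁻¹ * f2 (c j) :=
      sum_nonneg fun j _ => mul_nonneg (inv_nonneg.2 hN0.le) (hf2n _)
    rw [h1]
    refine (abs_add_le _ _).trans (add_le_add ?_ ?_)
    · rw [abs_neg]
      set z := N⁻¹ * ∑ j, g (c j)
      have : (∑ j, g (c j)) ^ 2 * (N⁻¹ ^ 2 / (2 * s)) = z ^ 2 / (2 * s) := by
        simp only [z]; ring
      rw [this]
      have h3 : |z| * (2 * s) ≤ s ^ 2 + z ^ 2 := by nlinarith [sq_nonneg (|z| - s), sq_abs z]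
      have h4 : s / 2 + z ^ 2 / (2 * s) = (s ^ 2 + z ^ 2) / (2 * s) := by field_simp
      rw [h4, le_div_iff₀ (by positivity)]
      exact h3
    · rw [abs_le]; constructor <;> linarith
  have hw : ∀ c : ι → α, 0 ≤ ∏ j, p (c j) := fun c => prod_nonneg fun j _ => hp.1 _
  have hE2 : ∑ c : ι → α, (∏ j, p (c j)) * ∑ j, N⁻¹ * f2 (c j) = m2 := by
    simp only [mul_sum]
    rw [sum_comm]
    have : ∀ j : ι, ∑ c : ι → α, (∏ j, p (c j)) * (N⁻¹ * f2 (c j)) = N⁻¹ * m2 := by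
      intro j
      rw [sum_iid_mul_apply hp.2 j (fun a => N⁻¹ * f2 a), hm2, mul_sum]
      exact sum_congr rfl fun a _ => by ring
    simp only [this, sum_const, card_univ, nsmul_eq_mul, ← hN]
    field_simp
  calc ∑ c : ι → α, (∏ j, p (c j)) * |1 - N⁻¹ * ∑ j, f (c j)|
      ≤ ∑ c : ι → α, (∏ j, p (c j)) *
        ((s / 2 + (∑ j, g (c j)) ^ 2 * (N⁻¹ ^ 2 / (2 * s))) + (m2 + ∑ j, N⁻¹ * f2 (c j))) :=
        sum_le_sum fun c _ => mul_le_mul_of_nonneg_left (hpt c) (hw c)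
    _ = s / 2 + N * (∑ a, p a * g a ^ 2) * (N⁻¹ ^ 2 / (2 * s)) + (m2 + m2) := by
        simp only [mul_add, sum_add_distrib, hE2, ← mul_assoc, ← sum_mul, sum_iid hp.2,
          sum_iid_mul_sq hp.2 hg0, ← hN, one_mul]
    _ ≤ s + 2 * m2 := by
        -- The variance of the empirical mean is at most `γ / N ≤ s²`; this is the only use of the
        -- codebook size.
        have h1 : N * (∑ a, p a * g a ^ 2) * (N⁻¹ ^ 2 / (2 * s)) ≤ s / 2 := by
          have : N * (∑ a, p a * g a ^ 2) * (N⁻¹ ^ 2 / (2 * s))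
            = (∑ a, p a * g a ^ 2) / (2 * s * N) := by field_simp
          rw [this, div_le_iff₀ (by positivity)]
          nlinarith
        linarith

end Covering

/-! ### A one-shot coding theorem -/

section OneShot

variable {X Y V A W U M L : Type*} [Fintype X] [Fintype Y] [Fintype V] [Fintype A] [Fintype W]
  [Fintype U] [Fintype M] [Fintype L]

/-- The marginal of `V`. -/
def margV (p : X → Y → V → ℝ) (v : V) : ℝ := ∑ x, ∑ y, p x y v

/-- The marginal of `Y`. -/
def margY (p : X → Y → V → ℝ) (y : Y) : ℝ := ∑ x, ∑ v, p x y v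

/-- The law of the output `A` of the test channel `q` applied to `V`. -/
def margA (p : X → Y → V → ℝ) (q : V → A → ℝ) (a : A) : ℝ := ∑ x, ∑ y, ∑ v, p x y v * q v a

/-- The joint law of `(A, Y)`. -/
def margAY (p : X → Y → V → ℝ) (q : V → A → ℝ) (a : A) (y : Y) : ℝ := ∑ x, ∑ v, p x y v * q v a

/-- The joint law of `(X, A, Y)`. -/
def margXAY (p : X → Y → V → ℝ) (q : V → A → ℝ) (x : X) (a : A) (y : Y) : ℝ :=
  ∑ v, p x y v * q v a

/-- The output law of the channel `t` with input law `pW`. -/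
def outLaw (pW : W → ℝ) (t : W → U → ℝ) (u : U) : ℝ := ∑ w, pW w * t w u

/-- The error probability of a code for one receiver. -/
def codeError (p : X → Y → V → ℝ) (t : W → U → ℝ) (enc : X → W) (helper : V → M)
    (dec : U → Y → M → X) : ℝ :=
  ∑ x, ∑ y, ∑ v, ∑ u, p x y v * t (enc x) u * ind (dec u y (helper v) ≠ x)

open Classical in
/-- A threshold decoder: its errors are covered by a union bound. -/
lemma exists_decoder [Nonempty X] (G₁ : A → Y → Prop) (G₂ : X → A → Y → Prop)
    (G₃ : W → U → Prop) (enc : X → W) (c : M × L → A) :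
    ∃ dec : U → Y → M → X, ∀ u y x m l, ind (dec u y m ≠ x) ≤
      (ind (¬G₁ (c (m, l)) y) + ind (¬G₂ x (c (m, l)) y) + ind (¬G₃ (enc x) u)
        + ∑ x', ind (x' ≠ x) * (ind (G₂ x' (c (m, l)) y) * ind (G₃ (enc x') u)))
      + ∑ l', ind (l' ≠ l) * ind (G₁ (c (m, l')) y) := by
  -- The decoder accepts any source block that passes all tests with some codeword of the announced
  -- bin; the position in the bin need not be recovered correctly.
  let good (u : U) (y : Y) (m : M) (x : X) : Prop :=
    ∃ l, G₁ (c (m, l)) y ∧ G₂ x (c (m, l)) y ∧ G₃ (enc x) u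
  refine ⟨fun u y m => if h : ∃ x, good u y m x then h.choose else Classical.arbitrary X,
    fun u y x m l => ?_⟩
  have n1 : 0 ≤ ∑ x', ind (x' ≠ x) * (ind (G₂ x' (c (m, l)) y) * ind (G₃ (enc x') u)) :=
    sum_nonneg fun _ _ => mul_nonneg (ind_nonneg _) (mul_nonneg (ind_nonneg _) (ind_nonneg _))
  have n2 : 0 ≤ ∑ l', ind (l' ≠ l) * ind (G₁ (c (m, l')) y) :=
    sum_nonneg fun _ _ => mul_nonneg (ind_nonneg _) (ind_nonneg _)
  have n3 := ind_nonneg (¬G₁ (c (m, l)) y)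
  have n4 := ind_nonneg (¬G₂ x (c (m, l)) y)
  have n5 := ind_nonneg (¬G₃ (enc x) u)
  refine ind_le (by linarith) fun hne => ?_
  by_cases h1 : G₁ (c (m, l)) y
  swap
  · rw [ind_of h1]; linarith
  by_cases h2 : G₂ x (c (m, l)) y
  swap
  · rw [ind_of h2]; linarith
  by_cases h3 : G₃ (enc x) u
  swap
  · rw [ind_of h3]; linarith
  have hex : ∃ x, good u y m x := ⟨x, l, h1, h2, h3⟩
  simp only [dif_pos hex] at hne
  obtain ⟨l', g1, g2, g3⟩ := hex.choose_spec
  -- A wrong decision is either a false source block with the true codeword, or comes from a false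
  -- codeword, which already passed the test against `Y`.
  by_cases hl : l' = l
  · subst hl
    have := single_le_sum
      (f := fun x' => ind (x' ≠ x) * (ind (G₂ x' (c (m, l')) y) * ind (G₃ (enc x') u)))
      (fun _ _ => mul_nonneg (ind_nonneg _) (mul_nonneg (ind_nonneg _) (ind_nonneg _)))
      (mem_univ hex.choose)
    simp only [ind_of hne, ind_of g2, ind_of g3] at this
    linarith
  · have := single_le_sum (f := fun l' => ind (l' ≠ l) * ind (G₁ (c (m, l')) y))
      (fun _ _ => mul_nonneg (ind_nonneg _) (ind_nonneg _)) (mem_univ l')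
    simp only [ind_of hl, ind_of g1] at this
    linarith

/-- The best deterministic quantizer is at least as good as the likelihood encoder. -/
lemma exists_helper {J : Type*} [Fintype J] [Nonempty J] {e : V → J → ℝ} {r : V → ℝ}
    (he : ∀ v j, 0 ≤ e v j) (her : ∀ v j, e v j ≤ r v) {ψ : J → V → ℝ} (hψ : ∀ j v, 0 ≤ ψ j v) :
    ∃ b : V → J, ∑ v, e v (b v) ≤
      ∑ v, ∑ j, ψ j v * e v j + ∑ v, r v * |1 - ∑ j, ψ j v| := by
  -- The weights `ψ` need not sum to one. The minimal cost is compared with the weighted cost, and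
  -- the missing mass is charged the trivial bound `r`.
  have hmin : ∀ v, ∃ j, ∀ j', e v j ≤ e v j' := fun v => Finite.exists_min (e v)
  choose b hb using hmin
  refine ⟨b, ?_⟩
  rw [← sum_add_distrib]
  refine sum_le_sum fun v _ => ?_
  have h1 : (∑ j, ψ j v) * e v (b v) ≤ ∑ j, ψ j v * e v j := by
    rw [sum_mul]
    exact sum_le_sum fun j _ => mul_le_mul_of_nonneg_left (hb v j) (hψ j v)
  have h2 : (1 - ∑ j, ψ j v) * e v (b v) ≤ r v * |1 - ∑ j, ψ j v| := by
    calc _ ≤ |1 - ∑ j, ψ j v| * e v (b v) :=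
          mul_le_mul_of_nonneg_right (le_abs_self _) (he _ _)
      _ ≤ |1 - ∑ j, ψ j v| * r v := mul_le_mul_of_nonneg_left (her _ _) (abs_nonneg _)
      _ = _ := mul_comm _ _
  linarith

section Averages

lemma sum_rotate (f : X → Y → V → ℝ) :
    ∑ x, ∑ y, ∑ v, f x y v = ∑ v, ∑ x, ∑ y, f x y v := by
  rw [sum_comm (s := univ (α := V))]
  exact sum_congr rfl fun x _ => sum_comm

lemma sum_mul_sum_rotate {E : Type*} [Fintype E] (w : E → ℝ) (k : X → Y → V → A → ℝ)
    (f : E → X → Y → A → ℝ) :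
    ∑ e, w e * ∑ x, ∑ y, ∑ v, ∑ a, k x y v a * f e x y a
      = ∑ x, ∑ y, ∑ v, ∑ a, k x y v a * ∑ e, w e * f e x y a := by
  simp only [mul_sum]
  rw [sum_comm]
  refine sum_congr rfl fun x _ => ?_
  rw [sum_comm]
  refine sum_congr rfl fun y _ => ?_
  rw [sum_comm]
  refine sum_congr rfl fun v _ => ?_
  rw [sum_comm]
  refine sum_congr rfl fun a _ => sum_congr rfl fun e _ => ?_
  ring

variable {p : X → Y → V → ℝ} {q : V → A → ℝ}

lemma sum_margA (hp1 : ∑ x, ∑ y, ∑ v, p x y v = 1) (hq1 : ∀ v, ∑ a, q v a = 1) :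
    ∑ a, margA p q a = 1 := by
  unfold margA
  rw [sum_comm, ← hp1]
  refine sum_congr rfl fun x _ => ?_
  rw [sum_comm]
  refine sum_congr rfl fun y _ => ?_
  rw [sum_comm]
  refine sum_congr rfl fun v _ => ?_
  rw [← mul_sum, hq1, mul_one]

lemma margA_nonneg (hp : ∀ x y v, 0 ≤ p x y v) (hq : ∀ v a, 0 ≤ q v a) (a : A) :
    0 ≤ margA p q a :=
  sum_nonneg fun x _ => sum_nonneg fun y _ => sum_nonneg fun v _ => mul_nonneg (hp x y v) (hq v a)

lemma margAY_nonneg (hp : ∀ x y v, 0 ≤ p x y v) (hq : ∀ v a, 0 ≤ q v a) (a : A) (y : Y) :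
    0 ≤ margAY p q a y :=
  sum_nonneg fun x _ => sum_nonneg fun v _ => mul_nonneg (hp x y v) (hq v a)

lemma margXAY_nonneg (hp : ∀ x y v, 0 ≤ p x y v) (hq : ∀ v a, 0 ≤ q v a) (x : X) (a : A)
    (y : Y) : 0 ≤ margXAY p q x a y :=
  sum_nonneg fun v _ => mul_nonneg (hp x y v) (hq v a)

lemma margV_nonneg (hp : ∀ x y v, 0 ≤ p x y v) (v : V) : 0 ≤ margV p v :=
  sum_nonneg fun x _ => sum_nonneg fun y _ => hp x y v

lemma sum_margV (hp1 : ∑ x, ∑ y, ∑ v, p x y v = 1) : ∑ v, margV p v = 1 := by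
  unfold margV
  rw [sum_comm, ← hp1]
  exact sum_congr rfl fun x _ => sum_comm

lemma sum_margAY (a : A) : ∑ y, margAY p q a y = margA p q a := by
  unfold margAY margA
  rw [sum_comm]

lemma sum_margXAY (a : A) (y : Y) : ∑ x, margXAY p q x a y = margAY p q a y := rfl

lemma margA_eq (a : A) : margA p q a = ∑ v, margV p v * q v a := by
  unfold margA margV
  simp only [sum_mul]
  exact sum_rotate _

/-- Reweighting a codeword drawn from `margA` by the likelihood ratio turns its law into the test
channel. Only an inequality holds where `margA` vanishes, since division by zero gives zero. -/
lemma margA_mul_div_le (hq : ∀ v a, 0 ≤ q v a) (a : A) (v : V) :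
    margA p q a * (q v a / margA p q a) ≤ q v a := by
  by_cases h : margA p q a = 0
  · rw [h, zero_mul]; exact hq v a
  · rw [mul_div_cancel₀ _ h]

/-- For `v` of positive probability, `q v` is absolutely continuous with respect to `margA`, so no
mass is lost in the reweighting. -/
lemma sum_margA_mul_div (hp : ∀ x y v, 0 ≤ p x y v) (hq : ∀ v a, 0 ≤ q v a)
    (hq1 : ∀ v, ∑ a, q v a = 1) {v : V} (hv : margV p v ≠ 0) :
    ∑ a, margA p q a * (q v a / margA p q a) = 1 := by
  rw [← hq1 v]
  refine sum_congr rfl fun a _ => ?_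
  by_cases h : margA p q a = 0
  · have h1 : margV p v * q v a = 0 := by
      rw [margA_eq, sum_eq_zero_iff_of_nonneg
        fun v _ => mul_nonneg (margV_nonneg hp v) (hq v a)] at h
      exact h v (mem_univ v)
    rw [h, zero_mul, (mul_eq_zero.1 h1).resolve_left hv]
  · rw [mul_div_cancel₀ _ h]

variable [DecidableEq M] [DecidableEq L]

/-- The average number of wrong codewords of a bin that pass the test against `Y`. -/
lemma sum_codebook_wrong_le (hp : ∀ x y v, 0 ≤ p x y v) (hp1 : ∑ x, ∑ y, ∑ v, p x y v = 1)
    (hq : ∀ v a, 0 ≤ q v a) (hq1 : ∀ v, ∑ a, q v a = 1) {γ : ℝ} (hγ : 0 < γ) (m : M) (l : L) :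
    ∑ c : M × L → A, (∏ j, margA p q (c j)) *
      ∑ v, q v (c (m, l)) / margA p q (c (m, l)) * ∑ l', ind (l' ≠ l) * ∑ x, ∑ y, p x y v *
        ind (γ * (margA p q (c (m, l')) * margY p y) < margAY p q (c (m, l')) y)
      ≤ ((Fintype.card L : ℝ) - 1) / γ := by
  have hA := margA_nonneg hp hq
  have hA1 := sum_margA hp1 hq1
  set G : A → Y → ℝ := fun a y => ind (γ * (margA p q a * margY p y) < margAY p q a y) with hG
  have hG0 : ∀ a y, 0 ≤ G a y := fun a y => ind_nonneg _
  -- Change of measure: where the test succeeds, the product law of an independent pair is at most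
  -- `1 / γ` times the joint law.
  have hpass : ∑ y, margY p y * ∑ a, margA p q a * G a y ≤ 1 / γ := by
    have h1 : ∀ y a, margY p y * (margA p q a * G a y) ≤ margAY p q a y / γ := by
      intro y a
      by_cases h : γ * (margA p q a * margY p y) < margAY p q a y
      · simp only [hG, ind_of h]
        rw [le_div_iff₀ hγ]; linarith
      · simp only [hG, ind_of_not h, mul_zero]
        exact div_nonneg (margAY_nonneg hp hq a y) hγ.le
    calc _ ≤ ∑ y, ∑ a, margAY p q a y / γ := by
          refine sum_le_sum fun y _ => ?_
          rw [mul_sum]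
          exact sum_le_sum fun a _ => h1 y a
      _ = 1 / γ := by
          rw [sum_comm]
          simp only [← sum_div, sum_margAY, hA1]
  have hl : ∀ l', ∑ c : M × L → A, (∏ j, margA p q (c j)) *
      ∑ v, q v (c (m, l)) / margA p q (c (m, l)) * (ind (l' ≠ l) * ∑ x, ∑ y, p x y v *
        G (c (m, l')) y) ≤ ind (l' ≠ l) * (1 / γ) := by
    intro l'
    by_cases hne : l' = l
    · rw [ind_of_not (not_not.2 hne)]; simp
    rw [ind_of hne]
    -- Distinct entries of the codebook are independent, so tilting the law of the true entry does
    -- not affect the false one.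
    have hne' : (m, l) ≠ (m, l') := fun h => hne (Prod.ext_iff.1 h).2.symm
    calc _ = ∑ v, ∑ x, ∑ y, p x y v * ∑ c : M × L → A, (∏ j, margA p q (c j)) *
            (q v (c (m, l)) / margA p q (c (m, l)) * G (c (m, l')) y) := by
          simp only [one_mul, mul_sum]
          rw [sum_comm]
          refine sum_congr rfl fun v _ => ?_
          rw [sum_comm]
          refine sum_congr rfl fun x _ => ?_
          rw [sum_comm]
          refine sum_congr rfl fun y _ => sum_congr rfl fun c _ => ?_
          ring
      _ ≤ ∑ v, ∑ x, ∑ y, p x y v * ∑ a, margA p q a * G a y := by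
          refine sum_le_sum fun v _ => sum_le_sum fun x _ => sum_le_sum fun y _ =>
            mul_le_mul_of_nonneg_left ?_ (hp x y v)
          rw [sum_iid_mul_apply_mul_apply hA1 hne' (fun a => q v a / margA p q a)
            (fun a => G a y)]
          refine mul_le_of_le_one_left
            (sum_nonneg fun a _ => mul_nonneg (hA a) (hG0 a y)) ?_
          exact (sum_le_sum fun a _ => margA_mul_div_le hq a v).trans (hq1 v).le
      _ = ∑ y, margY p y * ∑ a, margA p q a * G a y := by
          unfold margY
          simp only [sum_mul]
          rw [sum_comm]
          simp only [sum_comm (s := univ (α := V)) (t := univ (α := Y))]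
          rw [sum_comm]
      _ ≤ 1 * (1 / γ) := by rw [one_mul]; exact hpass
  calc _ = ∑ l', ∑ c : M × L → A, (∏ j, margA p q (c j)) *
      ∑ v, q v (c (m, l)) / margA p q (c (m, l)) * (ind (l' ≠ l) * ∑ x, ∑ y, p x y v *
        G (c (m, l')) y) := by
        rw [sum_comm]
        refine sum_congr rfl fun c _ => ?_
        rw [← mul_sum, sum_comm]
        simp only [mul_sum]
        rfl
    _ ≤ ∑ l', ind (l' ≠ l) * (1 / γ) := sum_le_sum fun l' _ => hl l'
    _ = ((Fintype.card L : ℝ) - 1) / γ := by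
        have : ∀ l' : L, ind (l' ≠ l) = 1 - if l' = l then 1 else 0 := by
          intro l'
          by_cases h : l' = l <;> simp [ind, h]
        rw [← sum_mul]
        simp only [this, sum_sub_distrib]
        simp
        ring

/-- The average over the channel codebook of the errors caused by the channel. -/
lemma sum_encoder_le [DecidableEq X] {pW : W → ℝ} {t : W → U → ℝ}
    (hp : ∀ x y v, 0 ≤ p x y v) (hp1 : ∑ x, ∑ y, ∑ v, p x y v = 1)
    (hq : ∀ v a, 0 ≤ q v a) (hq1 : ∀ v, ∑ a, q v a = 1)
    (hW : pW ∈ stdSimplex ℝ W) (ht : ∀ w, t w ∈ stdSimplex ℝ U) {γ γ' : ℝ} (hγ : 0 < γ)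
    (hγ' : 0 < γ') (F : X → Y → A → ℝ) :
    ∑ enc : X → W, (∏ x, pW (enc x)) * ∑ x, ∑ y, ∑ v, ∑ a, p x y v * q v a *
      ∑ u, t (enc x) u * (F x y a + ind (¬ γ' * outLaw pW t u < t (enc x) u)
        + ∑ x', ind (x' ≠ x) * (ind (margAY p q a y < γ * margXAY p q x' a y)
          * ind (γ' * outLaw pW t u < t (enc x') u)))
      ≤ ∑ x, ∑ y, ∑ v, ∑ a, p x y v * q v a * F x y a
        + ∑ w, ∑ u, pW w * t w u * ind (¬ γ' * outLaw pW t u < t w u) + γ / γ' := by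
  set H : W → U → ℝ := fun w u => ind (γ' * outLaw pW t u < t w u) with hH
  set G : X → A → Y → ℝ := fun x a y => ind (margAY p q a y < γ * margXAY p q x a y) with hG
  set e := ∑ w, ∑ u, pW w * t w u * ind (¬ γ' * outLaw pW t u < t w u) with he
  -- The same change of measure for the channel: an independent codeword passes the test with
  -- probability at most `1 / γ'`.
  have hwrong : ∑ u, outLaw pW t u * ∑ w, pW w * H w u ≤ 1 / γ' := by
    have h1 : ∀ u w, outLaw pW t u * (pW w * H w u) ≤ pW w * t w u / γ' := by
      intro u w
      by_cases h : γ' * outLaw pW t u < t w u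
      · simp only [hH, ind_of h]
        rw [le_div_iff₀ hγ']
        nlinarith [mul_le_mul_of_nonneg_left h.le (hW.1 w)]
      · simp only [hH, ind_of_not h, mul_zero]
        exact div_nonneg (mul_nonneg (hW.1 w) ((ht w).1 u)) hγ'.le
    calc _ ≤ ∑ u, ∑ w, pW w * t w u / γ' := by
          refine sum_le_sum fun u _ => ?_
          rw [mul_sum]
          exact sum_le_sum fun w _ => h1 u w
      _ = 1 / γ' := by
          rw [sum_comm]
          simp only [← sum_div, ← mul_sum, (ht _).2, mul_one, hW.2]
  -- At most `γ` source blocks can have conditional probability above `1 / γ`; multiplied by `1 /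
  -- γ'` this list size gives the term `γ / γ'`.
  have hlist : ∑ x, ∑ y, ∑ v, ∑ a, p x y v * q v a * ∑ x', G x' a y ≤ γ := by
    calc _ = ∑ y, ∑ a, margAY p q a y * ∑ x', G x' a y := by
          unfold margAY
          simp only [sum_mul]
          rw [sum_comm]
          refine sum_congr rfl fun y _ => ?_
          simp only [sum_comm (s := univ (α := V)) (t := univ (α := A))]
          rw [sum_comm]
      _ ≤ ∑ y, ∑ a, ∑ x', γ * margXAY p q x' a y := by
          refine sum_le_sum fun y _ => sum_le_sum fun a _ => ?_
          rw [mul_sum]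
          refine sum_le_sum fun x' _ => ?_
          by_cases h : margAY p q a y < γ * margXAY p q x' a y
          · simp only [hG, ind_of h]; linarith
          · simp only [hG, ind_of_not h, mul_zero]
            exact mul_nonneg hγ.le (margXAY_nonneg hp hq x' a y)
      _ = γ := by
          rw [sum_comm]
          simp only [← mul_sum, sum_margXAY, sum_margAY, sum_margA hp1 hq1, mul_one]
  have key : ∀ x y a, ∑ enc : X → W, (∏ x, pW (enc x)) *
      ∑ u, t (enc x) u * (F x y a + ind (¬ γ' * outLaw pW t u < t (enc x) u)
        + ∑ x', ind (x' ≠ x) * (G x' a y * H (enc x') u))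
      ≤ F x y a + e + (∑ x', G x' a y) * (1 / γ') := by
    intro x y a
    have h1 : ∀ enc : X → W, (∏ x, pW (enc x)) *
        ∑ u, t (enc x) u * (F x y a + ind (¬ γ' * outLaw pW t u < t (enc x) u)
          + ∑ x', ind (x' ≠ x) * (G x' a y * H (enc x') u))
        = (∏ x, pW (enc x)) * F x y a
          + (∏ x, pW (enc x)) * (∑ u, t (enc x) u * ind (¬ γ' * outLaw pW t u < t (enc x) u))
          + ∑ x', G x' a y * (ind (x' ≠ x) * ∑ u, (∏ x, pW (enc x)) *
            (t (enc x) u * H (enc x') u)) := by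
      intro enc
      simp only [mul_add, sum_add_distrib, ← sum_mul, (ht _).2, one_mul]
      congr 1
      simp only [mul_sum]
      rw [sum_comm]
      refine sum_congr rfl fun x' _ => sum_congr rfl fun u _ => ?_
      ring
    simp only [h1, sum_add_distrib]
    refine add_le_add (add_le_add ?_ ?_) ?_
    · rw [← sum_mul, sum_iid hW.2, one_mul]
    · rw [sum_iid_mul_apply hW.2 x
        (fun w => ∑ u, t w u * ind (¬ γ' * outLaw pW t u < t w u)), he]
      simp only [mul_sum, mul_assoc, le_refl]
    · rw [sum_comm, sum_mul]
      refine sum_le_sum fun x' _ => ?_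
      rw [← mul_sum]
      refine mul_le_mul_of_nonneg_left ?_ (ind_nonneg _)
      rw [← mul_sum]
      by_cases hx : x' = x
      · rw [ind_of_not (not_not.2 hx), zero_mul]; positivity
      -- For `x' ≠ x` the two channel codewords are independent, so the output produced by the first
      -- has law `outLaw` relative to the second.
      · rw [ind_of hx, one_mul, sum_comm]
        refine le_of_eq_of_le (sum_congr rfl fun u _ => ?_) hwrong
        rw [sum_iid_mul_apply_mul_apply hW.2 (Ne.symm hx) (fun w => t w u) (fun w => H w u)]
        rfl
  calc _ = ∑ x, ∑ y, ∑ v, ∑ a, p x y v * q v a * ∑ enc : X → W, (∏ x, pW (enc x)) *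
        ∑ u, t (enc x) u * (F x y a + ind (¬ γ' * outLaw pW t u < t (enc x) u)
        + ∑ x', ind (x' ≠ x) * (G x' a y * H (enc x') u)) := by
        exact sum_mul_sum_rotate _ (fun x y v a => p x y v * q v a) _
    _ ≤ ∑ x, ∑ y, ∑ v, ∑ a, p x y v * q v a *
          (F x y a + e + (∑ x', G x' a y) * (1 / γ')) :=
        sum_le_sum fun x _ => sum_le_sum fun y _ => sum_le_sum fun v _ => sum_le_sum fun a _ =>
          mul_le_mul_of_nonneg_left (key x y a) (mul_nonneg (hp x y v) (hq v a))
    _ = ∑ x, ∑ y, ∑ v, ∑ a, p x y v * q v a * F x y a + e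
        + (∑ x, ∑ y, ∑ v, ∑ a, p x y v * q v a * ∑ x', G x' a y) * (1 / γ') := by
        simp only [mul_add, sum_add_distrib, ← mul_assoc, ← sum_mul]
        simp only [← mul_sum, hq1, mul_one, hp1, one_mul]
    _ ≤ _ := by
        rw [div_eq_mul_one_div γ γ']
        gcongr

end Averages

end OneShot

section OneShotTheorem

variable {X Y V A W U M L : Type*} [Fintype X] [Fintype Y] [Fintype V] [Fintype A] [Fintype W]
  [Fintype U] [Fintype M] [Fintype L]

variable {p : X → Y → V → ℝ} {q : V → A → ℝ}

/-- A codeword reweighted by the likelihood ratio behaves like the test channel output of the actual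
`V`; a nonnegative cost makes the one-sided reweighting sufficient. -/
lemma sum_margA_mul_le (hp : ∀ x y v, 0 ≤ p x y v) (hq : ∀ v a, 0 ≤ q v a) {f : X → Y → A → ℝ}
    (hf : ∀ x y a, 0 ≤ f x y a) :
    ∑ a, margA p q a * ∑ v, q v a / margA p q a * ∑ x, ∑ y, p x y v * f x y a
      ≤ ∑ x, ∑ y, ∑ v, ∑ a, p x y v * q v a * f x y a := by
  rw [sum_rotate]
  simp only [mul_sum]
  rw [sum_comm]
  refine sum_le_sum fun v _ => ?_
  rw [sum_comm]
  refine sum_le_sum fun x _ => ?_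
  rw [sum_comm]
  refine sum_le_sum fun y _ => sum_le_sum fun a _ => ?_
  rw [← mul_assoc, mul_comm (p x y v) (q v a), mul_assoc (q v a)]
  exact mul_le_mul_of_nonneg_right (margA_mul_div_le hq a v) (mul_nonneg (hp x y v) (hf x y a))

/-- Soft covering for the codebook of the helper. -/
lemma sum_codebook_covering_le [DecidableEq M] [DecidableEq L] [Nonempty M] [Nonempty L]
    (hp : ∀ x y v, 0 ≤ p x y v) (hp1 : ∑ x, ∑ y, ∑ v, p x y v = 1)
    (hq : ∀ v a, 0 ≤ q v a) (hq1 : ∀ v, ∑ a, q v a = 1) {N γ s : ℝ} (hγ : 0 ≤ γ) (hs : 0 < s)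
    (hN : N = Fintype.card (M × L)) (hγs : γ ≤ s ^ 2 * N) :
    ∑ c : M × L → A, (∏ j, margA p q (c j)) *
      ∑ v, margV p v * |1 - ∑ j, N⁻¹ * (q v (c j) / margA p q (c j))|
      ≤ s + 2 * ∑ x, ∑ y, ∑ v, ∑ a, p x y v * q v a * ind (γ * margA p q a < q v a) := by
  have hA : margA p q ∈ stdSimplex ℝ A := ⟨margA_nonneg hp hq, sum_margA hp1 hq1⟩
  have hN0 : 0 < N := by rw [hN]; exact_mod_cast Fintype.card_pos
  have hv : ∀ v, margV p v * ∑ c : M × L → A, (∏ j, margA p q (c j)) *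
      |1 - ∑ j, N⁻¹ * (q v (c j) / margA p q (c j))|
      ≤ margV p v * (s + 2 * ∑ a, q v a * ind (γ * margA p q a < q v a)) := by
    intro v
    by_cases h0 : margV p v = 0
    · simp [h0]
    refine mul_le_mul_of_nonneg_left ?_ (margV_nonneg hp v)
    have h := sum_iid_mul_abs_le (ι := M × L) hA (f := fun a => q v a / margA p q a)
      (fun a => div_nonneg (hq v a) (hA.1 a)) (sum_margA_mul_div hp hq hq1 h0) hN hN0 hs hγ hγs
    simp only [mul_sum] at h ⊢
    refine h.trans (add_le_add le_rfl (sum_le_sum fun a _ => ?_))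
    refine mul_le_mul_of_nonneg_left ?_ zero_le_two
    rcases (hA.1 a).eq_or_lt with ha | ha
    · rw [← ha, zero_mul]
      exact mul_nonneg (hq v a) (ind_nonneg _)
    · rw [← mul_assoc, mul_div_cancel₀ _ ha.ne']
      refine mul_le_mul_of_nonneg_left (ind_le (ind_nonneg _) fun hlt => ?_) (hq v a)
      rw [ind_of ((lt_div_iff₀ ha).1 hlt)]
  calc _ = ∑ v, margV p v * ∑ c : M × L → A, (∏ j, margA p q (c j)) *
      |1 - ∑ j, N⁻¹ * (q v (c j) / margA p q (c j))| := by
        generalize hf : (fun (c : M × L → A) v =>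
          |1 - ∑ j, N⁻¹ * (q v (c j) / margA p q (c j))|) = f
        have hf' : ∀ (c : M × L → A) v,
          |1 - ∑ j, N⁻¹ * (q v (c j) / margA p q (c j))| = f c v := fun c v => by rw [← hf]
        simp only [hf', mul_sum]
        rw [sum_comm]
        exact sum_congr rfl fun v _ => sum_congr rfl fun c _ => by ring
    _ ≤ ∑ v, margV p v * (s + 2 * ∑ a, q v a * ind (γ * margA p q a < q v a)) :=
        sum_le_sum fun v _ => hv v
    _ = s + 2 * ∑ x, ∑ y, ∑ v, ∑ a, p x y v * q v a * ind (γ * margA p q a < q v a) := by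
        simp only [mul_add, sum_add_distrib, ← sum_mul, sum_margV hp1, one_mul]
        rw [sum_rotate, mul_sum]
        congr 1
        refine sum_congr rfl fun v _ => ?_
        simp only [mul_assoc, ← mul_sum, ← sum_mul, margV]
        ring

/-- One-shot coding theorem: for a random channel codebook, the helper and the decoder can be
chosen such that the error probability is small on average. -/
theorem exists_code_of_codebook [DecidableEq X] [Nonempty X] [Nonempty M] [Nonempty L]
    {pW : W → ℝ} {t : W → U → ℝ}
    (hp : ∀ x y v, 0 ≤ p x y v) (hp1 : ∑ x, ∑ y, ∑ v, p x y v = 1)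
    (hq : ∀ v a, 0 ≤ q v a) (hq1 : ∀ v, ∑ a, q v a = 1)
    (hW : pW ∈ stdSimplex ℝ W) (ht : ∀ w, t w ∈ stdSimplex ℝ U) {γ₁ γ₂ γ₃ γ₄ s : ℝ}
    (hγ₁ : 0 < γ₁) (hγ₂ : 0 < γ₂) (hγ₃ : 0 < γ₃) (hγ₄ : 0 ≤ γ₄) (hs : 0 < s)
    (hγs : γ₄ ≤ s ^ 2 * (Fintype.card M * Fintype.card L)) :
    ∃ B : (X → W) → ℝ,
      (∀ enc, ∃ (helper : V → M) (dec : U → Y → M → X), codeError p t enc helper dec ≤ B enc) ∧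
      ∑ enc : X → W, (∏ x, pW (enc x)) * B enc ≤
        ∑ x, ∑ y, ∑ v, ∑ a, p x y v * q v a *
          (ind (¬ γ₁ * (margA p q a * margY p y) < margAY p q a y)
            + ind (¬ margAY p q a y < γ₂ * margXAY p q x a y))
        + ∑ w, ∑ u, pW w * t w u * ind (¬ γ₃ * outLaw pW t u < t w u) + γ₂ / γ₃
        + (((Fintype.card L : ℝ) - 1) / γ₁
          + (s + 2 * ∑ x, ∑ y, ∑ v, ∑ a, p x y v * q v a * ind (γ₄ * margA p q a < q v a))) := by
  classical
  set N : ℝ := (Fintype.card (M × L) : ℝ) with hN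
  have hN' : N = Fintype.card M * Fintype.card L := by rw [hN, Fintype.card_prod]; push_cast; ring
  have hN0 : 0 < N := by rw [hN]; exact_mod_cast Fintype.card_pos
  rw [← hN'] at hγs
  have hA := margA_nonneg hp hq
  have hA1 := sum_margA hp1 hq1
  set soft := s + 2 * ∑ x, ∑ y, ∑ v, ∑ a, p x y v * q v a * ind (γ₄ * margA p q a < q v a)
  set main : (X → W) → X → Y → U → A → ℝ := fun enc x y u a =>
    (ind (¬ γ₁ * (margA p q a * margY p y) < margAY p q a y)
      + ind (¬ margAY p q a y < γ₂ * margXAY p q x a y))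
      + ind (¬ γ₃ * outLaw pW t u < t (enc x) u)
      + ∑ x', ind (x' ≠ x) * (ind (margAY p q a y < γ₂ * margXAY p q x' a y)
          * ind (γ₃ * outLaw pW t u < t (enc x') u)) with hmain
  have hmain0 : ∀ enc x y u a, 0 ≤ main enc x y u a := fun enc x y u a =>
    add_nonneg (add_nonneg (add_nonneg (ind_nonneg _) (ind_nonneg _)) (ind_nonneg _))
      (sum_nonneg fun _ _ => mul_nonneg (ind_nonneg _) (mul_nonneg (ind_nonneg _) (ind_nonneg _)))
  -- The bound is an explicit functional of `enc` alone: the helper codebook is averaged out with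
  -- `enc` held fixed, so that receivers with different helpers can later share one encoder.
  refine ⟨fun enc => ∑ x, ∑ y, ∑ v, ∑ a, p x y v * q v a * ∑ u, t (enc x) u * main enc x y u a
    + (((Fintype.card L : ℝ) - 1) / γ₁ + soft), fun enc => ?_, ?_⟩
  swap
  · simp only [mul_add (∏ x, pW _), sum_add_distrib, ← sum_mul, sum_iid hW.2, one_mul]
    exact add_le_add (sum_encoder_le hp hp1 hq hq1 hW ht hγ₂ hγ₃ _) le_rfl
  -- `Ψ` is the cost attached to the true codeword and `Θ` that of false codewords in its bin, both
  -- weighted by the likelihood encoder.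
  set Ψ : A → ℝ := fun a => ∑ v, q v a / margA p q a *
    ∑ x, ∑ y, p x y v * ∑ u, t (enc x) u * main enc x y u a with hΨ
  set Θ : (M × L → A) → M × L → ℝ := fun c j => ∑ v, q v (c j) / margA p q (c j) *
    ∑ l', ind (l' ≠ j.2) * ∑ x, ∑ y, p x y v *
      ind (γ₁ * (margA p q (c (j.1, l')) * margY p y) < margAY p q (c (j.1, l')) y) with hΘ
  have hΨle : ∑ a, margA p q a * Ψ a
      ≤ ∑ x, ∑ y, ∑ v, ∑ a, p x y v * q v a * ∑ u, t (enc x) u * main enc x y u a := by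
    have h0 : ∀ x y a, 0 ≤ ∑ u, t (enc x) u * main enc x y u a := fun x y a =>
      sum_nonneg fun u _ => mul_nonneg ((ht _).1 u) (hmain0 enc x y u a)
    exact sum_margA_mul_le hp hq h0
  have hE : ∑ c : M × L → A, (∏ j, margA p q (c j)) * (N⁻¹ * ∑ j, (Ψ (c j) + Θ c j)
      + ∑ v, margV p v * |1 - ∑ j, N⁻¹ * (q v (c j) / margA p q (c j))|)
      ≤ ∑ x, ∑ y, ∑ v, ∑ a, p x y v * q v a * ∑ u, t (enc x) u * main enc x y u a
        + (((Fintype.card L : ℝ) - 1) / γ₁ + soft) := by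
    simp only [mul_add (∏ j, margA p q _), sum_add_distrib]
    rw [← add_assoc]
    refine add_le_add ?_ (sum_codebook_covering_le hp hp1 hq hq1 hγ₄ hs hN hγs)
    have h1 : ∑ c : M × L → A, (∏ j, margA p q (c j)) * (N⁻¹ * (∑ j, Ψ (c j) + ∑ j, Θ c j))
        = ∑ j, N⁻¹ * (∑ c : M × L → A, (∏ j, margA p q (c j)) * Ψ (c j)
          + ∑ c : M × L → A, (∏ j, margA p q (c j)) * Θ c j) := by
      simp only [← sum_add_distrib, mul_sum]
      rw [sum_comm]
      exact sum_congr rfl fun j _ => sum_congr rfl fun c _ => by ring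
    rw [h1]
    have h2 : ∀ j : M × L, N⁻¹ * (∑ c : M × L → A, (∏ j, margA p q (c j)) * Ψ (c j)
          + ∑ c : M × L → A, (∏ j, margA p q (c j)) * Θ c j)
        ≤ N⁻¹ * (∑ x, ∑ y, ∑ v, ∑ a, p x y v * q v a * ∑ u, t (enc x) u * main enc x y u a
          + ((Fintype.card L : ℝ) - 1) / γ₁) := by
      intro j
      refine mul_le_mul_of_nonneg_left (add_le_add ?_ ?_) (inv_nonneg.2 hN0.le)
      · rw [sum_iid_mul_apply hA1 j Ψ]; exact hΨle
      · exact sum_codebook_wrong_le hp hp1 hq hq1 hγ₁ j.1 j.2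
    refine (sum_le_sum fun j _ => h2 j).trans ?_
    rw [sum_const, card_univ, nsmul_eq_mul, ← hN, ← mul_assoc, mul_inv_cancel₀ hN0.ne', one_mul]
  obtain ⟨c, hc⟩ := exists_le_of_sum_mul_le
    (fun c : M × L → A => prod_nonneg fun j _ => hA (c j)) (sum_iid hA1) hE
  obtain ⟨dec, hdec⟩ := exists_decoder (M := M) (L := L)
    (fun a y => γ₁ * (margA p q a * margY p y) < margAY p q a y)
    (fun x a y => margAY p q a y < γ₂ * margXAY p q x a y)
    (fun w u => γ₃ * outLaw pW t u < t w u) enc c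
  set e : V → M × L → ℝ := fun v j =>
    ∑ x, ∑ y, p x y v * ∑ u, t (enc x) u * ind (dec u y j.1 ≠ x) with he
  have he0 : ∀ v j, 0 ≤ e v j := fun v j => sum_nonneg fun x _ => sum_nonneg fun y _ =>
    mul_nonneg (hp x y v) (sum_nonneg fun u _ => mul_nonneg ((ht _).1 u) (ind_nonneg _))
  have her : ∀ v j, e v j ≤ margV p v := fun v j => sum_le_sum fun x _ => sum_le_sum fun y _ => by
    refine mul_le_of_le_one_right (hp x y v) ?_
    rw [← (ht (enc x)).2]
    exact sum_le_sum fun u _ => mul_le_of_le_one_right ((ht _).1 u) (ind_le_one _)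
  obtain ⟨b, hb⟩ := exists_helper he0 her (ψ := fun j v => N⁻¹ * (q v (c j) / margA p q (c j)))
    (fun j v => mul_nonneg (inv_nonneg.2 hN0.le) (div_nonneg (hq _ _) (hA _)))
  refine ⟨fun v => (b v).1, dec, ?_⟩
  refine le_trans (le_of_eq ?_) (hb.trans (le_trans (add_le_add ?_ le_rfl) hc))
  · unfold codeError
    rw [sum_rotate]
    refine sum_congr rfl fun v _ => ?_
    simp only [he]
    refine sum_congr rfl fun x _ => sum_congr rfl fun y _ => ?_
    rw [mul_sum]
    exact sum_congr rfl fun u _ => by ring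
  · have hle : ∀ v j, e v j ≤ ∑ x, ∑ y, p x y v * ∑ u, t (enc x) u * main enc x y u (c j)
        + ∑ l', ind (l' ≠ j.2) * ∑ x, ∑ y, p x y v *
          ind (γ₁ * (margA p q (c (j.1, l')) * margY p y) < margAY p q (c (j.1, l')) y) := by
      intro v j
      have h1 : ∑ l', ind (l' ≠ j.2) * ∑ x, ∑ y, p x y v *
          ind (γ₁ * (margA p q (c (j.1, l')) * margY p y) < margAY p q (c (j.1, l')) y)
          = ∑ x, ∑ y, p x y v * ∑ l', ind (l' ≠ j.2) *
          ind (γ₁ * (margA p q (c (j.1, l')) * margY p y) < margAY p q (c (j.1, l')) y) := by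
        simp only [mul_sum]
        rw [sum_comm]
        refine sum_congr rfl fun x _ => ?_
        rw [sum_comm]
        exact sum_congr rfl fun y _ => sum_congr rfl fun l _ => by ring
      rw [h1, ← sum_add_distrib]
      refine sum_le_sum fun x _ => ?_
      rw [← sum_add_distrib]
      refine sum_le_sum fun y _ => ?_
      rw [← mul_add]
      refine mul_le_mul_of_nonneg_left ?_ (hp x y v)
      set z := ∑ l', ind (l' ≠ j.2) *
          ind (γ₁ * (margA p q (c (j.1, l')) * margY p y) < margAY p q (c (j.1, l')) y)
      have hz : z = ∑ u, t (enc x) u * z := by rw [← sum_mul, (ht _).2, one_mul]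
      rw [hz, ← sum_add_distrib]
      refine sum_le_sum fun u _ => ?_
      rw [← mul_add]
      exact mul_le_mul_of_nonneg_left (hdec u y x j.1 j.2) ((ht _).1 u)
    calc _ ≤ ∑ v, ∑ j, N⁻¹ * (q v (c j) / margA p q (c j)) *
          (∑ x, ∑ y, p x y v * ∑ u, t (enc x) u * main enc x y u (c j)
          + ∑ l', ind (l' ≠ j.2) * ∑ x, ∑ y, p x y v *
          ind (γ₁ * (margA p q (c (j.1, l')) * margY p y) < margAY p q (c (j.1, l')) y)) :=
          sum_le_sum fun v _ => sum_le_sum fun j _ => mul_le_mul_of_nonneg_left (hle v j)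
            (mul_nonneg (inv_nonneg.2 hN0.le) (div_nonneg (hq _ _) (hA _)))
      _ = N⁻¹ * ∑ j, (Ψ (c j) + Θ c j) := by
          rw [sum_comm, mul_sum]
          refine sum_congr rfl fun j _ => ?_
          simp only [hΨ, hΘ]
          rw [← sum_add_distrib, mul_sum]
          refine sum_congr rfl fun v _ => ?_
          rw [← mul_add, mul_assoc]
      _ ≤ _ := le_rfl

end OneShotTheorem

/-! ### Block laws, memoryless channels and typicality -/

section Blocks

variable {ι X Y V A W U : Type*} [Fintype ι] [DecidableEq ι] [Fintype X] [Fintype Y] [Fintype V]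
  [Fintype A] [Fintype W] [Fintype U]

/-- The pmf of a block of iid source letters. -/
def blockPmf (ι : Type*) [Fintype ι] (p : X → Y → V → ℝ) (x : ι → X) (y : ι → Y) (v : ι → V) : ℝ :=
  ∏ i, p (x i) (y i) (v i)

/-- Memoryless uses of a channel. -/
def blockChannel (ι : Type*) [Fintype ι] (q : V → A → ℝ) (v : ι → V) (a : ι → A) : ℝ :=
  ∏ i, q (v i) (a i)

lemma sum_sum_arrow (F : (ι → X) → (ι → Y) → ℝ) :
    ∑ x : ι → X, ∑ y : ι → Y, F x y
      = ∑ s : ι → X × Y, F (fun i => (s i).1) (fun i => (s i).2) := by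
  rw [← Fintype.sum_prod_type']
  exact ((Equiv.arrowProdEquivProdArrow ι (fun _ => X) (fun _ => Y)).sum_comp
    (fun z => F z.1 z.2)).symm

lemma sum_sum_sum_arrow (F : (ι → X) → (ι → Y) → (ι → V) → ℝ) :
    ∑ x : ι → X, ∑ y : ι → Y, ∑ v : ι → V, F x y v
      = ∑ s : ι → X × Y × V, F (fun i => (s i).1) (fun i => (s i).2.1) (fun i => (s i).2.2) := by
  simp only [sum_sum_arrow (X := Y) (Y := V)]
  rw [sum_sum_arrow (X := X) (Y := Y × V)
    (F := fun x z => F x (fun i => (z i).1) (fun i => (z i).2))]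

lemma sum_sum_sum_sum_arrow (F : (ι → X) → (ι → Y) → (ι → V) → (ι → A) → ℝ) :
    ∑ x : ι → X, ∑ y : ι → Y, ∑ v : ι → V, ∑ a : ι → A, F x y v a
      = ∑ s : ι → X × Y × V × A, F (fun i => (s i).1) (fun i => (s i).2.1)
        (fun i => (s i).2.2.1) (fun i => (s i).2.2.2) := by
  simp only [sum_sum_sum_arrow (X := Y) (Y := V) (V := A)]
  rw [sum_sum_arrow (X := X) (Y := Y × V × A)
    (F := fun x z => F x (fun i => (z i).1) (fun i => (z i).2.1) (fun i => (z i).2.2))]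

lemma sum_prod_pi₂ (f : ι → X → Y → ℝ) :
    ∑ x : ι → X, ∑ y : ι → Y, ∏ i, f i (x i) (y i) = ∏ i, ∑ x, ∑ y, f i x y := by
  rw [← sum_prod_pi (fun i x => ∑ y, f i x y)]
  exact sum_congr rfl fun x _ => sum_prod_pi (fun i y => f i (x i) y)

lemma sum_prod_pi₃ (f : ι → X → Y → V → ℝ) :
    ∑ x : ι → X, ∑ y : ι → Y, ∑ v : ι → V, ∏ i, f i (x i) (y i) (v i)
      = ∏ i, ∑ x, ∑ y, ∑ v, f i x y v := by
  rw [← sum_prod_pi₂ (fun i x y => ∑ v, f i x y v)]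
  exact sum_congr rfl fun x _ => sum_congr rfl fun y _ => sum_prod_pi (fun i v => f i (x i) (y i) v)

variable {p : X → Y → V → ℝ} {q : V → A → ℝ}

lemma margA_block (a : ι → A) :
    margA (blockPmf ι p) (blockChannel ι q) a = ∏ i, margA p q (a i) := by
  simp only [margA, blockPmf, blockChannel, ← prod_mul_distrib]
  exact sum_prod_pi₃ (fun i x y v => p x y v * q v (a i))

lemma margY_block (y : ι → Y) : margY (blockPmf ι p) y = ∏ i, margY p (y i) := by
  simp only [margY, blockPmf]
  exact sum_prod_pi₂ (fun i x v => p x (y i) v)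

lemma margAY_block (a : ι → A) (y : ι → Y) :
    margAY (blockPmf ι p) (blockChannel ι q) a y = ∏ i, margAY p q (a i) (y i) := by
  simp only [margAY, blockPmf, blockChannel, ← prod_mul_distrib]
  exact sum_prod_pi₂ (fun i x v => p x (y i) v * q v (a i))

lemma margXAY_block (x : ι → X) (a : ι → A) (y : ι → Y) :
    margXAY (blockPmf ι p) (blockChannel ι q) x a y = ∏ i, margXAY p q (x i) (a i) (y i) := by
  simp only [margXAY, blockPmf, blockChannel, ← prod_mul_distrib]
  exact sum_prod_pi (fun i v => p (x i) (y i) v * q v (a i))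

lemma outLaw_block (pW : W → ℝ) (t : W → U → ℝ) (u : ι → U) :
    outLaw (fun w : ι → W => ∏ i, pW (w i)) (blockChannel ι t) u = ∏ i, outLaw pW t (u i) := by
  simp only [outLaw, blockChannel, ← prod_mul_distrib]
  exact sum_prod_pi (fun i w => pW w * t w (u i))

lemma blockChannel_mem_stdSimplex {t : W → U → ℝ} (ht : ∀ w, t w ∈ stdSimplex ℝ U) (w : ι → W) :
    blockChannel ι t w ∈ stdSimplex ℝ (ι → U) := by
  refine ⟨fun u => prod_nonneg fun i _ => (ht _).1 _, ?_⟩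
  simp only [blockChannel]
  rw [sum_prod_pi (fun i u => t (w i) u)]
  simp [(ht _).2]

lemma prod_mem_stdSimplex {pW : W → ℝ} (hW : pW ∈ stdSimplex ℝ W) :
    (fun w : ι → W => ∏ i, pW (w i)) ∈ stdSimplex ℝ (ι → W) :=
  ⟨fun _ => prod_nonneg fun _ _ => hW.1 _, sum_iid hW.2⟩

lemma sum_blockPmf (hp1 : ∑ x, ∑ y, ∑ v, p x y v = 1) :
    ∑ x, ∑ y, ∑ v, blockPmf ι p x y v = 1 := by
  simp only [blockPmf]
  rw [sum_prod_pi₃ (fun _ => p)]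
  simp [hp1]

/-- Asymptotic equipartition for a source block and the output of the test channel. -/
lemma exists_forall_sum_block_ind_le (hp : ∀ x y v, 0 ≤ p x y v)
    (hp1 : ∑ x, ∑ y, ∑ v, p x y v = 1) (hq : ∀ v a, 0 ≤ q v a) (hq1 : ∀ v, ∑ a, q v a = 1)
    {num den : X → Y → V → A → ℝ}
    (hnum : ∀ x y v a, p x y v * q v a ≠ 0 → 0 < num x y v a)
    (hden : ∀ x y v a, p x y v * q v a ≠ 0 → 0 < den x y v a)
    {μ : ℝ} (hμ : ∑ x, ∑ y, ∑ v, ∑ a, p x y v * q v a *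
      Real.logb 2 (num x y v a / den x y v a) = μ) {δ η : ℝ} (hδ : 0 < δ) (hη : 0 < η) :
    ∃ N : ℕ, ∀ n, N ≤ n → ∑ x, ∑ y, ∑ v, ∑ a,
      blockPmf (Fin n) p x y v * blockChannel (Fin n) q v a *
      ind (∏ i, num (x i) (y i) (v i) (a i) ≤ 2 ^ ((n : ℝ) * (μ - δ)) *
        ∏ i, den (x i) (y i) (v i) (a i)) ≤ η := by
  have hP : (fun z : X × Y × V × A => p z.1 z.2.1 z.2.2.1 * q z.2.2.1 z.2.2.2)
      ∈ stdSimplex ℝ (X × Y × V × A) := by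
    refine ⟨fun z => mul_nonneg (hp _ _ _) (hq _ _), ?_⟩
    simp only [Fintype.sum_prod_type, ← mul_sum, hq1, mul_one, hp1]
  obtain ⟨N, hN⟩ := exists_forall_sum_iid_ind_le hP
    (num := fun z => num z.1 z.2.1 z.2.2.1 z.2.2.2) (den := fun z => den z.1 z.2.1 z.2.2.1 z.2.2.2)
    (fun z => hnum _ _ _ _) (fun z => hden _ _ _ _)
    (by simpa only [Fintype.sum_prod_type] using hμ) hδ hη
  refine ⟨N, fun n hn => ?_⟩
  rw [sum_sum_sum_sum_arrow]
  simp only [blockPmf, blockChannel, ← prod_mul_distrib]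
  exact hN n hn

lemma exists_forall_two_rpow_le {δ η : ℝ} (hδ : 0 < δ) (hη : 0 < η) :
    ∃ N : ℕ, ∀ n : ℕ, N ≤ n → (2 : ℝ) ^ (-((n : ℝ) * δ)) ≤ η := by
  have h1 : (2 : ℝ) ^ (-δ) < 1 := Real.rpow_lt_one_of_one_lt_of_neg one_lt_two (by linarith)
  obtain ⟨N, hN⟩ := exists_pow_lt_of_lt_one hη h1
  refine ⟨N, fun n hn => ?_⟩
  have h2 : (2 : ℝ) ^ (-((n : ℝ) * δ)) = ((2 : ℝ) ^ (-δ)) ^ n := by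
    rw [← Real.rpow_natCast, ← Real.rpow_mul (by norm_num)]
    congr 1; ring
  rw [h2]
  exact (pow_le_pow_of_le_one (by positivity) h1.le hn).trans hN.le

end Blocks

/-! ### Achievability for one receiver at large blocklengths -/

section Asymptotic

variable {X Y V A W U : Type*} [Fintype X] [Fintype Y] [Fintype V] [Fintype A] [Fintype W]
  [Fintype U] {p : X → Y → V → ℝ} {q : V → A → ℝ} {pW : W → ℝ} {t : W → U → ℝ}

lemma margXAY_pos (hp : ∀ x y v, 0 ≤ p x y v) (hq : ∀ v a, 0 ≤ q v a) {x y v a}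
    (h : p x y v * q v a ≠ 0) : 0 < margXAY p q x a y :=
  ((mul_nonneg (hp x y v) (hq v a)).lt_of_ne' h).trans_le
    (single_le_sum (f := fun v => p x y v * q v a)
      (fun v _ => mul_nonneg (hp x y v) (hq v a)) (mem_univ v))

lemma margAY_pos (hp : ∀ x y v, 0 ≤ p x y v) (hq : ∀ v a, 0 ≤ q v a) {x y v a}
    (h : p x y v * q v a ≠ 0) : 0 < margAY p q a y :=
  (margXAY_pos hp hq h).trans_le (single_le_sum (f := fun x => margXAY p q x a y)
      (fun x _ => margXAY_nonneg hp hq x a y) (mem_univ x))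

lemma margA_pos (hp : ∀ x y v, 0 ≤ p x y v) (hq : ∀ v a, 0 ≤ q v a) {x y v a}
    (h : p x y v * q v a ≠ 0) : 0 < margA p q a := by
  rw [← sum_margAY]
  exact (margAY_pos hp hq h).trans_le (single_le_sum (f := fun y => margAY p q a y)
      (fun y _ => margAY_nonneg hp hq a y) (mem_univ y))

lemma margY_pos (hp : ∀ x y v, 0 ≤ p x y v) {x y v} (h : p x y v ≠ 0) : 0 < margY p y :=
  ((hp x y v).lt_of_ne' h).trans_le
    ((single_le_sum (f := fun v => p x y v) (fun v _ => hp x y v) (mem_univ v)).trans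
      (single_le_sum (f := fun x => ∑ v, p x y v) (fun x _ => sum_nonneg fun v _ => hp x y v)
        (mem_univ x)))

/-- Achievability for one receiver, on average over an iid channel codebook. -/
theorem exists_forall_codebook_bound [DecidableEq X] [Nonempty X]
    (hp : ∀ x y v, 0 ≤ p x y v) (hp1 : ∑ x, ∑ y, ∑ v, p x y v = 1)
    (hq : ∀ v a, 0 ≤ q v a) (hq1 : ∀ v, ∑ a, q v a = 1)
    (hW : pW ∈ stdSimplex ℝ W) (ht : ∀ w, t w ∈ stdSimplex ℝ U)
    {κ R iAY iAV hX iWU : ℝ} (hκ : 0 < κ) (hR : 0 < R)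
    (hAY : ∑ x, ∑ y, ∑ v, ∑ a, p x y v * q v a *
      Real.logb 2 (margAY p q a y / (margA p q a * margY p y)) = iAY)
    (hAV : ∑ x, ∑ y, ∑ v, ∑ a, p x y v * q v a * Real.logb 2 (margA p q a / q v a) = -iAV)
    (hXAY : ∑ x, ∑ y, ∑ v, ∑ a, p x y v * q v a *
      Real.logb 2 (margXAY p q x a y / margAY p q a y) = -hX)
    (hWU : ∑ w, ∑ u, pW w * t w u * Real.logb 2 (t w u / outLaw pW t u) = iWU)
    (hhelper : iAV - iAY < R) (hchannel : hX < κ * iWU) {η : ℝ} (hη : 0 < η) :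
    ∃ N : ℕ, ∀ ns nc : ℕ, N ≤ ns → N ≤ nc → (nc : ℝ) = κ * ns →
      ∃ B : ((Fin ns → X) → Fin nc → W) → ℝ,
        (∀ enc, ∃ (helper : (Fin ns → V) → Fin (numMessages ns R))
          (dec : (Fin nc → U) → (Fin ns → Y) → Fin (numMessages ns R) → Fin ns → X),
          codeError (blockPmf (Fin ns) p) (blockChannel (Fin nc) t) enc helper dec ≤ B enc) ∧
        ∑ enc : (Fin ns → X) → Fin nc → W, (∏ x, ∏ i, pW (enc x i)) * B enc ≤ η := by
  -- The rate slack is `8δ`: bins lose `2δ` against `iAY`, the covering parameter `s` costs `2δ`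
  -- more, and the exponent `4δ` left over exceeds the `δ` required by the covering threshold.
  set δ := (R - (iAV - iAY)) / 8 with hδ
  have hδ0 : 0 < δ := by rw [hδ]; linarith
  set d := (κ * iWU - hX) / 4 with hd
  have hd0 : 0 < d := by rw [hd]; linarith
  obtain ⟨N₁, hN₁⟩ := exists_forall_sum_block_ind_le hp hp1 hq hq1
    (num := fun x y v a => margAY p q a y) (den := fun x y v a => margA p q a * margY p y)
    (fun x y v a h => margAY_pos hp hq h)
    (fun x y v a h => mul_pos (margA_pos hp hq h) (margY_pos hp (left_ne_zero_of_mul h)))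
    hAY hδ0 (η := η / 10) (by positivity)
  obtain ⟨N₂, hN₂⟩ := exists_forall_sum_block_ind_le hp hp1 hq hq1
    (num := fun x y v a => margXAY p q x a y) (den := fun x y v a => margAY p q a y)
    (fun x y v a h => margXAY_pos hp hq h) (fun x y v a h => margAY_pos hp hq h)
    hXAY hd0 (η := η / 10) (by positivity)
  obtain ⟨N₄, hN₄⟩ := exists_forall_sum_block_ind_le hp hp1 hq hq1
    (num := fun x y v a => margA p q a) (den := fun x y v a => q v a)
    (fun x y v a h => margA_pos hp hq h)
    (fun x y v a h => (hq v a).lt_of_ne' (right_ne_zero_of_mul h))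
    hAV hδ0 (η := η / 10) (by positivity)
  have hPWU : (fun z : W × U => pW z.1 * t z.1 z.2) ∈ stdSimplex ℝ (W × U) := by
    refine ⟨fun z => mul_nonneg (hW.1 _) ((ht _).1 _), ?_⟩
    simp only [Fintype.sum_prod_type, ← mul_sum, (ht _).2, mul_one, hW.2]
  obtain ⟨N₃, hN₃⟩ := exists_forall_sum_iid_ind_le hPWU
    (num := fun z => t z.1 z.2) (den := fun z => outLaw pW t z.2)
    (fun z h => ((ht z.1).1 z.2).lt_of_ne' (right_ne_zero_of_mul h))
    (fun z h => ((mul_nonneg (hW.1 z.1) ((ht z.1).1 z.2)).lt_of_ne' h).trans_le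
      (single_le_sum (f := fun w => pW w * t w z.2)
        (fun w _ => mul_nonneg (hW.1 w) ((ht w).1 z.2)) (mem_univ z.1)))
    (by simpa only [Fintype.sum_prod_type] using hWU) (δ := d / κ) (by positivity)
    (η := η / 10) (by positivity)
  obtain ⟨N₅, hN₅⟩ := exists_forall_two_rpow_le hδ0 (η := η / 10) (by positivity)
  obtain ⟨N₆, hN₆⟩ := exists_forall_two_rpow_le hd0 (η := η / 10) (by positivity)
  refine ⟨N₁ + N₂ + N₃ + N₄ + N₅ + N₆, fun ns nc hns hnc hκn => ?_⟩
  specialize hN₁ ns (by omega)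
  specialize hN₂ ns (by omega)
  specialize hN₃ nc (by omega)
  specialize hN₄ ns (by omega)
  specialize hN₅ ns (by omega)
  specialize hN₆ ns (by omega)
  set n : ℝ := (ns : ℝ) with hn
  have hn0 : 0 ≤ n := Nat.cast_nonneg _
  have hM1 : (1 : ℝ) ≤ 2 ^ (n * R) := Real.one_le_rpow (by norm_num) (by positivity)
  -- Rounding down loses at most a factor of two because `2 ^ (n * R) ≥ 1`.
  have hM : (2 : ℝ) ^ (n * R) / 2 ≤ numMessages ns R := by
    have h1 := Nat.lt_floor_add_one ((2 : ℝ) ^ (n * R))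
    have h2 : (1 : ℝ) ≤ numMessages ns R := by
      have : 1 ≤ ⌊(2 : ℝ) ^ (n * R)⌋₊ := Nat.le_floor (by simpa using hM1)
      exact_mod_cast this
    unfold numMessages at h2 ⊢
    linarith
  have hMpos : 0 < numMessages ns R := by
    have : (0 : ℝ) < numMessages ns R := lt_of_lt_of_le (by positivity) hM
    exact_mod_cast this
  -- Rounding up keeps the bin nonempty even when the exponent is negative; only `L - 1` false
  -- entries matter, so no additive error of one survives.
  set L := ⌈(2 : ℝ) ^ (n * (iAY - 2 * δ))⌉₊ with hL
  have hL1 : (2 : ℝ) ^ (n * (iAY - 2 * δ)) ≤ L := Nat.le_ceil _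
  have hL2 : (L : ℝ) < 2 ^ (n * (iAY - 2 * δ)) + 1 := Nat.ceil_lt_add_one (by positivity)
  have hLpos : 0 < L := by
    have : (0 : ℝ) < L := lt_of_lt_of_le (by positivity) hL1
    exact_mod_cast this
  have : Nonempty (Fin (numMessages ns R)) := ⟨⟨0, hMpos⟩⟩
  have : Nonempty (Fin L) := ⟨⟨0, hLpos⟩⟩
  have two_add : ∀ a b : ℝ, (2 : ℝ) ^ (a + b) = 2 ^ a * 2 ^ b := fun a b =>
    Real.rpow_add (by norm_num) a b
  -- The factor `2` in the choice `s = 2 * 2 ^ (-(n * δ))` absorbs the rounding loss in the number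
  -- of messages.
  have hcover : (2 : ℝ) ^ (n * (iAV + δ)) ≤ (2 * 2 ^ (-(n * δ))) ^ 2 *
      (Fintype.card (Fin (numMessages ns R)) * Fintype.card (Fin L)) := by
    rw [Fintype.card_fin, Fintype.card_fin]
    calc (2 : ℝ) ^ (n * (iAV + δ))
        ≤ 2 ^ (-(n * δ) + -(n * δ) + n * R + n * (iAY - 2 * δ)) := by
          refine Real.rpow_le_rpow_of_exponent_le one_le_two ?_
          have : R = iAV - iAY + 8 * δ := by rw [hδ]; ring
          rw [this]
          nlinarith [mul_nonneg hn0 hδ0.le]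
      _ ≤ 2 * 2 ^ (-(n * δ) + -(n * δ) + n * R + n * (iAY - 2 * δ)) := by
          have : (0 : ℝ) < 2 ^ (-(n * δ) + -(n * δ) + n * R + n * (iAY - 2 * δ)) := by positivity
          linarith
      _ = (2 * 2 ^ (-(n * δ))) ^ 2 * (2 ^ (n * R) / 2 * 2 ^ (n * (iAY - 2 * δ))) := by
          simp only [two_add]; ring
      _ ≤ _ := by gcongr
  obtain ⟨B, hB, hBsum⟩ := exists_code_of_codebook (M := Fin (numMessages ns R)) (L := Fin L)
    (p := blockPmf (Fin ns) p) (q := blockChannel (Fin ns) q)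
    (pW := fun w : Fin nc → W => ∏ i, pW (w i)) (t := blockChannel (Fin nc) t)
    (γ₁ := 2 ^ (n * (iAY - δ))) (γ₂ := 2 ^ (n * (hX + d)))
    (γ₃ := 2 ^ ((nc : ℝ) * (iWU - d / κ))) (γ₄ := 2 ^ (n * (iAV + δ)))
    (s := 2 * 2 ^ (-(n * δ)))
    (fun x y v => prod_nonneg fun i _ => hp _ _ _) (sum_blockPmf hp1)
    (fun v a => prod_nonneg fun i _ => hq _ _)
    (fun v => (blockChannel_mem_stdSimplex (fun v => ⟨hq v, hq1 v⟩) v).2)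
    (prod_mem_stdSimplex hW) (blockChannel_mem_stdSimplex ht)
    (by positivity) (by positivity) (by positivity) (by positivity) (by positivity) hcover
  refine ⟨B, hB, hBsum.trans ?_⟩
  have two_le : ∀ a b c : ℝ, (2 : ℝ) ^ a * b ≤ c ↔ b ≤ 2 ^ (-a) * c := fun a b c => by
    rw [Real.rpow_neg (by norm_num), inv_mul_eq_div, le_div_iff₀ (by positivity), mul_comm]
  have e₁ : ∑ x, ∑ y, ∑ v, ∑ a, blockPmf (Fin ns) p x y v * blockChannel (Fin ns) q v a *
      ind (¬ (2 : ℝ) ^ (n * (iAY - δ)) * (margA (blockPmf (Fin ns) p) (blockChannel (Fin ns) q) a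
        * margY (blockPmf (Fin ns) p) y)
        < margAY (blockPmf (Fin ns) p) (blockChannel (Fin ns) q) a y) ≤ η / 10 := by
    simp only [not_lt, margA_block, margY_block, margAY_block, ← prod_mul_distrib]
    exact hN₁
  have e₂ : ∑ x, ∑ y, ∑ v, ∑ a, blockPmf (Fin ns) p x y v * blockChannel (Fin ns) q v a *
      ind (¬ margAY (blockPmf (Fin ns) p) (blockChannel (Fin ns) q) a y
        < (2 : ℝ) ^ (n * (hX + d)) *
          margXAY (blockPmf (Fin ns) p) (blockChannel (Fin ns) q) x a y) ≤ η / 10 := by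
    simp only [not_lt, margXAY_block, margAY_block, two_le]
    have : -(n * (hX + d)) = n * (-hX - d) := by ring
    rw [this]
    exact hN₂
  have e₃ : ∑ w : Fin nc → W, ∑ u, (∏ i, pW (w i)) * blockChannel (Fin nc) t w u *
      ind (¬ (2 : ℝ) ^ ((nc : ℝ) * (iWU - d / κ)) *
        outLaw (fun w : Fin nc → W => ∏ i, pW (w i)) (blockChannel (Fin nc) t) u
        < blockChannel (Fin nc) t w u) ≤ η / 10 := by
    rw [sum_sum_arrow]
    simp only [not_lt, outLaw_block]
    simp only [blockChannel, ← prod_mul_distrib]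
    exact hN₃
  have e₄ : ∑ x, ∑ y, ∑ v, ∑ a, blockPmf (Fin ns) p x y v * blockChannel (Fin ns) q v a *
      ind ((2 : ℝ) ^ (n * (iAV + δ)) * margA (blockPmf (Fin ns) p) (blockChannel (Fin ns) q) a
        < blockChannel (Fin ns) q v a) ≤ η / 10 := by
    -- The covering threshold is an upper bound on `q / margA`, so typicality is applied to the
    -- inverse ratio, with mean `-iAV`.
    refine le_trans (sum_le_sum fun x _ => sum_le_sum fun y _ => sum_le_sum fun v _ =>
      sum_le_sum fun a _ => mul_le_mul_of_nonneg_left (ind_le (ind_nonneg _) fun h => ?_)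
        (mul_nonneg (prod_nonneg fun i _ => hp _ _ _) (prod_nonneg fun i _ => hq _ _))) hN₄
    rw [ind_of]
    rw [margA_block] at h
    have h' := (two_le _ _ _).1 h.le
    have e : -(n * (iAV + δ)) = n * (-iAV - δ) := by ring
    rw [e] at h'
    exact h'
  have e₅ : ((Fintype.card (Fin L) : ℝ) - 1) / 2 ^ (n * (iAY - δ)) ≤ η / 10 := by
    refine le_trans ?_ hN₅
    rw [Fintype.card_fin, div_le_iff₀ (by positivity), ← two_add]
    have : -(n * δ) + n * (iAY - δ) = n * (iAY - 2 * δ) := by ring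
    rw [this]
    linarith
  have e₆ : (2 : ℝ) ^ (n * (hX + d)) / 2 ^ ((nc : ℝ) * (iWU - d / κ)) ≤ η / 10 := by
    refine le_trans ?_ hN₆
    rw [div_le_iff₀ (by positivity), ← two_add]
    refine Real.rpow_le_rpow_of_exponent_le one_le_two ?_
    rw [hκn]
    have h1 : κ * n * (iWU - d / κ) = n * (κ * iWU - d) := by field_simp
    have h2 : κ * iWU = hX + 4 * d := by rw [hd]; ring
    rw [h1, h2]
    nlinarith [mul_nonneg hn0 hd0.le]
  -- Five terms of size `η / 10`, the parameter `s` counted twice and the covering tail counted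
  -- twice give `9η / 10`.
  simp only [mul_add (blockPmf _ _ _ _ _ * _), sum_add_distrib]
  linarith

end Asymptotic

/-! ### Entropy of finite measures -/

section Entropy

variable {α β ι : Type*} [Fintype α] [Fintype β] [Fintype ι]

/-- The entropy (in nats) of a finite measure, normalized so that it is homogeneous of degree one:
`hEnt f = - ∑ f a log (f a / ∑ f)`. -/
def hEnt (f : α → ℝ) : ℝ := ∑ a, negMulLog (f a) - negMulLog (∑ a, f a)

lemma hEnt_zero : hEnt (fun _ : α => 0) = 0 := by simp [hEnt]

lemma hEnt_smul (c : ℝ) (f : α → ℝ) : hEnt (fun a => c * f a) = c * hEnt f := by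
  simp only [hEnt, negMulLog_mul, sum_add_distrib, ← mul_sum, ← sum_mul]
  ring

lemma hEnt_comp_equiv (e : β ≃ α) (f : α → ℝ) : hEnt (fun b => f (e b)) = hEnt f := by
  unfold hEnt
  rw [e.sum_comp (fun a => negMulLog (f a)), e.sum_comp f]

lemma hEnt_of_sum_eq_one {f : α → ℝ} (hf : ∑ a, f a = 1) : hEnt f = ∑ a, negMulLog (f a) := by
  simp [hEnt, hf]

/-- The chain rule. -/
lemma hEnt_prod (f : α × β → ℝ) :
    hEnt f = hEnt (fun a => ∑ b, f (a, b)) + ∑ a, hEnt (fun b => f (a, b)) := by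
  simp only [hEnt, Fintype.sum_prod_type, sum_sub_distrib]
  ring

lemma eq_zero_of_sum_eq_zero {f : α → ℝ} (hf : ∀ a, 0 ≤ f a) (h : ∑ a, f a = 0) :
    f = fun _ => 0 := by
  funext a
  exact (sum_eq_zero_iff_of_nonneg fun a _ => hf a).1 h a (mem_univ a)

/-- Superadditivity is concavity of entropy rewritten through homogeneity of degree one. It is the
form in which "conditioning reduces entropy" is used throughout. -/
lemma hEnt_add_le {f g : α → ℝ} (hf : ∀ a, 0 ≤ f a) (hg : ∀ a, 0 ≤ g a) :
    hEnt f + hEnt g ≤ hEnt (fun a => f a + g a) := by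
  rcases (sum_nonneg fun a (_ : a ∈ univ) => hf a).eq_or_lt with hF | hF
  · rw [eq_zero_of_sum_eq_zero hf hF.symm]
    simp [hEnt_zero]
  rcases (sum_nonneg fun a (_ : a ∈ univ) => hg a).eq_or_lt with hG | hG
  · rw [eq_zero_of_sum_eq_zero hg hG.symm]
    simp [hEnt_zero]
  set F := ∑ a, f a with hFd
  set G := ∑ a, g a with hGd
  have e1 : f = fun a => F * (f a / F) := by funext a; field_simp
  have e2 : g = fun a => G * (g a / G) := by funext a; field_simp
  have e3 : (fun a => f a + g a)
      = fun a => (F + G) * (F / (F + G) * (f a / F) + G / (F + G) * (g a / G)) := by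
    funext a; field_simp
  have s1 : ∑ a, f a / F = 1 := by rw [← sum_div, div_self hF.ne']
  have s2 : ∑ a, g a / G = 1 := by rw [← sum_div, div_self hG.ne']
  have hα : F / (F + G) + G / (F + G) = 1 := by field_simp
  rw [e3, hEnt_smul]
  have h1 : hEnt f = F * hEnt (fun a => f a / F) := by rw [← hEnt_smul, ← e1]
  have h2 : hEnt g = G * hEnt (fun a => g a / G) := by rw [← hEnt_smul, ← e2]
  rw [h1, h2, hEnt_of_sum_eq_one s1, hEnt_of_sum_eq_one s2, hEnt_of_sum_eq_one (by
    rw [sum_add_distrib, ← mul_sum, ← mul_sum, s1, s2]; simpa using hα), mul_sum, mul_sum, mul_sum,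
    ← sum_add_distrib]
  refine sum_le_sum fun a _ => ?_
  have hc := concaveOn_negMulLog.2 (Set.mem_Ici.2 (div_nonneg (hf a) hF.le))
    (Set.mem_Ici.2 (div_nonneg (hg a) hG.le)) (div_nonneg hF.le (add_pos hF hG).le)
    (div_nonneg hG.le (add_pos hF hG).le) hα
  simp only [smul_eq_mul] at hc
  have := mul_le_mul_of_nonneg_left hc (add_pos hF hG).le
  refine le_trans (le_of_eq ?_) this
  field_simp

lemma sum_hEnt_le {f : ι → α → ℝ} (hf : ∀ i a, 0 ≤ f i a) :
    ∑ i, hEnt (f i) ≤ hEnt (fun a => ∑ i, f i a) := by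
  classical
  have : ∀ s : Finset ι, ∑ i ∈ s, hEnt (f i) ≤ hEnt (fun a => ∑ i ∈ s, f i a) := by
    intro s
    induction s using Finset.induction_on with
    | empty => simp [hEnt_zero]
    | insert i s hi ih =>
      simp only [sum_insert hi]
      exact (add_le_add le_rfl ih).trans
        (hEnt_add_le (hf i) fun a => sum_nonneg fun j _ => hf j a)
  exact this univ

/-- A measure is a sum of point masses, each of entropy zero, so superadditivity applies. -/
lemma hEnt_nonneg {f : α → ℝ} (hf : ∀ a, 0 ≤ f a) : 0 ≤ hEnt f := by
  classical
  have h := sum_hEnt_le (f := fun (i a : α) => if a = i then f a else 0)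
    (fun i a => by split_ifs <;> simp [hf a])
  have h1 : ∀ i : α, hEnt (fun a => if a = i then f a else 0) = 0 := by
    intro i
    unfold hEnt
    simp [apply_ite negMulLog]
  simpa [h1] using h

/-- Jensen's inequality for `negMulLog` with uniform weights. -/
lemma hEnt_le_mul_log_card {f : α → ℝ} (hf : ∀ a, 0 ≤ f a) :
    hEnt f ≤ (∑ a, f a) * log (Fintype.card α) := by
  classical
  rcases (sum_nonneg fun a (_ : a ∈ univ) => hf a).eq_or_lt with hF | hF
  · rw [← hF, eq_zero_of_sum_eq_zero hf hF.symm, hEnt_zero, zero_mul]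
  set F := ∑ a, f a with hFd
  have hne : Nonempty α := by
    by_contra h
    rw [not_nonempty_iff] at h
    simp [hFd] at hF
  have hcard : (0 : ℝ) < Fintype.card α := by exact_mod_cast Fintype.card_pos
  have hc := concaveOn_negMulLog.le_map_sum (t := univ) (w := fun _ : α => (Fintype.card α : ℝ)⁻¹)
    (p := f) (fun _ _ => by positivity) (by simp) (fun a _ => Set.mem_Ici.2 (hf a))
  simp only [smul_eq_mul, ← mul_sum, ← hFd] at hc
  rw [negMulLog_mul] at hc
  have h2 : negMulLog ((Fintype.card α : ℝ)⁻¹)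
      = (Fintype.card α : ℝ)⁻¹ * log (Fintype.card α) := by
    simp [negMulLog, log_inv]
  rw [h2] at hc
  have h3 := mul_le_mul_of_nonneg_left hc hcard.le
  unfold hEnt
  have h4 : (Fintype.card α : ℝ) * ((Fintype.card α : ℝ)⁻¹ * ∑ a, negMulLog (f a))
      = ∑ a, negMulLog (f a) := by field_simp
  have h5 : (Fintype.card α : ℝ) * (F * ((Fintype.card α : ℝ)⁻¹ * log (Fintype.card α))
      + (Fintype.card α : ℝ)⁻¹ * negMulLog F) = F * log (Fintype.card α) + negMulLog F := by
    field_simp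
  rw [h4, h5] at h3
  linarith

/-- Fano's inequality for a finite measure. -/
lemma hEnt_le_fano {f : α → ℝ} (hf : ∀ a, 0 ≤ f a) (a₀ : α) :
    hEnt f ≤ (∑ a, f a) * log 2 + (∑ a, f a * ind (a₀ ≠ a)) * log (Fintype.card α) := by
  classical
  set g : α → ℝ := fun a => f a * ind (a₀ ≠ a) with hg
  have hg0 : ∀ a, 0 ≤ g a := fun a => mul_nonneg (hf a) (ind_nonneg _)
  have hsplit : ∀ F : α → ℝ, ∑ a, F a = F a₀ + ∑ a ∈ univ.erase a₀, F a := fun F =>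
    (add_sum_erase _ _ (mem_univ a₀)).symm
  have hga : g a₀ = 0 := by simp [hg, ind]
  have hgf : ∀ a ∈ univ.erase a₀, g a = f a := fun a ha => by
    simp only [hg]; rw [ind_of (ne_of_mem_erase ha).symm, mul_one]
  have hgs : ∑ a, g a = ∑ a ∈ univ.erase a₀, f a := by
    rw [hsplit, hga, zero_add]; exact sum_congr rfl hgf
  have hfs : ∑ a, f a = f a₀ + ∑ a, g a := by rw [hgs]; exact hsplit f
  -- Grouping: the entropy is that of the binary choice between `a₀` and the rest, plus the entropy
  -- within the rest.
  have e : hEnt f = hEnt ![f a₀, ∑ a, g a] + hEnt g := by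
    have h1 : ∑ a, negMulLog (g a) = ∑ a ∈ univ.erase a₀, negMulLog (f a) := by
      rw [hsplit, hga, negMulLog_zero, zero_add]
      exact sum_congr rfl fun a ha => by rw [hgf a ha]
    simp only [hEnt, Fin.sum_univ_two, Matrix.cons_val_zero, Matrix.cons_val_one, h1]
    rw [hsplit (fun a => negMulLog (f a)), hfs]
    ring
  rw [e]
  refine add_le_add ?_ (hEnt_le_mul_log_card hg0)
  have h2 := hEnt_le_mul_log_card (f := ![f a₀, ∑ a, g a]) (by
    intro i; fin_cases i
    · exact hf a₀
    · exact sum_nonneg fun a _ => hg0 a)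
  simpa [Fin.sum_univ_two, ← hfs] using h2

end Entropy

/-! ### Entropy of sequences -/

section EntropyBlocks

variable {U : Type*} [Fintype U]

lemma sum_fin_succ_arrow {n : ℕ} (F : (Fin (n + 1) → U) → ℝ) :
    ∑ u, F u = ∑ a, ∑ u' : Fin n → U, F (Fin.cons a u') := by
  rw [← (Fin.consEquiv (fun _ : Fin (n + 1) => U)).sum_comp, Fintype.sum_prod_type]
  rfl

lemma hEnt_fin_succ_arrow {n : ℕ} (f : (Fin (n + 1) → U) → ℝ) :
    hEnt f = hEnt (fun z : (Fin n → U) × U => f (Fin.cons z.2 z.1)) := by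
  rw [← hEnt_comp_equiv (Equiv.prodComm (Fin n → U) U |>.trans
    (Fin.consEquiv (fun _ : Fin (n + 1) => U)))]
  rfl

lemma law_eq_sum {Ω α : Type*} [Fintype Ω] (p : Ω → ℝ) (f : Ω → α) (a : α) :
    law p f a = ∑ ω, p ω * ind (f ω = a) := by
  classical
  unfold law ind
  rw [sum_filter]
  simp

/-- The entropy of a block is at most the sum of the entropies of its letters. -/
lemma hEnt_le_sum_law {n : ℕ} {f : (Fin n → U) → ℝ} (hf : ∀ u, 0 ≤ f u) :
    hEnt f ≤ ∑ i, hEnt (law f (fun u => u i)) := by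
  induction n with
  | zero => simp [hEnt]
  | succ n ih =>
    rw [hEnt_fin_succ_arrow, hEnt_prod, Fin.sum_univ_succ, add_comm]
    refine add_le_add ?_ ?_
    -- Forgetting the tail can only increase the entropy of the first letter.
    · refine (sum_hEnt_le fun i a => hf _).trans (le_of_eq ?_)
      congr 1; funext a
      classical
      rw [law_eq_sum, sum_fin_succ_arrow]
      simp [ind]
    · refine (ih fun u => sum_nonneg fun a _ => hf _).trans (le_of_eq ?_)
      refine sum_congr rfl fun i _ => ?_
      congr 1; funext a
      rw [law_eq_sum, law_eq_sum, sum_fin_succ_arrow, sum_comm]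
      simp [sum_mul]

/-- The entropy of a product measure. -/
lemma hEnt_prod_pi {n : ℕ} {t : Fin n → U → ℝ} (ht : ∀ i, ∑ u, t i u = 1) :
    hEnt (fun u : Fin n → U => ∏ i, t i (u i)) = ∑ i, hEnt (t i) := by
  induction n with
  | zero => simp [hEnt]
  | succ n ih =>
    rw [hEnt_fin_succ_arrow, hEnt_prod, Fin.sum_univ_succ, add_comm]
    simp only [Fin.prod_univ_succ, Fin.cons_zero, Fin.cons_succ]
    congr 1
    · simp only [mul_comm (t 0 _), hEnt_smul, ← sum_mul]
      rw [sum_prod_pi (fun i u => t (Fin.succ i) u)]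
      simp [ht]
    · simp only [← sum_mul, ht, one_mul]
      exact ih fun i => ht _

end EntropyBlocks

/-! ### Single-letterization of the helper constraint -/

section TwoLetter

variable {X Y V X₁ X₂ Y₁ Y₂ V₁ V₂ : Type*} [Fintype X] [Fintype Y] [Fintype V] [Fintype X₁]
  [Fintype X₂] [Fintype Y₁] [Fintype Y₂] [Fintype V₁] [Fintype V₂]

/-- The conditional entropy of `X` given `Y` under a finite measure. -/
def entXY (μ : X → Y → V → ℝ) : ℝ := ∑ y, hEnt (fun x => ∑ v, μ x y v)

/-- The conditional entropy of `(X, V)` given `Y` under a finite measure. -/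
def entXVY (μ : X → Y → V → ℝ) : ℝ := ∑ y, hEnt (fun z : X × V => μ z.1 y z.2)

lemma entXY_smul (c : ℝ) (μ : X → Y → V → ℝ) :
    entXY (fun x y v => c * μ x y v) = c * entXY μ := by
  simp only [entXY, ← mul_sum, hEnt_smul]

lemma entXVY_smul (c : ℝ) (μ : X → Y → V → ℝ) :
    entXVY (fun x y v => c * μ x y v) = c * entXVY μ := by
  simp only [entXVY, hEnt_smul, mul_sum]

lemma entXY_comp_equiv (e₁ : X₁ ≃ X) (e₂ : Y₁ ≃ Y) (e₃ : V₁ ≃ V) (μ : X → Y → V → ℝ) :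
    entXY (fun x y v => μ (e₁ x) (e₂ y) (e₃ v)) = entXY μ := by
  unfold entXY
  rw [← e₂.sum_comp]
  refine sum_congr rfl fun y _ => ?_
  rw [← hEnt_comp_equiv e₁]
  congr 1; funext x
  exact e₃.sum_comp _

lemma entXVY_comp_equiv (e₁ : X₁ ≃ X) (e₂ : Y₁ ≃ Y) (e₃ : V₁ ≃ V) (μ : X → Y → V → ℝ) :
    entXVY (fun x y v => μ (e₁ x) (e₂ y) (e₃ v)) = entXVY μ := by
  unfold entXVY
  rw [← e₂.sum_comp]
  refine sum_congr rfl fun y _ => ?_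
  rw [← hEnt_comp_equiv (Equiv.prodCongr e₁ e₃)]
  rfl

/-- The chain rule in `X` is exact; the inequality comes from conditioning the second term also on
`v₁`. That extra conditioning makes the remaining source an iid block tilted by a density of `v₂`
only. -/
lemma le_entXY_prod {μ : X₁ × X₂ → Y₁ × Y₂ → V₁ × V₂ → ℝ} (hμ : ∀ x y v, 0 ≤ μ x y v) :
    ∑ y₂, entXY (fun x₁ y₁ v₁ => ∑ x₂, ∑ v₂, μ (x₁, x₂) (y₁, y₂) (v₁, v₂))
      + ∑ x₁, ∑ y₁, ∑ v₁, entXY (fun x₂ y₂ v₂ => μ (x₁, x₂) (y₁, y₂) (v₁, v₂)) ≤ entXY μ := by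
  have h : entXY μ = ∑ y₂, ∑ y₁, hEnt (fun x₁ => ∑ x₂, ∑ v, μ (x₁, x₂) (y₁, y₂) v)
      + ∑ x₁, ∑ y₁, ∑ y₂, hEnt (fun x₂ => ∑ v, μ (x₁, x₂) (y₁, y₂) v) := by
    unfold entXY
    simp only [hEnt_prod, Fintype.sum_prod_type, sum_add_distrib]
    congr 1
    · exact sum_comm
    · rw [sum_comm (s := univ (α := X₁))]
      exact sum_congr rfl fun y₁ _ => sum_comm
  rw [h]
  refine add_le_add (le_of_eq ?_) ?_
  · unfold entXY
    refine sum_congr rfl fun y₂ _ => sum_congr rfl fun y₁ _ => ?_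
    congr 1; funext x₁
    rw [sum_comm]
    simp only [Fintype.sum_prod_type]
  · refine sum_le_sum fun x₁ _ => sum_le_sum fun y₁ _ => ?_
    unfold entXY
    rw [sum_comm]
    refine sum_le_sum fun y₂ _ => ?_
    simp only [Fintype.sum_prod_type]
    exact sum_hEnt_le fun v₁ x₂ => sum_nonneg fun v₂ _ => hμ _ _ _

/-- Here `v₁` already belongs to the first variable, so the chain rule gives equality with exactly
the fibres used in `le_entXY_prod`. One family of auxiliary values therefore serves both quantities.
-/
lemma entXVY_prod (μ : X₁ × X₂ → Y₁ × Y₂ → V₁ × V₂ → ℝ) :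
    entXVY μ = ∑ y₂, entXVY (fun x₁ y₁ v₁ => ∑ x₂, ∑ v₂, μ (x₁, x₂) (y₁, y₂) (v₁, v₂))
      + ∑ x₁, ∑ y₁, ∑ v₁, entXVY (fun x₂ y₂ v₂ => μ (x₁, x₂) (y₁, y₂) (v₁, v₂)) := by
  unfold entXVY
  have h : ∀ y : Y₁ × Y₂, hEnt (fun z : (X₁ × X₂) × V₁ × V₂ => μ z.1 y z.2)
      = hEnt (fun z : X₁ × V₁ => ∑ x₂, ∑ v₂, μ (z.1, x₂) y (z.2, v₂))
        + ∑ x₁, ∑ v₁, hEnt (fun z : X₂ × V₂ => μ (x₁, z.1) y (v₁, z.2)) := by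
    intro y
    rw [← hEnt_comp_equiv (Equiv.prodProdProdComm X₁ V₁ X₂ V₂)]
    rw [hEnt_prod]
    simp only [Fintype.sum_prod_type, Equiv.prodProdProdComm_apply]
  simp only [h, Fintype.sum_prod_type, sum_add_distrib]
  congr 1
  · exact sum_comm
  · rw [sum_rotate]
    refine sum_congr rfl fun x₁ _ => sum_congr rfl fun y₁ _ => sum_comm

end TwoLetter

/-! ### Induction on the blocklength -/

section SingleLetter

universe u₁ u₂ u₃

variable {X : Type u₁} {Y : Type u₂} {V : Type u₃} [Fintype X] [Fintype Y] [Fintype V]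

/-- The cone generated by the triples `(ρ, H(X | Y), H(X, V | Y))` for the source tilted by a
density `ρ` of `V`. -/
def tiltCone (p : X → Y → V → ℝ) : AddSubmonoid ((V → ℝ) × ℝ × ℝ) :=
  AddSubmonoid.closure {z | ∃ ρ : V → ℝ, (∀ v, 0 ≤ ρ v) ∧
    z = (ρ, entXY (fun x y v => p x y v * ρ v), entXVY (fun x y v => p x y v * ρ v))}

lemma mem_tiltCone (p : X → Y → V → ℝ) {ρ : V → ℝ} (hρ : ∀ v, 0 ≤ ρ v) :
    (ρ, entXY (fun x y v => p x y v * ρ v), entXVY (fun x y v => p x y v * ρ v)) ∈ tiltCone p :=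
  AddSubmonoid.subset_closure ⟨ρ, hρ, rfl⟩

lemma blockPmf_cons {n : ℕ} (p : X → Y → V → ℝ) (x : X) (y : Y) (v : V) (x' : Fin n → X)
    (y' : Fin n → Y) (v' : Fin n → V) :
    blockPmf (Fin (n + 1)) p (Fin.cons x x') (Fin.cons y y') (Fin.cons v v')
      = p x y v * blockPmf (Fin n) p x' y' v' := by
  simp [blockPmf, Fin.prod_univ_succ]

lemma entXY_fin_succ_arrow {n : ℕ}
    (μ : (Fin (n + 1) → X) → (Fin (n + 1) → Y) → (Fin (n + 1) → V) → ℝ) :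
    entXY μ = entXY (fun (x : X × (Fin n → X)) (y : Y × (Fin n → Y)) (v : V × (Fin n → V)) =>
      μ (Fin.cons x.1 x.2) (Fin.cons y.1 y.2) (Fin.cons v.1 v.2)) :=
  (entXY_comp_equiv (Fin.consEquiv (fun _ : Fin (n + 1) => X))
    (Fin.consEquiv (fun _ : Fin (n + 1) => Y)) (Fin.consEquiv (fun _ : Fin (n + 1) => V)) μ).symm

lemma entXVY_fin_succ_arrow {n : ℕ}
    (μ : (Fin (n + 1) → X) → (Fin (n + 1) → Y) → (Fin (n + 1) → V) → ℝ) :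
    entXVY μ = entXVY (fun (x : X × (Fin n → X)) (y : Y × (Fin n → Y)) (v : V × (Fin n → V)) =>
      μ (Fin.cons x.1 x.2) (Fin.cons y.1 y.2) (Fin.cons v.1 v.2)) :=
  (entXVY_comp_equiv (Fin.consEquiv (fun _ : Fin (n + 1) => X))
    (Fin.consEquiv (fun _ : Fin (n + 1) => Y)) (Fin.consEquiv (fun _ : Fin (n + 1) => V)) μ).symm

lemma le_entXY_block {n : ℕ} {p : X → Y → V → ℝ} (hp : ∀ x y v, 0 ≤ p x y v)
    {r : (Fin (n + 1) → V) → ℝ} (hr : ∀ v, 0 ≤ r v) :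
    ∑ y₂, entXY (fun x y v => p x y v *
        ∑ x₂, ∑ v₂, blockPmf (Fin n) p x₂ y₂ v₂ * r (Fin.cons v v₂))
      + ∑ x, ∑ y, ∑ v, entXY (fun x₂ y₂ v₂ =>
        blockPmf (Fin n) p x₂ y₂ v₂ * (p x y v * r (Fin.cons v v₂)))
      ≤ entXY (fun x y v => blockPmf (Fin (n + 1)) p x y v * r v) := by
  have h := le_entXY_prod (μ := fun (x : X × (Fin n → X)) (y : Y × (Fin n → Y))
    (v : V × (Fin n → V)) => blockPmf (Fin n) p x.2 y.2 v.2 *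
      (p x.1 y.1 v.1 * r (Fin.cons v.1 v.2)))
    (fun x y v => mul_nonneg (prod_nonneg fun i _ => hp _ _ _) (mul_nonneg (hp _ _ _) (hr _)))
  rw [entXY_fin_succ_arrow]
  simp only [blockPmf_cons, mul_sum]
  simpa only [mul_left_comm (blockPmf (Fin n) p _ _ _), mul_assoc] using h

lemma entXVY_block {n : ℕ} (p : X → Y → V → ℝ) (r : (Fin (n + 1) → V) → ℝ) :
    entXVY (fun x y v => blockPmf (Fin (n + 1)) p x y v * r v)
      = ∑ y₂, entXVY (fun x y v => p x y v *
        ∑ x₂, ∑ v₂, blockPmf (Fin n) p x₂ y₂ v₂ * r (Fin.cons v v₂))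
      + ∑ x, ∑ y, ∑ v, entXVY (fun x₂ y₂ v₂ =>
        blockPmf (Fin n) p x₂ y₂ v₂ * (p x y v * r (Fin.cons v v₂))) := by
  have h := entXVY_prod (fun (x : X × (Fin n → X)) (y : Y × (Fin n → Y))
    (v : V × (Fin n → V)) => blockPmf (Fin n) p x.2 y.2 v.2 *
      (p x.1 y.1 v.1 * r (Fin.cons v.1 v.2)))
  rw [entXVY_fin_succ_arrow]
  simp only [blockPmf_cons, mul_sum]
  simpa only [mul_left_comm (blockPmf (Fin n) p _ _ _), mul_assoc] using h

/-- A finite family of densities of the block `V₁, …, V_n` that sums to one reduces to a family of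
densities of one letter. -/
theorem exists_mem_tiltCone {p : X → Y → V → ℝ} (hp : ∀ x y v, 0 ≤ p x y v)
    (hp1 : ∑ x, ∑ y, ∑ v, p x y v = 1) (n : ℕ) :
    ∀ (ι : Type (max u₁ u₂ u₃)) [Fintype ι] (ρ : ι → (Fin n → V) → ℝ), (∀ j v, 0 ≤ ρ j v) →
      (∀ v, ∑ j, ρ j v = 1) →
      ∃ a b, ((fun _ => (n : ℝ)), a, b) ∈ tiltCone p ∧
        a ≤ ∑ j, entXY (fun x y v => blockPmf (Fin n) p x y v * ρ j v) ∧
        ∑ j, entXVY (fun x y v => blockPmf (Fin n) p x y v * ρ j v) ≤ b := by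
  induction n with
  | zero =>
    intro ι _ ρ hρ _
    refine ⟨0, 0, ?_, ?_, ?_⟩
    · have h0 : ((fun _ : V => ((0 : ℕ) : ℝ)), (0 : ℝ), (0 : ℝ)) = 0 := by
        rw [Nat.cast_zero]; rfl
      rw [h0]
      exact (tiltCone p).zero_mem
    · simp [entXY, hEnt]
    · simp [entXVY, hEnt, Fintype.sum_prod_type]
  | succ n ih =>
    intro ι _ ρ hρ hρ1
    have hblock : ∀ x y v, 0 ≤ blockPmf (Fin n) p x y v := fun x y v =>
      prod_nonneg fun i _ => hp _ _ _
    -- The first letter joins the index of the family: the remaining block is conditioned on the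
    -- message and on `(x, y, v)`. The index type grows at each stage, hence the induction over all
    -- index types of a large enough universe.
    obtain ⟨a, b, hab, ha, hb⟩ := ih (ι × X × Y × V)
      (fun j v => p j.2.1 j.2.2.1 j.2.2.2 * ρ j.1 (Fin.cons j.2.2.2 v))
      (fun j v => mul_nonneg (hp _ _ _) (hρ _ _)) (fun v => by
        simp only [Fintype.sum_prod_type]
        rw [sum_comm, ← hp1]
        refine sum_congr rfl fun x _ => ?_
        rw [sum_comm]
        refine sum_congr rfl fun y _ => ?_
        rw [sum_comm]
        refine sum_congr rfl fun v _ => ?_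
        rw [← mul_sum, hρ1, mul_one])
    -- For the first letter the auxiliary variable is the message together with the later side
    -- information; `σ j y₂ v` is its conditional probability given `v`.
    set σ : ι → (Fin n → Y) → V → ℝ := fun j y₂ v =>
      ∑ x₂, ∑ v₂, blockPmf (Fin n) p x₂ y₂ v₂ * ρ j (Fin.cons v v₂) with hσ
    have hσ0 : ∀ j y v, 0 ≤ σ j y v := fun j y v =>
      sum_nonneg fun x₂ _ => sum_nonneg fun v₂ _ => mul_nonneg (hblock _ _ _) (hρ _ _)
    have hσ1 : ∀ v, ∑ j, ∑ y, σ j y v = 1 := by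
      intro v
      rw [← sum_blockPmf (ι := Fin n) hp1]
      simp only [hσ]
      rw [sum_comm, sum_comm (s := univ (α := Fin n → X))]
      refine sum_congr rfl fun y₂ _ => ?_
      rw [sum_comm]
      refine sum_congr rfl fun x₂ _ => ?_
      rw [sum_comm]
      refine sum_congr rfl fun v₂ _ => ?_
      rw [← mul_sum, hρ1, mul_one]
    have hmem : (∑ j, ∑ y₂, (σ j y₂, entXY (fun x y v => p x y v * σ j y₂ v),
        entXVY (fun x y v => p x y v * σ j y₂ v))) ∈ tiltCone p :=
      sum_mem fun j _ => sum_mem fun y₂ _ => mem_tiltCone p (hσ0 j y₂)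
    refine ⟨∑ j, ∑ y₂, entXY (fun x y v => p x y v * σ j y₂ v) + a,
      ∑ j, ∑ y₂, entXVY (fun x y v => p x y v * σ j y₂ v) + b, ?_, ?_, ?_⟩
    · convert add_mem hmem hab using 1
      simp only [Prod.ext_iff, Prod.fst_add, Prod.snd_add, Prod.fst_sum, Prod.snd_sum, and_true]
      funext v
      simp [Finset.sum_apply, hσ1, add_comm]
    · refine le_trans (add_le_add le_rfl ha) ?_
      simp only [Fintype.sum_prod_type]
      rw [← sum_add_distrib]
      exact sum_le_sum fun j _ => le_entXY_block hp (hρ j)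
    · refine le_trans (le_of_eq ?_) (add_le_add le_rfl hb)
      simp only [Fintype.sum_prod_type]
      rw [← sum_add_distrib]
      exact sum_congr rfl fun j _ => entXVY_block p (ρ j)

end SingleLetter

/-! ### Compactness -/

lemma isCompact_convexHull_of_isCompact {E : Type*} [NormedAddCommGroup E] [NormedSpace ℝ E]
    [FiniteDimensional ℝ E] {s : Set E} (hs : IsCompact s) : IsCompact (convexHull ℝ s) := by
  rcases s.eq_empty_or_nonempty with rfl | ⟨s₀, hs₀⟩
  · simp
  -- Carathéodory: `finrank + 1` points suffice, so the hull is a continuous image of a compact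
  -- product. Shorter combinations are padded with weight zero at `s₀`.
  set d := Module.finrank ℝ E + 1
  set φ : (Fin d → ℝ) × (Fin d → E) → E := fun z => ∑ i, z.1 i • z.2 i with hφ
  have hφc : Continuous φ := by fun_prop
  have himg : convexHull ℝ s = φ '' (stdSimplex ℝ (Fin d) ×ˢ Set.univ.pi fun _ => s) := by
    apply Set.Subset.antisymm
    · intro x hx
      obtain ⟨ι, _, z, w, hz, haff, hw, hw1, rfl⟩ := eq_pos_convex_span_of_mem_convexHull hx
      have hcard : Fintype.card ι ≤ Fintype.card (Fin d) := by
        rw [Fintype.card_fin]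
        exact haff.card_le_finrank_succ.trans
          (Nat.add_le_add_right (Submodule.finrank_le _) 1)
      obtain ⟨e⟩ := Function.Embedding.nonempty_of_card_le hcard
      have hwe : ∀ i, Function.extend e w 0 (e i) = w i := e.injective.extend_apply w 0
      have hze : ∀ i, Function.extend e z (fun _ => s₀) (e i) = z i :=
        e.injective.extend_apply z _
      have hout : ∀ i ∉ Set.range e, Function.extend e w 0 i = 0 := fun i hi =>
        Function.extend_apply' _ _ _ fun ⟨j, hj⟩ => hi ⟨j, hj⟩
      refine ⟨(Function.extend e w 0, Function.extend e z fun _ => s₀), ⟨⟨fun i => ?_, ?_⟩,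
        fun i _ => ?_⟩, ?_⟩
      · by_cases hi : i ∈ Set.range e
        · obtain ⟨j, rfl⟩ := hi
          simp only [hwe]; exact (hw j).le
        · simp only [hout i hi]; exact le_rfl
      · rw [← hw1]
        exact (Fintype.sum_of_injective e e.injective _ _ hout fun i => (hwe i).symm).symm
      · by_cases hi : i ∈ Set.range e
        · obtain ⟨j, rfl⟩ := hi
          simp only [hze]; exact hz ⟨j, rfl⟩
        · simp only
          rw [Function.extend_apply' _ _ _ fun ⟨j, hj⟩ => hi ⟨j, hj⟩]
          exact hs₀
      · exact (Fintype.sum_of_injective e e.injective _ _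
          (fun i hi => by simp only [hout i hi, zero_smul]) fun i => by simp only [hwe, hze]).symm
    · rintro _ ⟨⟨w, z⟩, ⟨hw, hz⟩, rfl⟩
      exact (convex_convexHull ℝ s).sum_mem (fun i _ => hw.1 i) hw.2
        fun i _ => subset_convexHull ℝ s (hz i (Set.mem_univ i))
  rw [himg]
  exact ((isCompact_stdSimplex ℝ (Fin d)).prod (isCompact_univ_pi fun _ => hs)).image hφc

/-! ### From the cone to a compact convex hull -/

section Hull

variable {X Y V : Type*} [Fintype X] [Fintype Y] [Fintype V]

/-- The triples `(ρ, H(X | Y), H(X, V | Y))` for tilting densities `ρ` of total mass one. -/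
def tiltSet (p : X → Y → V → ℝ) : Set ((V → ℝ) × ℝ × ℝ) :=
  (fun ρ : V → ℝ => (ρ, entXY (fun x y v => p x y v * ρ v), entXVY (fun x y v => p x y v * ρ v)))
    '' stdSimplex ℝ V

lemma continuous_hEnt {α Z : Type*} [Fintype α] [TopologicalSpace Z] {f : Z → α → ℝ}
    (hf : Continuous f) : Continuous fun z => hEnt (f z) := by
  unfold hEnt
  have : ∀ a, Continuous fun z => f z a := fun a => (continuous_apply a).comp hf
  exact (continuous_finsetSum _ fun a _ => continuous_negMulLog.comp (this a)).sub
    (continuous_negMulLog.comp (continuous_finsetSum _ fun a _ => this a))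

lemma isCompact_convexHull_tiltSet (p : X → Y → V → ℝ) :
    IsCompact (convexHull ℝ (tiltSet p)) := by
  refine isCompact_convexHull_of_isCompact ((isCompact_stdSimplex ℝ V).image ?_)
  refine continuous_id.prodMk (Continuous.prodMk ?_ ?_)
  · exact continuous_finsetSum _ fun y _ => continuous_hEnt (by fun_prop)
  · exact continuous_finsetSum _ fun y _ => continuous_hEnt (by fun_prop)

/-- By homogeneity each generator is a multiple of a point of `tiltSet`, and sums of multiples
renormalize to convex combinations. The zero element uses an arbitrary point `z₀` of the hull. -/
lemma exists_smul_of_mem_tiltCone [Nonempty V] {p : X → Y → V → ℝ} {z : (V → ℝ) × ℝ × ℝ}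
    (hz : z ∈ tiltCone p) : ∃ c : ℝ, 0 ≤ c ∧ ∃ z' ∈ convexHull ℝ (tiltSet p), z = c • z' := by
  classical
  obtain ⟨z₀, hz₀⟩ : (convexHull ℝ (tiltSet p)).Nonempty :=
    (Set.Nonempty.image _ ⟨_, single_mem_stdSimplex ℝ (Classical.arbitrary V)⟩).convexHull
  unfold tiltCone at hz
  induction hz using AddSubmonoid.closure_induction with
  | mem z hz =>
    obtain ⟨ρ, hρ, rfl⟩ := hz
    rcases (sum_nonneg fun v (_ : v ∈ univ) => hρ v).eq_or_lt with h0 | h0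
    · refine ⟨0, le_rfl, z₀, hz₀, ?_⟩
      rw [eq_zero_of_sum_eq_zero hρ h0.symm, zero_smul]
      simp only [mul_zero, entXY, entXVY, hEnt_zero, sum_const_zero]
      rfl
    · set c := ∑ v, ρ v with hc
      refine ⟨c, h0.le, _, subset_convexHull ℝ _ ⟨fun v => ρ v / c,
        ⟨fun v => div_nonneg (hρ v) h0.le, ?_⟩, rfl⟩, ?_⟩
      · rw [← sum_div, div_self h0.ne']
      · have h1 : ρ = c • fun v => ρ v / c := by
          funext v; simp only [Pi.smul_apply, smul_eq_mul]; field_simp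
        have h2 : (fun x y v => p x y v * ρ v) = fun x y v => c * (p x y v * (ρ v / c)) := by
          funext x y v; field_simp
        simp only [Prod.smul_mk, smul_eq_mul, ← entXY_smul, ← entXVY_smul, ← h2, ← h1]
  | zero => exact ⟨0, le_rfl, z₀, hz₀, (zero_smul _ _).symm⟩
  | add a b _ _ iha ihb =>
    obtain ⟨c₁, hc₁, z₁, hz₁, rfl⟩ := iha
    obtain ⟨c₂, hc₂, z₂, hz₂, rfl⟩ := ihb
    rcases (add_nonneg hc₁ hc₂).eq_or_lt with h0 | h0
    · have h1 : c₁ = 0 := by linarith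
      have h2 : c₂ = 0 := by linarith
      exact ⟨0, le_rfl, z₀, hz₀, by simp [h1, h2]⟩
    · refine ⟨c₁ + c₂, h0.le, (c₁ / (c₁ + c₂)) • z₁ + (c₂ / (c₁ + c₂)) • z₂,
        convex_convexHull ℝ _ hz₁ hz₂ (by positivity) (by positivity) (by field_simp), ?_⟩
      rw [smul_add, smul_smul, smul_smul, mul_div_cancel₀ _ h0.ne', mul_div_cancel₀ _ h0.ne']

lemma exists_mem_hull_of_mem_tiltCone [Nonempty V] {p : X → Y → V → ℝ} {n a b : ℝ} (hn : 0 < n)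
    (h : ((fun _ => n), a, b) ∈ tiltCone p) :
    ((fun _ => (Fintype.card V : ℝ)⁻¹), a / (n * Fintype.card V), b / (n * Fintype.card V))
      ∈ convexHull ℝ (tiltSet p) := by
  obtain ⟨c, hc, z, hz, hcz⟩ := exists_smul_of_mem_tiltCone h
  have hV : (0 : ℝ) < Fintype.card V := by exact_mod_cast Fintype.card_pos
  have hsum : ∑ v, z.1 v = 1 := by
    have : convexHull ℝ (tiltSet p) ⊆ {z | ∑ v, z.1 v = 1} := by
      refine convexHull_min ?_ ?_
      · rintro _ ⟨ρ, hρ, rfl⟩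
        exact hρ.2
      · intro z₁ h₁ z₂ h₂ s t _ _ hst
        simp only [Set.mem_ofPred_eq, Prod.fst_add, Prod.smul_fst, Pi.add_apply, Pi.smul_apply,
          smul_eq_mul, sum_add_distrib, ← mul_sum] at *
        rw [h₁, h₂]; linarith
    exact this hz
  simp only [Prod.ext_iff, Prod.smul_fst, Prod.smul_snd, smul_eq_mul] at hcz
  obtain ⟨h1, h2, h3⟩ := hcz
  -- Densities in the hull have total mass one, so the scale is the mass of the constant density
  -- `n`.
  have hcn : c = n * Fintype.card V := by
    have := congrArg (fun f : V → ℝ => ∑ v, f v) h1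
    simp only [Pi.smul_apply, smul_eq_mul, ← mul_sum, hsum] at this
    simp at this
    linarith
  have hc0 : 0 < c := by rw [hcn]; positivity
  convert hz using 1
  simp only [Prod.ext_iff]
  refine ⟨?_, ?_, ?_⟩
  · funext v
    have := congrFun h1 v
    simp only [Pi.smul_apply, smul_eq_mul, hcn] at this
    field_simp
    nlinarith
  · rw [← hcn, h2]; field_simp
  · rw [← hcn, h3]; field_simp

/-- A point of the hull over the constant density is given by a test channel. -/
lemma exists_testChannel_of_mem_hull [Nonempty V] {p : X → Y → V → ℝ} {a b : ℝ}
    (h : ((fun _ => (Fintype.card V : ℝ)⁻¹), a, b) ∈ convexHull ℝ (tiltSet p)) :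
    ∃ (m : ℕ) (q : V → Fin m → ℝ), (∀ v, q v ∈ stdSimplex ℝ (Fin m)) ∧
      ∑ j, entXY (fun x y v => p x y v * q v j) = Fintype.card V * a ∧
      ∑ j, entXVY (fun x y v => p x y v * q v j) = Fintype.card V * b := by
  have hV : (0 : ℝ) < Fintype.card V := by exact_mod_cast Fintype.card_pos
  obtain ⟨ι, _, z, w, hz, -, hw, hw1, hsum⟩ := eq_pos_convex_span_of_mem_convexHull h
  have hz' : ∀ i, ∃ ρ ∈ stdSimplex ℝ V, (ρ, entXY (fun x y v => p x y v * ρ v),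
      entXVY (fun x y v => p x y v * ρ v)) = z i := fun i => hz ⟨i, rfl⟩
  choose ρ hρ hρz using hz'
  set e := (Fintype.equivFin ι).symm
  simp only [Prod.ext_iff, Prod.fst_sum, Prod.snd_sum, ← hρz, Prod.smul_fst, Prod.smul_snd,
    smul_eq_mul] at hsum
  obtain ⟨h1, h2, h3⟩ := hsum
  -- Bayes' rule relative to uniform `V`: weight times density, divided by `1 / |V|`. The channel is
  -- stochastic because the mixture of the densities is uniform.
  refine ⟨Fintype.card ι, fun v j => Fintype.card V * w (e j) * ρ (e j) v, fun v =>
    ⟨fun j => mul_nonneg (mul_nonneg hV.le (hw _).le) ((hρ _).1 v), ?_⟩, ?_, ?_⟩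
  · rw [e.sum_comp (fun i => (Fintype.card V : ℝ) * w i * ρ i v)]
    have := congrFun h1 v
    simp only [Finset.sum_apply, Pi.smul_apply, smul_eq_mul] at this
    simp only [mul_assoc, ← mul_sum, this]
    field_simp
  · rw [← h2, mul_sum, ← e.sum_comp]
    refine sum_congr rfl fun j _ => ?_
    rw [← mul_assoc, ← entXY_smul]
    congr 1; funext x y v; ring
  · rw [← h3, mul_sum, ← e.sum_comp]
    refine sum_congr rfl fun j _ => ?_
    rw [← mul_assoc, ← entXVY_smul]
    congr 1; funext x y v; ring

end Hull

/-! ### The converse for one receiver at a fixed blocklength -/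

section Channel

variable {X Z W U ι : Type*} [Fintype X] [Fintype Z] [Fintype W] [Fintype U] [Fintype ι]

/-- The mutual information (in nats) between input and output of a channel. -/
def chanInfo (pW : W → ℝ) (t : W → U → ℝ) : ℝ :=
  hEnt (outLaw pW t) - ∑ w, pW w * hEnt (t w)

lemma outLaw_nonneg {pW : W → ℝ} {t : W → U → ℝ} (hW : ∀ w, 0 ≤ pW w) (ht : ∀ w u, 0 ≤ t w u)
    (u : U) : 0 ≤ outLaw pW t u :=
  sum_nonneg fun w _ => mul_nonneg (hW w) (ht w u)

/-- Fano's inequality combined with the information that the channel conveys. -/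
lemma sum_hEnt_le_of_decoder {θ : X → Z → ℝ} {T : X → U → ℝ} (hθ : ∀ x z, 0 ≤ θ x z)
    (hθ1 : ∑ x, ∑ z, θ x z = 1) (hT : ∀ x, T x ∈ stdSimplex ℝ U) (dec : U → Z → X) :
    ∑ z, hEnt (fun x => θ x z) ≤ log 2
      + (∑ x, ∑ z, ∑ u, θ x z * T x u * ind (dec u z ≠ x)) * log (Fintype.card X)
      + chanInfo (fun x => ∑ z, θ x z) T := by
  -- Two chain rules for the pair `(X, U)` on the fibre over `z`: H(X) = H(U) + H(X|U) - H(U|X).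
  have hz : ∀ z, hEnt (fun x => θ x z) = hEnt (fun u => ∑ x, θ x z * T x u)
      + ∑ u, hEnt (fun x => θ x z * T x u) - ∑ x, θ x z * hEnt (T x) := by
    intro z
    have h1 := hEnt_prod (fun w : X × U => θ w.1 z * T w.1 w.2)
    have h2 := hEnt_prod (fun w : U × X => θ w.2 z * T w.2 w.1)
    rw [← hEnt_comp_equiv (Equiv.prodComm X U)] at h2
    simp only [Equiv.prodComm_apply, Prod.fst_swap, Prod.snd_swap] at h2
    simp only [hEnt_smul, ← mul_sum, (hT _).2, mul_one] at h1
    linarith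
  have hfano : ∑ z, ∑ u, hEnt (fun x => θ x z * T x u) ≤ log 2
      + (∑ x, ∑ z, ∑ u, θ x z * T x u * ind (dec u z ≠ x)) * log (Fintype.card X) := by
    calc _ ≤ ∑ z, ∑ u, ((∑ x, θ x z * T x u) * log 2
            + (∑ x, θ x z * T x u * ind (dec u z ≠ x)) * log (Fintype.card X)) :=
          sum_le_sum fun z _ => sum_le_sum fun u _ =>
            hEnt_le_fano (fun x => mul_nonneg (hθ x z) ((hT x).1 u)) (dec u z)
      _ = _ := by
          simp only [sum_add_distrib, ← sum_mul]
          rw [sum_rotate (fun z u x => θ x z * T x u * ind (dec u z ≠ x)),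
            sum_rotate (fun z u x => θ x z * T x u)]
          simp only [← mul_sum, (hT _).2, mul_one, hθ1, one_mul]
  have hsup : ∑ z, hEnt (fun u => ∑ x, θ x z * T x u)
      ≤ hEnt (outLaw (fun x => ∑ z, θ x z) T) := by
    refine (sum_hEnt_le fun z u => sum_nonneg fun x _ =>
      mul_nonneg (hθ x z) ((hT x).1 u)).trans (le_of_eq ?_)
    congr 1; funext u
    simp only [outLaw, sum_mul]
    exact sum_comm
  have hcond : ∑ z, ∑ x, θ x z * hEnt (T x) = ∑ x, (∑ z, θ x z) * hEnt (T x) := by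
    rw [sum_comm]
    simp only [sum_mul]
  simp only [hz, sum_sub_distrib, sum_add_distrib, hcond, chanInfo]
  linarith

/-- The mutual information is concave in the input law. -/
lemma sum_chanInfo_le {P : ι → W → ℝ} {t : W → U → ℝ} (hP : ∀ i w, 0 ≤ P i w)
    (ht : ∀ w u, 0 ≤ t w u) {c : ℝ} (hc : 0 < c) :
    ∑ i, chanInfo (P i) t ≤ c * chanInfo (fun w => c⁻¹ * ∑ i, P i w) t := by
  -- The output entropy is superadditive in the input law, while the conditional entropy is linear
  -- in it.
  have h1 : ∑ i, hEnt (outLaw (P i) t) ≤ c * hEnt (outLaw (fun w => c⁻¹ * ∑ i, P i w) t) := by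
    rw [← hEnt_smul]
    refine (sum_hEnt_le fun i u => outLaw_nonneg (hP i) ht u).trans (le_of_eq ?_)
    congr 1; funext u
    unfold outLaw
    rw [sum_comm, mul_sum]
    refine sum_congr rfl fun w _ => ?_
    rw [← sum_mul]
    field_simp
  have h2 : ∑ i, ∑ w, P i w * hEnt (t w)
      = c * ∑ w, (c⁻¹ * ∑ i, P i w) * hEnt (t w) := by
    rw [sum_comm, mul_sum]
    refine sum_congr rfl fun w _ => ?_
    rw [← sum_mul]
    field_simp
  simp only [chanInfo, sum_sub_distrib, mul_sub]
  linarith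

/-- The information conveyed by a block of channel uses is at most the sum over the letters. -/
lemma chanInfo_block_le {n : ℕ} {pX : X → ℝ} (hpX : ∀ x, 0 ≤ pX x) {t : W → U → ℝ}
    (ht : ∀ w, t w ∈ stdSimplex ℝ U) (enc : X → Fin n → W) :
    chanInfo pX (fun x => blockChannel (Fin n) t (enc x))
      ≤ ∑ i, chanInfo (law pX (fun x => enc x i)) t := by
  classical
  have hlaw : ∀ (i : Fin n) (F : W → ℝ),
      ∑ w, law pX (fun x => enc x i) w * F w = ∑ x, pX x * F (enc x i) := by
    intro i F
    simp only [law_eq_sum, sum_mul]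
    rw [sum_comm]
    refine sum_congr rfl fun x _ => ?_
    rw [sum_eq_single (enc x i)]
    · rw [ind_of rfl, mul_one]
    · intro w _ hw
      rw [ind_of_not (Ne.symm hw)]; ring
    · simp
  have h1 : hEnt (outLaw pX (fun x => blockChannel (Fin n) t (enc x)))
      ≤ ∑ i, hEnt (outLaw (law pX (fun x => enc x i)) t) := by
    refine (hEnt_le_sum_law fun u => outLaw_nonneg hpX
      (fun x u => (blockChannel_mem_stdSimplex ht (enc x)).1 u) u).trans (le_of_eq ?_)
    refine sum_congr rfl fun i _ => ?_
    congr 1; funext b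
    rw [law_eq_sum]
    have h3 : outLaw (law pX fun x => enc x i) t b = ∑ x, pX x * t (enc x i) b :=
      hlaw i fun w => t w b
    rw [h3]
    unfold outLaw
    simp only [sum_mul]
    rw [sum_comm]
    refine sum_congr rfl fun x _ => ?_
    simp only [mul_assoc, ← mul_sum]
    congr 1
    have h2 : ∀ u : Fin n → U, blockChannel (Fin n) t (enc x) u * ind (u i = b)
        = ∏ j, (t (enc x j) (u j) * if j = i then ind (u j = b) else 1) := by
      intro u; rw [prod_mul_distrib]; simp [blockChannel]
    simp only [h2]
    rw [sum_prod_pi (fun j a => t (enc x j) a * if j = i then ind (a = b) else 1),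
      Finset.prod_eq_single i]
    · simp only [if_true]
      rw [sum_eq_single b]
      · rw [ind_of rfl, mul_one]
      · intro a _ ha; rw [ind_of_not ha, mul_zero]
      · simp
    · intro j _ hj
      simp [hj, (ht _).2]
    · simp
  have h2 : ∑ x, pX x * hEnt (blockChannel (Fin n) t (enc x))
      = ∑ i, ∑ w, law pX (fun x => enc x i) w * hEnt (t w) := by
    simp only [hlaw]
    rw [sum_comm]
    refine sum_congr rfl fun x _ => ?_
    rw [← mul_sum]
    congr 1
    exact hEnt_prod_pi fun i => (ht (enc x i)).2
  unfold chanInfo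
  rw [sum_sub_distrib, ← h2]
  linarith

end Channel

/-! ### From a code to a point of the cone -/

section Converse

universe u₁ u₂ u₃

variable {X : Type u₁} {Y : Type u₂} {V : Type u₃} {W U : Type*} [Fintype X] [Fintype Y]
  [Fintype V] [Fintype W] [Fintype U]

/-- The letter law of the channel input, averaged over the block. -/
def inputLaw {ns nc : ℕ} (pX : X → ℝ) (enc : (Fin ns → X) → Fin nc → W) (w : W) : ℝ :=
  (nc : ℝ)⁻¹ * ∑ i, law (fun x : Fin ns → X => ∏ j, pX (x j)) (fun x => enc x i) w

lemma sum_law {Ω α : Type*} [Fintype Ω] [Fintype α] (p : Ω → ℝ) (f : Ω → α) :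
    ∑ a, law p f a = ∑ ω, p ω := by
  classical
  simp only [law_eq_sum]
  rw [sum_comm]
  refine sum_congr rfl fun ω _ => ?_
  simp [ind]

lemma law_nonneg {Ω α : Type*} [Fintype Ω] {p : Ω → ℝ} (hp : ∀ ω, 0 ≤ p ω) (f : Ω → α) (a : α) :
    0 ≤ law p f a :=
  sum_nonneg fun _ _ => hp _

lemma inputLaw_mem_stdSimplex {ns nc : ℕ} (hnc : 0 < nc) {pX : X → ℝ} (hpX : pX ∈ stdSimplex ℝ X)
    (enc : (Fin ns → X) → Fin nc → W) : inputLaw pX enc ∈ stdSimplex ℝ W := by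
  have hnc' : (0 : ℝ) < nc := by exact_mod_cast hnc
  refine ⟨fun w => mul_nonneg (by positivity) (sum_nonneg fun i _ =>
    law_nonneg (fun x => prod_nonneg fun j _ => hpX.1 _) _ _), ?_⟩
  unfold inputLaw
  rw [← mul_sum, sum_comm]
  simp only [sum_law, sum_iid hpX.2]
  simp [hnc'.ne']

/-- The exact splitting `entXVY_block` with the trivial density makes each stage contribute one copy
of the single-letter entropy. -/
lemma entXVY_blockPmf {p : X → Y → V → ℝ} (hp1 : ∑ x, ∑ y, ∑ v, p x y v = 1) (n : ℕ) :
    entXVY (blockPmf (Fin n) p) = n * entXVY p := by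
  induction n with
  | zero => simp [entXVY, hEnt, Fintype.sum_prod_type]
  | succ n ih =>
    have h := entXVY_block (n := n) p (fun _ => 1)
    simp only [mul_one] at h
    rw [h]
    have h1 : ∀ y₂, entXVY (fun x y v => p x y v * ∑ x₂, ∑ v₂, blockPmf (Fin n) p x₂ y₂ v₂)
        = (∑ x₂, ∑ v₂, blockPmf (Fin n) p x₂ y₂ v₂) * entXVY p := by
      intro y₂
      rw [← entXVY_smul]
      congr 1; funext x y v; ring
    have h2 : ∀ x y v, entXVY (fun x₂ y₂ v₂ => blockPmf (Fin n) p x₂ y₂ v₂ * p x y v)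
        = p x y v * entXVY (blockPmf (Fin n) p) := by
      intro x y v
      rw [← entXVY_smul]
      congr 1; funext x y v; ring
    simp only [h1, h2, ← sum_mul, hp1, ih]
    rw [sum_comm, sum_blockPmf hp1]
    push_cast
    ring

/-- A helper message reduces the conditional entropy by at most the logarithm of the number of
messages. -/
lemma entXVY_sub_log_le {M : Type*} [Fintype M] {μ : X → Y → V → ℝ} (hμ : ∀ x y v, 0 ≤ μ x y v)
    (hμ1 : ∑ x, ∑ y, ∑ v, μ x y v = 1) {ρ : M → V → ℝ} (hρ : ∀ m v, 0 ≤ ρ m v)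
    (hρ1 : ∀ v, ∑ m, ρ m v = 1) :
    entXVY μ - log (Fintype.card M) ≤ ∑ m, entXVY (fun x y v => μ x y v * ρ m v) := by
  have hy : ∀ y, hEnt (fun z : X × V => μ z.1 y z.2)
      - (∑ x, ∑ v, μ x y v) * log (Fintype.card M)
      ≤ ∑ m, hEnt (fun z : X × V => μ z.1 y z.2 * ρ m z.2) := by
    intro y
    -- The chain rule in both orders, on each fibre of `Y`: the message entropy is at most the
    -- logarithm of the number of messages, and the entropy of the message given `(X, V)` is
    -- nonnegative.
    have h1 := hEnt_prod (fun w : M × (X × V) => μ w.2.1 y w.2.2 * ρ w.1 w.2.2)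
    have h2 := hEnt_prod (fun w : (X × V) × M => μ w.1.1 y w.1.2 * ρ w.2 w.1.2)
    rw [← hEnt_comp_equiv (Equiv.prodComm M (X × V))] at h2
    simp only [Equiv.prodComm_apply, Prod.fst_swap, Prod.snd_swap, ← mul_sum, hρ1, mul_one] at h2
    have h3 : 0 ≤ ∑ z : X × V, hEnt (fun m => μ z.1 y z.2 * ρ m z.2) :=
      sum_nonneg fun z _ => hEnt_nonneg fun m => mul_nonneg (hμ _ _ _) (hρ _ _)
    have h4 := hEnt_le_mul_log_card (f := fun m : M => ∑ z : X × V, μ z.1 y z.2 * ρ m z.2)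
      (fun m => sum_nonneg fun z _ => mul_nonneg (hμ _ _ _) (hρ _ _))
    rw [sum_comm] at h4
    simp only [← mul_sum, hρ1, mul_one] at h4
    rw [Fintype.sum_prod_type] at h4
    linarith
  have h := sum_le_sum fun y (_ : y ∈ univ) => hy y
  rw [sum_sub_distrib, ← sum_mul, sum_comm (s := univ (α := Y)), hμ1, one_mul] at h
  unfold entXVY
  rw [sum_comm (s := univ (α := M))]
  exact h

/-- The converse for one receiver at a fixed blocklength. -/
theorem exists_tiltCone_of_code {p : X → Y → V → ℝ} (hp : ∀ x y v, 0 ≤ p x y v)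
    (hp1 : ∑ x, ∑ y, ∑ v, p x y v = 1) {t : W → U → ℝ} (ht : ∀ w, t w ∈ stdSimplex ℝ U)
    {pX : X → ℝ} (hpX : ∀ x, ∑ y, ∑ v, p x y v = pX x) {ns nc M : ℕ} (hnc : 0 < nc)
    (enc : (Fin ns → X) → Fin nc → W) (helper : (Fin ns → V) → Fin M)
    (dec : (Fin nc → U) → (Fin ns → Y) → Fin M → Fin ns → X) :
    ∃ a b, ((fun _ => (ns : ℝ)), a, b) ∈ tiltCone p ∧
      a ≤ log 2 + codeError (blockPmf (Fin ns) p) (blockChannel (Fin nc) t) enc helper dec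
          * (ns * log (Fintype.card X)) + nc * chanInfo (inputLaw pX enc) t ∧
      ns * entXVY p - log M ≤ b := by
  classical
  set ρ : Fin M → (Fin ns → V) → ℝ := fun m v => ind (helper v = m) with hρ
  have hρ0 : ∀ m v, 0 ≤ ρ m v := fun m v => ind_nonneg _
  have hρF : ∀ v (F : Fin M → ℝ), ∑ m, ρ m v * F m = F (helper v) := by
    intro v F
    simp [hρ, ind]
  have hρ1 : ∀ v, ∑ m, ρ m v = 1 := fun v => by simpa using hρF v fun _ => 1
  have hpX0 : ∀ x, 0 ≤ pX x := fun x => by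
    rw [← hpX]; exact sum_nonneg fun y _ => sum_nonneg fun v _ => hp x y v
  have hblock : ∀ x y v, 0 ≤ blockPmf (Fin ns) p x y v := fun x y v =>
    prod_nonneg fun i _ => hp _ _ _
  -- `ULift` moves the message set into the universe required by the induction.
  obtain ⟨a, b, hab, ha, hb⟩ := exists_mem_tiltCone hp hp1 ns (ULift (Fin M))
    (fun m => ρ m.down) (fun m => hρ0 m.down)
    (fun v => by rw [← hρ1 v]; exact Equiv.ulift.sum_comp (fun m => ρ m v))
  have hulift : ∀ F : Fin M → ℝ, ∑ j : ULift (Fin M), F j.down = ∑ m, F m :=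
    fun F => Equiv.ulift.sum_comp F
  refine ⟨a, b, hab, ha.trans ?_, le_trans ?_ hb⟩
  · rw [hulift (fun m => entXY fun x y v => blockPmf (Fin ns) p x y v * ρ m v)]
    -- Fano's inequality is applied with the message and the side information together as decoder
    -- input.
    set θ : (Fin ns → X) → Fin M × (Fin ns → Y) → ℝ := fun x z =>
      ∑ v, blockPmf (Fin ns) p x z.2 v * ρ z.1 v with hθ
    have hθ0 : ∀ x z, 0 ≤ θ x z := fun x z => sum_nonneg fun v _ =>
      mul_nonneg (hblock _ _ _) (hρ0 _ _)
    have hmarg : ∀ x, ∑ z, θ x z = ∏ i, pX (x i) := by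
      intro x
      simp only [hθ, Fintype.sum_prod_type]
      rw [sum_comm]
      have : ∀ y, ∑ m, ∑ v, blockPmf (Fin ns) p x y v * ρ m v
          = ∑ v, blockPmf (Fin ns) p x y v := by
        intro y
        rw [sum_comm]
        simp only [← mul_sum, hρ1, mul_one]
      simp only [this, ← hpX]
      exact sum_prod_pi₂ (fun i y v => p (x i) y v)
    have hpX1 : ∑ x, pX x = 1 := by simp only [← hpX, hp1]
    have h := sum_hEnt_le_of_decoder (T := fun x => blockChannel (Fin nc) t (enc x)) hθ0
      (by simp only [hmarg]; exact sum_iid hpX1)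
      (fun x => blockChannel_mem_stdSimplex ht (enc x)) (fun u z => dec u z.2 z.1)
    have e1 : ∑ m, entXY (fun x y v => blockPmf (Fin ns) p x y v * ρ m v)
        = ∑ z, hEnt (fun x => θ x z) := by
      rw [Fintype.sum_prod_type]; rfl
    have e2 : ∑ x, ∑ z, ∑ u, θ x z * blockChannel (Fin nc) t (enc x) u * ind (dec u z.2 z.1 ≠ x)
        = codeError (blockPmf (Fin ns) p) (blockChannel (Fin nc) t) enc helper dec := by
      unfold codeError
      refine sum_congr rfl fun x _ => ?_
      rw [Fintype.sum_prod_type, sum_comm]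
      refine sum_congr rfl fun y _ => ?_
      simp only [hθ, sum_mul]
      rw [sum_rotate]
      refine sum_congr rfl fun v _ => ?_
      rw [sum_comm]
      refine sum_congr rfl fun u _ => ?_
      rw [← hρF v (fun m => blockPmf (Fin ns) p x y v * blockChannel (Fin nc) t (enc x) u
        * ind (dec u y m ≠ x))]
      exact sum_congr rfl fun m _ => by ring
    have e3 : log (Fintype.card (Fin ns → X)) = ns * log (Fintype.card X) := by
      simp [log_pow]
    have e4 : chanInfo (fun x => ∑ z, θ x z) (fun x => blockChannel (Fin nc) t (enc x))
        ≤ nc * chanInfo (inputLaw pX enc) t := by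
      simp only [hmarg]
      refine (chanInfo_block_le (fun x => prod_nonneg fun i _ => hpX0 _) ht enc).trans ?_
      exact sum_chanInfo_le (fun i w => law_nonneg (fun x => prod_nonneg fun i _ => hpX0 _) _ _)
        (fun w u => (ht w).1 u) (by exact_mod_cast hnc)
    rw [e1]
    rw [e2, e3] at h
    linarith
  · rw [hulift (fun m => entXVY fun x y v => blockPmf (Fin ns) p x y v * ρ m v)]
    have h := entXVY_sub_log_le hblock (sum_blockPmf hp1) hρ0 hρ1
    rwa [entXVY_blockPmf hp1, Fintype.card_fin] at h

end Converse

/-! ### Information quantities of random variables -/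

section Laws

variable {Ω α β γ : Type*} [Fintype Ω] [Fintype α]

lemma law_comp (p : Ω → ℝ) (f : Ω → α) (g : α → β) (b : β) :
    law p (fun ω => g (f ω)) b = ∑ a, law p f a * ind (g a = b) := by
  classical
  simp only [law_eq_sum, sum_mul]
  rw [sum_comm]
  refine sum_congr rfl fun ω _ => ?_
  rw [sum_eq_single (f ω)]
  · rw [ind_of (q := f ω = f ω) rfl, mul_one]
  · intro a _ ha; rw [ind_of_not (Ne.symm ha)]; ring
  · simp

variable [Fintype β] [Fintype γ]

lemma sum_law_pair_left (p : Ω → ℝ) (f : Ω → α) (g : Ω → β) (b : β) :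
    ∑ a, law p (fun ω => (f ω, g ω)) (a, b) = law p g b := by
  classical
  rw [law_comp p (fun ω => (f ω, g ω)) Prod.snd b, Fintype.sum_prod_type]
  refine sum_congr rfl fun a _ => ?_
  simp [ind]

lemma sum_law_pair_right (p : Ω → ℝ) (f : Ω → α) (g : Ω → β) (a : α) :
    ∑ b, law p (fun ω => (f ω, g ω)) (a, b) = law p f a := by
  classical
  rw [law_comp p (fun ω => (f ω, g ω)) Prod.fst a, Fintype.sum_prod_type_right]
  refine sum_congr rfl fun b _ => ?_
  simp [ind]

lemma sum_law_triple_mid (p : Ω → ℝ) (f : Ω → α) (g : Ω → β) (h : Ω → γ) (a : α) (c : γ) :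
    ∑ b, law p (fun ω => (f ω, g ω, h ω)) (a, b, c) = law p (fun ω => (f ω, h ω)) (a, c) := by
  classical
  rw [law_comp p (fun ω => (f ω, g ω, h ω)) (fun z => (z.1, z.2.2)) (a, c)]
  simp [ind, Fintype.sum_prod_type, ite_and]

lemma sum_mul_log_div (f : α → ℝ) (hf : ∀ a, 0 ≤ f a) :
    ∑ a, f a * log (f a / ∑ a, f a) = -hEnt f := by
  have h : ∀ a, f a * log (f a / ∑ a, f a) = -negMulLog (f a) - f a * log (∑ a, f a) := by
    intro a
    by_cases h0 : f a = 0
    · simp [h0]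
    have hF : (∑ a, f a) ≠ 0 := fun h =>
      h0 ((sum_eq_zero_iff_of_nonneg fun a _ => hf a).1 h a (mem_univ a))
    rw [log_div h0 hF, negMulLog]
    ring
  simp only [h, sum_sub_distrib, sum_neg_distrib, ← sum_mul, hEnt]
  rw [negMulLog]
  ring

lemma logb_two_mul_log_two (a : ℝ) : logb 2 a * log 2 = log a := by
  rw [logb, div_mul_cancel₀ _ (log_pos one_lt_two).ne']

lemma condEntropy_mul_log_two {p : Ω → ℝ} (hp : ∀ ω, 0 ≤ p ω) (f : Ω → α) (g : Ω → β) :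
    condEntropy p f g * log 2 = ∑ b, hEnt (fun a => law p (fun ω => (f ω, g ω)) (a, b)) := by
  unfold condEntropy
  rw [neg_mul, sum_comm, sum_mul, ← sum_neg_distrib]
  refine sum_congr rfl fun b _ => ?_
  rw [neg_eq_iff_eq_neg, ← sum_mul_log_div _ (fun a => law_nonneg hp _ _), sum_mul]
  refine sum_congr rfl fun a _ => ?_
  rw [mul_assoc, logb_two_mul_log_two, sum_law_pair_left]

/-- Mutual information becomes H(g) - H(g|f) in nats. Total mass one is needed because `hEnt`
normalizes its argument whereas `mutualInfo` does not. -/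
lemma mutualInfo_mul_log_two {p : Ω → ℝ} (hp : ∀ ω, 0 ≤ p ω) (f : Ω → α) (g : Ω → β)
    (hg : ∑ b, law p g b = 1) :
    mutualInfo p f g * log 2
      = hEnt (law p g) - ∑ a, hEnt (fun b => law p (fun ω => (f ω, g ω)) (a, b)) := by
  have hpt : ∀ a b, law p (fun ω => (f ω, g ω)) (a, b) *
      logb 2 (law p (fun ω => (f ω, g ω)) (a, b) / (law p f a * law p g b)) * log 2
      = law p (fun ω => (f ω, g ω)) (a, b) * log (law p (fun ω => (f ω, g ω)) (a, b)
        / ∑ b, law p (fun ω => (f ω, g ω)) (a, b))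
        - law p (fun ω => (f ω, g ω)) (a, b) * log (law p g b / ∑ b, law p g b) := by
    intro a b
    rw [mul_assoc, logb_two_mul_log_two, hg, div_one, sum_law_pair_right]
    by_cases h0 : law p (fun ω => (f ω, g ω)) (a, b) = 0
    · simp [h0]
    have hpos := (law_nonneg hp (fun ω => (f ω, g ω)) (a, b)).lt_of_ne' h0
    have h1 : 0 < law p f a := hpos.trans_le (by
      rw [← sum_law_pair_right p f g a]
      exact single_le_sum (f := fun b => law p (fun ω => (f ω, g ω)) (a, b))
        (fun b _ => law_nonneg hp _ _) (mem_univ b))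
    have h2 : 0 < law p g b := hpos.trans_le (by
      rw [← sum_law_pair_left p f g b]
      exact single_le_sum (f := fun a => law p (fun ω => (f ω, g ω)) (a, b))
        (fun a _ => law_nonneg hp _ _) (mem_univ a))
    rw [← div_div, log_div (div_pos hpos h1).ne' h2.ne']
    ring
  unfold mutualInfo
  simp only [sum_mul, hpt, sum_sub_distrib]
  rw [sum_comm (f := fun a b => law p (fun ω => (f ω, g ω)) (a, b) *
    log (law p g b / ∑ b, law p g b))]
  simp only [← sum_mul, sum_law_pair_left, sum_mul_log_div _ (law_nonneg hp g)]
  have : ∀ a, ∑ b, law p (fun ω => (f ω, g ω)) (a, b) *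
      log (law p (fun ω => (f ω, g ω)) (a, b) / law p f a)
      = -hEnt (fun b => law p (fun ω => (f ω, g ω)) (a, b)) := by
    intro a
    rw [← sum_mul_log_div _ (fun b => law_nonneg hp _ _)]
    simp only [sum_law_pair_right]
  simp only [sum_law_pair_right, this, sum_neg_distrib]
  ring

lemma condMutualInfo_mul_log_two {p : Ω → ℝ} (hp : ∀ ω, 0 ≤ p ω) (f : Ω → α) (g : Ω → β)
    (h : Ω → γ) :
    condMutualInfo p f g h * log 2
      = ∑ c, hEnt (fun a => law p (fun ω => (f ω, h ω)) (a, c))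
        - ∑ b, ∑ c, hEnt (fun a => law p (fun ω => (f ω, g ω, h ω)) (a, b, c)) := by
  set l := law p (fun ω => (f ω, g ω, h ω)) with hl
  have hl0 : ∀ z, 0 ≤ l z := fun z => law_nonneg hp _ _
  have hac : ∀ a c, ∑ b, l (a, b, c) = law p (fun ω => (f ω, h ω)) (a, c) :=
    fun a c => sum_law_triple_mid p f g h a c
  have hbc : ∀ b c, ∑ a, l (a, b, c) = law p (fun ω => (g ω, h ω)) (b, c) :=
    fun b c => sum_law_pair_left p f (fun ω => (g ω, h ω)) (b, c)
  have hc : ∀ c, ∑ a, law p (fun ω => (f ω, h ω)) (a, c) = law p h c :=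
    fun c => sum_law_pair_left p f h c
  have hpt : ∀ a b c, l (a, b, c) * logb 2 (l (a, b, c) * law p h c /
      (law p (fun ω => (f ω, h ω)) (a, c) * law p (fun ω => (g ω, h ω)) (b, c))) * log 2
      = l (a, b, c) * log (l (a, b, c) / law p (fun ω => (g ω, h ω)) (b, c))
        - l (a, b, c) * log (law p (fun ω => (f ω, h ω)) (a, c) / law p h c) := by
    intro a b c
    rw [mul_assoc, logb_two_mul_log_two]
    by_cases h0 : l (a, b, c) = 0
    · simp [h0]
    have hpos := (hl0 (a, b, c)).lt_of_ne' h0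
    have h1 : 0 < law p (fun ω => (f ω, h ω)) (a, c) := hpos.trans_le (by
      rw [← hac]
      exact single_le_sum (f := fun b => l (a, b, c)) (fun b _ => hl0 _) (mem_univ b))
    have h2 : 0 < law p (fun ω => (g ω, h ω)) (b, c) := hpos.trans_le (by
      rw [← hbc]
      exact single_le_sum (f := fun a => l (a, b, c)) (fun b _ => hl0 _) (mem_univ a))
    have h3 : 0 < law p h c := h1.trans_le (by
      rw [← hc]
      exact single_le_sum (f := fun a => law p (fun ω => (f ω, h ω)) (a, c))
        (fun b _ => law_nonneg hp _ _) (mem_univ a))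
    rw [log_div (mul_pos hpos h3).ne' (mul_pos h1 h2).ne', log_mul hpos.ne' h3.ne',
      log_mul h1.ne' h2.ne', log_div hpos.ne' h2.ne', log_div h1.ne' h3.ne']
    ring
  unfold condMutualInfo
  simp only [sum_mul, ← hl, hpt, sum_sub_distrib]
  have e1 : ∑ a, ∑ b, ∑ c, l (a, b, c) * log (l (a, b, c) / law p (fun ω => (g ω, h ω)) (b, c))
      = -∑ b, ∑ c, hEnt (fun a => l (a, b, c)) := by
    rw [← sum_rotate (fun b c a =>
      l (a, b, c) * log (l (a, b, c) / law p (fun ω => (g ω, h ω)) (b, c))), ← sum_neg_distrib]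
    refine sum_congr rfl fun b _ => ?_
    rw [← sum_neg_distrib]
    refine sum_congr rfl fun c _ => ?_
    rw [← sum_mul_log_div _ (fun a => hl0 _), hbc]
  have e2 : ∑ a, ∑ b, ∑ c, l (a, b, c) * log (law p (fun ω => (f ω, h ω)) (a, c) / law p h c)
      = -∑ c, hEnt (fun a => law p (fun ω => (f ω, h ω)) (a, c)) := by
    rw [sum_rotate, ← sum_neg_distrib]
    refine sum_congr rfl fun c _ => ?_
    simp only [← sum_mul, hac]
    rw [← sum_mul_log_div _ (fun a => law_nonneg hp _ _), hc]
  rw [e1, e2]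
  ring

lemma condMutualInfo_nonneg {p : Ω → ℝ} (hp : ∀ ω, 0 ≤ p ω) (f : Ω → α) (g : Ω → β)
    (h : Ω → γ) : 0 ≤ condMutualInfo p f g h := by
  have h1 := condMutualInfo_mul_log_two hp f g h
  have h2 : ∑ b, ∑ c, hEnt (fun a => law p (fun ω => (f ω, g ω, h ω)) (a, b, c))
      ≤ ∑ c, hEnt (fun a => law p (fun ω => (f ω, h ω)) (a, c)) := by
    rw [sum_comm]
    refine sum_le_sum fun c _ => ?_
    refine (sum_hEnt_le fun b a => law_nonneg hp _ _).trans (le_of_eq ?_)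
    congr 1; funext a
    exact sum_law_triple_mid p f g h a c
  have h3 : 0 ≤ condMutualInfo p f g h * log 2 := by linarith
  exact nonneg_of_mul_nonneg_left h3 (log_pos one_lt_two)

end Laws

/-! ### The marginals seen by one receiver -/

section Receiver

variable {K : ℕ} {X W : Type*} {Y V U : Fin K → Type*}
  [Fintype X] [Fintype W] [∀ k, Fintype (Y k)] [∀ k, Fintype (V k)] [∀ k, Fintype (U k)]

/-- The law of `(X, Y_k, V_k)`. -/
def sourceLaw (P : Letter X Y V → ℝ) (k : Fin K) (x : X) (y : Y k) (v : V k) : ℝ :=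
  law P (fun s => (s.1, s.2.1 k, s.2.2 k)) (x, y, v)

/-- The channel from `W` to `U_k`. -/
def receiverChannel (T : W → (∀ k, U k) → ℝ) (k : Fin K) (w : W) : U k → ℝ :=
  law (T w) (fun u => u k)

lemma sourceLaw_nonneg {P : Letter X Y V → ℝ} (hP : P ∈ stdSimplex ℝ (Letter X Y V)) (k : Fin K)
    (x : X) (y : Y k) (v : V k) : 0 ≤ sourceLaw P k x y v :=
  law_nonneg hP.1 _ _

lemma sum_sourceLaw {P : Letter X Y V → ℝ} (hP : P ∈ stdSimplex ℝ (Letter X Y V)) (k : Fin K) :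
    ∑ x, ∑ y, ∑ v, sourceLaw P k x y v = 1 := by
  have h := sum_law P (fun s => (s.1, s.2.1 k, s.2.2 k))
  simp only [Fintype.sum_prod_type] at h
  unfold sourceLaw
  rw [h, ← hP.2]
  simp only [Fintype.sum_prod_type]

lemma sum_sum_sourceLaw (P : Letter X Y V → ℝ) (k : Fin K) (x : X) :
    ∑ y, ∑ v, sourceLaw P k x y v = law P Prod.fst x := by
  have h := sum_law_pair_right P Prod.fst (fun s => (s.2.1 k, s.2.2 k)) x
  rw [Fintype.sum_prod_type] at h
  exact h

lemma receiverChannel_mem_stdSimplex {T : W → (∀ k, U k) → ℝ}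
    (hT : ∀ w, T w ∈ stdSimplex ℝ (∀ k, U k)) (k : Fin K) (w : W) :
    receiverChannel T k w ∈ stdSimplex ℝ (U k) :=
  ⟨fun _ => law_nonneg (hT w).1 _ _, (sum_law _ _).trans (hT w).2⟩

/-- The error event of receiver `k` involves only its own side information and output, so the iid
letters may be replaced by their images. -/
lemma errorProb_eq_codeError {ns nc : ℕ} {R : Fin K → ℝ} (c : Code X W Y V U ns nc R)
    (P : Letter X Y V → ℝ) (T : W → (∀ k, U k) → ℝ) (k : Fin K) :
    c.errorProb P T k = codeError (blockPmf (Fin ns) (sourceLaw P k))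
      (blockChannel (Fin nc) (receiverChannel T k)) c.enc (c.helper k) (c.dec k) := by
  unfold codeError
  rw [sum_sum_sum_arrow]
  have h := sum_indep_comp (ι := Fin ns) (fun _ => P) (fun s => (s.1, s.2.1 k, s.2.2 k))
    (fun z => ∑ u : Fin nc → U k, blockChannel (Fin nc) (receiverChannel T k)
      (c.enc fun j => (z j).1) u * ind (c.dec k u (fun i => (z i).2.1)
        (c.helper k fun i => (z i).2.2) ≠ fun i => (z i).1))
  simp only [mul_sum] at h
  simp only [mul_assoc]
  refine Eq.trans ?_ h
  unfold Code.errorProb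
  refine sum_congr rfl fun s _ => ?_
  rw [← mul_sum]
  have h2 := sum_indep_comp (ι := Fin nc) (fun i => T (c.enc (fun j => (s j).1) i))
    (fun u => u k) (fun u => ind (c.dec k u (fun i => (s i).2.1 k)
        (c.helper k fun i => (s i).2.2 k) ≠ fun i => (s i).1))
  unfold blockChannel receiverChannel
  rw [← h2, mul_sum]
  refine sum_congr rfl fun u _ => ?_
  unfold ind
  split_ifs <;> simp

lemma channelInfo_mul_log_two {PW : W → ℝ} (hPW : PW ∈ stdSimplex ℝ W) {T : W → (∀ k, U k) → ℝ}
    (hT : ∀ w, T w ∈ stdSimplex ℝ (∀ k, U k)) (k : Fin K) :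
    channelInfo PW T k * log 2 = chanInfo PW (receiverChannel T k) := by
  classical
  have hpos : ∀ z, 0 ≤ channelJoint PW T z := fun z => mul_nonneg (hPW.1 _) ((hT _).1 _)
  have hjoint : ∀ w u, law (channelJoint PW T) (fun z => (z.1, z.2 k)) (w, u)
      = PW w * receiverChannel T k w u := by
    intro w u
    unfold receiverChannel
    simp only [law_eq_sum, Fintype.sum_prod_type, channelJoint]
    rw [sum_eq_single w]
    · simp only [Prod.mk.injEq, true_and, mul_sum, mul_assoc]
    · intro w' _ hw
      simp [ind, hw]
    · simp
  have hout : law (channelJoint PW T) (fun z => z.2 k) = outLaw PW (receiverChannel T k) := by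
    funext u
    rw [← sum_law_pair_left (channelJoint PW T) (fun z => z.1) (fun z => z.2 k) u]
    simp only [hjoint, outLaw]
  have hsum : ∑ u, law (channelJoint PW T) (fun z => z.2 k) u = 1 := by
    rw [sum_law]
    simp only [Fintype.sum_prod_type, channelJoint, ← mul_sum, (hT _).2, mul_one, hPW.2]
  unfold channelInfo chanInfo
  rw [mutualInfo_mul_log_two hpos _ _ hsum, hout]
  simp only [hjoint, hEnt_smul]

end Receiver

/-! ### Auxiliary variables and test channels -/

section Auxiliary

variable {K : ℕ} {X W : Type*} {Y V U : Fin K → Type*}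
  [Fintype X] [Fintype W] [∀ k, Fintype (Y k)] [∀ k, Fintype (V k)] [∀ k, Fintype (U k)]
  {m : Fin K → ℕ}

/-- The law of `(X, Y_k, V_k, A_k)`. -/
def auxLaw (Q : Letter X Y V × (∀ k, Fin (m k)) → ℝ) (k : Fin K) (x : X) (y : Y k) (v : V k)
    (a : Fin (m k)) : ℝ :=
  law Q (fun z => (z.1.1, z.1.2.1 k, z.1.2.2 k, z.2 k)) (x, y, v, a)

section Factored

variable {Q : Letter X Y V × (∀ k, Fin (m k)) → ℝ} {k : Fin K} {p : X → Y k → V k → ℝ}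
  {q : V k → Fin (m k) → ℝ}

lemma law_comp_aux {β : Type*} (g : X × Y k × V k × Fin (m k) → β) (b : β) :
    law Q (fun z => g (z.1.1, z.1.2.1 k, z.1.2.2 k, z.2 k)) b
      = ∑ x, ∑ y, ∑ v, ∑ a, auxLaw Q k x y v a * ind (g (x, y, v, a) = b) := by
  rw [law_comp Q (fun z => (z.1.1, z.1.2.1 k, z.1.2.2 k, z.2 k)) g b]
  simp only [Fintype.sum_prod_type]
  rfl

lemma law_VAY (hF : ∀ x y v a, auxLaw Q k x y v a = p x y v * q v a)
    (v : V k) (a : Fin (m k)) (y : Y k) :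
    law Q (fun z => (z.1.2.2 k, z.2 k, z.1.2.1 k)) (v, a, y) = ∑ x, p x y v * q v a := by
  classical
  rw [law_comp_aux (fun w => (w.2.2.1, w.2.2.2, w.2.1))]
  simp [hF, ind, ite_and]

lemma law_VY (hF : ∀ x y v a, auxLaw Q k x y v a = p x y v * q v a)
    (hq1 : ∀ v, ∑ a, q v a = 1) (v : V k) (y : Y k) :
    law Q (fun z => (z.1.2.2 k, z.1.2.1 k)) (v, y) = ∑ x, p x y v := by
  classical
  rw [law_comp_aux (fun w => (w.2.2.1, w.2.1))]
  simp [hF, ind, ite_and, ← mul_sum, hq1]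

lemma law_AY (hF : ∀ x y v a, auxLaw Q k x y v a = p x y v * q v a)
    (a : Fin (m k)) (y : Y k) :
    law Q (fun z => (z.2 k, z.1.2.1 k)) (a, y) = margAY p q a y := by
  classical
  rw [law_comp_aux (fun w => (w.2.2.2, w.2.1))]
  simp [hF, ind, ite_and, margAY]

lemma law_XAY (hF : ∀ x y v a, auxLaw Q k x y v a = p x y v * q v a)
    (x : X) (a : Fin (m k)) (y : Y k) :
    law Q (fun z => (z.1.1, (z.2 k, z.1.2.1 k))) (x, (a, y)) = margXAY p q x a y := by
  classical
  rw [law_comp_aux (fun w => (w.1, (w.2.2.2, w.2.1)))]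
  simp [hF, ind, ite_and, margXAY]

lemma law_Y (hF : ∀ x y v a, auxLaw Q k x y v a = p x y v * q v a)
    (hq1 : ∀ v, ∑ a, q v a = 1) (y : Y k) :
    law Q (fun z => z.1.2.1 k) y = margY p y := by
  classical
  rw [law_comp_aux (fun w => w.2.1)]
  simp [hF, ind, margY, ← mul_sum, hq1]

lemma equivocation_mul_log_two (hF : ∀ x y v a, auxLaw Q k x y v a = p x y v * q v a)
    (hQ : ∀ z, 0 ≤ Q z) :
    equivocation m Q k * log 2 = ∑ a, entXY (fun x y v => p x y v * q v a) := by
  unfold equivocation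
  rw [condEntropy_mul_log_two hQ, Fintype.sum_prod_type]
  simp only [law_XAY hF]
  rfl

/-- Adding `X` changes nothing: given `V` and `Y`, the auxiliary variable carries no information on
`X`, so the terms H(X|V,Y) cancel. This form matches the quantity tracked by the converse. -/
lemma helperInfo_mul_log_two (hF : ∀ x y v a, auxLaw Q k x y v a = p x y v * q v a)
    (hQ : ∀ z, 0 ≤ Q z) (hq1 : ∀ v, ∑ a, q v a = 1) :
    helperInfo m Q k * log 2 = entXVY p - ∑ a, entXVY (fun x y v => p x y v * q v a) := by
  have hchain : ∀ r : X → Y k → V k → ℝ,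
      entXVY r = ∑ y, hEnt (fun v => ∑ x, r x y v) + ∑ y, ∑ v, hEnt (fun x => r x y v) := by
    intro r
    unfold entXVY
    rw [← sum_add_distrib]
    refine sum_congr rfl fun y _ => ?_
    rw [← hEnt_comp_equiv (Equiv.prodComm (V k) X), hEnt_prod]
    rfl
  have hcancel : ∑ a, ∑ y, ∑ v, hEnt (fun x => p x y v * q v a)
      = ∑ y, ∑ v, hEnt (fun x => p x y v) := by
    have h1 : ∀ y v a, hEnt (fun x => p x y v * q v a) = q v a * hEnt (fun x => p x y v) := by
      intro y v a
      rw [← hEnt_smul]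
      congr 1; funext x; ring
    simp only [h1]
    rw [← sum_rotate (fun y v a => q v a * hEnt (fun x => p x y v))]
    simp only [← sum_mul, hq1, one_mul]
  unfold helperInfo
  rw [condMutualInfo_mul_log_two hQ]
  simp only [law_VAY hF, law_VY hF hq1]
  simp only [hchain, sum_add_distrib, hcancel]
  ring

lemma equivocation_eq (hF : ∀ x y v a, auxLaw Q k x y v a = p x y v * q v a) :
    ∑ x, ∑ y, ∑ v, ∑ a, p x y v * q v a * logb 2 (margXAY p q x a y / margAY p q a y)
      = -equivocation m Q k := by
  unfold equivocation condEntropy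
  simp only [Fintype.sum_prod_type, law_XAY hF, law_AY hF, neg_neg]
  refine sum_congr rfl fun x _ => ?_
  rw [sum_comm (s := univ (α := Fin (m k)))]
  refine sum_congr rfl fun y _ => ?_
  rw [sum_comm]
  refine sum_congr rfl fun a _ => ?_
  rw [← sum_mul]
  rfl

/-- The decomposition I(V;A|Y) = I(V;A) - I(A;Y), valid by the Markov chain, separates the covering
exponent from the binning exponent. -/
lemma helperInfo_eq (hF : ∀ x y v a, auxLaw Q k x y v a = p x y v * q v a)
    (hp : ∀ x y v, 0 ≤ p x y v) (hq : ∀ v a, 0 ≤ q v a)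
    (hq1 : ∀ v, ∑ a, q v a = 1) :
    helperInfo m Q k
      = -(∑ x, ∑ y, ∑ v, ∑ a, p x y v * q v a * logb 2 (margA p q a / q v a))
        - ∑ x, ∑ y, ∑ v, ∑ a, p x y v * q v a *
          logb 2 (margAY p q a y / (margA p q a * margY p y)) := by
  have hpt : ∀ x y v a, p x y v * q v a * logb 2 ((∑ x, p x y v * q v a) * margY p y /
      ((∑ x, p x y v) * margAY p q a y))
      = -(p x y v * q v a * logb 2 (margA p q a / q v a))
        - p x y v * q v a * logb 2 (margAY p q a y / (margA p q a * margY p y)) := by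
    intro x y v a
    by_cases h0 : p x y v * q v a = 0
    · simp [h0]
    have h1 := margA_pos hp hq h0
    have h2 := margAY_pos hp hq h0
    have h3 := margY_pos hp (left_ne_zero_of_mul h0)
    have h4 := (hq v a).lt_of_ne' (right_ne_zero_of_mul h0)
    have h5 : 0 < ∑ x, p x y v := ((hp x y v).lt_of_ne' (left_ne_zero_of_mul h0)).trans_le
      (single_le_sum (f := fun x => p x y v) (fun x _ => hp x y v) (mem_univ x))
    rw [← sum_mul, logb_div (by positivity) (by positivity), logb_mul (by positivity) h3.ne',
      logb_mul h5.ne' h4.ne', logb_mul h5.ne' h2.ne', logb_div h1.ne' h4.ne',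
      logb_div h2.ne' (by positivity), logb_mul h1.ne' h3.ne']
    ring
  simp only [← sum_neg_distrib, ← sum_sub_distrib, ← hpt]
  unfold helperInfo condMutualInfo
  simp only [law_VAY hF, law_VY hF hq1, law_AY hF, law_Y hF hq1]
  rw [sum_comm (s := univ (α := X)), sum_rotate]
  refine sum_congr rfl fun y _ => ?_
  rw [← sum_rotate]
  refine sum_congr rfl fun v _ => sum_congr rfl fun a _ => ?_
  rw [sum_mul]

end Factored

lemma law_eq_sourceLaw {P : Letter X Y V → ℝ} {Q : Letter X Y V × (∀ k, Fin (m k)) → ℝ}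
    (hQP : law Q Prod.fst = P) (k : Fin K) (x : X) (y : Y k) (v : V k) :
    law Q (fun z => ((z.1.1, z.1.2.1 k), z.1.2.2 k)) ((x, y), v) = sourceLaw P k x y v := by
  rw [law_comp Q Prod.fst (fun s => ((s.1, s.2.1 k), s.2.2 k)), hQP]
  unfold sourceLaw
  rw [law_eq_sum]
  refine sum_congr rfl fun s _ => ?_
  simp only [Prod.mk.injEq, and_assoc]

/-- The Markov condition provides a test channel from `V_k` to `A_k`. -/
lemma exists_testChannel_of_isAuxiliary {P : Letter X Y V → ℝ}
    {Q : Letter X Y V × (∀ k, Fin (m k)) → ℝ} (hQ : IsAuxiliary P m Q) (k : Fin K) :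
    ∃ q : V k → Fin (m k) → ℝ, (∀ v a, 0 ≤ q v a) ∧ (∀ v, ∑ a, q v a = 1) ∧
      ∀ x y v a, auxLaw Q k x y v a = sourceLaw P k x y v * q v a := by
  classical
  obtain ⟨hQs, hQP, hM⟩ := hQ
  set lV := law Q (fun z => z.1.2.2 k) with hlV
  set lA := law Q (fun z => z.2 k) with hlA
  set lVA := law Q (fun z => (z.1.2.2 k, z.2 k)) with hlVA
  have hVA : ∀ v, ∑ a, lVA (v, a) = lV v := fun v =>
    sum_law_pair_right Q (fun z => z.1.2.2 k) (fun z => z.2 k) v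
  -- The conditional law of `A_k` given `V_k`. For `v` of probability zero any pmf would do; the
  -- marginal of `A_k` is used.
  refine ⟨fun v a => if lV v = 0 then lA a else lVA (v, a) / lV v, fun v a => ?_, fun v => ?_,
    fun x y v a => ?_⟩
  · beta_reduce
    split_ifs
    · exact law_nonneg hQs.1 _ _
    · exact div_nonneg (law_nonneg hQs.1 _ _) (law_nonneg hQs.1 _ _)
  · beta_reduce
    split_ifs with h
    · rw [hlA, sum_law]; exact hQs.2
    · rw [← sum_div, hVA, div_self h]
  · have h1 := hM k (x, y) v a
    rw [law_eq_sourceLaw hQP] at h1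
    have h2 : law Q (fun z => ((z.1.1, z.1.2.1 k), z.1.2.2 k, z.2 k)) ((x, y), v, a)
        = auxLaw Q k x y v a := by
      unfold auxLaw
      rw [law_eq_sum, law_eq_sum]
      refine sum_congr rfl fun s _ => ?_
      simp only [Prod.mk.injEq, and_assoc]
    rw [h2] at h1
    beta_reduce
    split_ifs with h
    · have h3 : ∀ x y, sourceLaw P k x y v = 0 ∧ auxLaw Q k x y v a = 0 := by
        intro x y
        have h4 := sum_law_pair_left Q (fun z => (z.1.1, z.1.2.1 k)) (fun z => z.1.2.2 k) v
        rw [← hlV, h, sum_eq_zero_iff_of_nonneg fun _ _ => law_nonneg hQs.1 _ _] at h4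
        have h5 := h4 (x, y) (mem_univ _)
        have h6 := sum_law_pair_right Q (fun z => ((z.1.1, z.1.2.1 k), z.1.2.2 k))
          (fun z => z.2 k) ((x, y), v)
        rw [h5, sum_eq_zero_iff_of_nonneg fun _ _ => law_nonneg hQs.1 _ _] at h6
        rw [law_eq_sourceLaw hQP] at h5
        refine ⟨h5, ?_⟩
        rw [← h6 a (mem_univ _)]
        unfold auxLaw
        rw [law_eq_sum, law_eq_sum]
        refine sum_congr rfl fun s _ => ?_
        simp only [Prod.mk.injEq, and_assoc]
      rw [(h3 x y).1, (h3 x y).2, zero_mul]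
    · rw [mul_div_assoc', eq_div_iff h]
      exact h1

lemma sum_pi_prod_mul_ind {r : ∀ k, Fin (m k) → ℝ} (hr : ∀ k, ∑ a, r k a = 1) (k : Fin K)
    (b : Fin (m k)) : ∑ a : ∀ k, Fin (m k), (∏ j, r j (a j)) * ind (a k = b) = r k b := by
  classical
  have h1 : ∀ a : ∀ k, Fin (m k), (∏ j, r j (a j)) * ind (a k = b)
      = ∏ j, Function.update r k (fun c => r k c * ind (c = b)) j (a j) := by
    intro a
    rw [← mul_prod_erase univ _ (mem_univ k), ← mul_prod_erase univ
      (fun j => Function.update r k (fun c => r k c * ind (c = b)) j (a j)) (mem_univ k)]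
    simp only [Function.update_self]
    rw [mul_right_comm]
    congr 1
    refine prod_congr rfl fun j hj => ?_
    rw [Function.update_of_ne (ne_of_mem_erase hj)]
  simp only [h1]
  have h2 := Finset.prod_univ_sum (fun j => (univ : Finset (Fin (m j))))
    (fun j c => Function.update r k (fun c => r k c * ind (c = b)) j c)
  rw [Fintype.piFinset_univ] at h2
  rw [← h2, Finset.prod_eq_single k]
  · simp only [Function.update_self]
    rw [sum_eq_single b]
    · rw [ind_of rfl, mul_one]
    · intro c _ hc; rw [ind_of_not hc, mul_zero]
    · simp
  · intro j _ hj
    rw [Function.update_of_ne hj]; exact hr j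
  · simp

lemma sum_pi_prod {r : ∀ k, Fin (m k) → ℝ} (hr : ∀ k, ∑ a, r k a = 1) :
    ∑ a : ∀ k, Fin (m k), ∏ j, r j (a j) = 1 := by
  have h := Finset.prod_univ_sum (fun j => (univ : Finset (Fin (m j)))) r
  rw [Fintype.piFinset_univ] at h
  rw [← h]
  simp [hr]

/-- Test channels from `V_k` to `A_k` define auxiliary random variables. -/
lemma exists_isAuxiliary {P : Letter X Y V → ℝ} (hP : P ∈ stdSimplex ℝ (Letter X Y V))
    {q : ∀ k, V k → Fin (m k) → ℝ} (hq : ∀ k v, q k v ∈ stdSimplex ℝ (Fin (m k))) :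
    ∃ Q, IsAuxiliary P m Q ∧
      ∀ k x y v a, auxLaw Q k x y v a = sourceLaw P k x y v * q k v a := by
  classical
  -- The auxiliary variables are taken conditionally independent given the letter; the conditions of
  -- each receiver involve only its own auxiliary variable.
  set Q : Letter X Y V × (∀ k, Fin (m k)) → ℝ := fun z => P z.1 * ∏ j, q j (z.1.2.2 j) (z.2 j)
    with hQ
  have hQ0 : ∀ z, 0 ≤ Q z := fun z => mul_nonneg (hP.1 _) (prod_nonneg fun j _ => (hq _ _).1 _)
  have hr : ∀ (s : Letter X Y V) (k : Fin K), ∑ a, q k (s.2.2 k) a = 1 := fun s k => (hq _ _).2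
  have hF : ∀ k x y v a, auxLaw Q k x y v a = sourceLaw P k x y v * q k v a := by
    intro k x y v a
    unfold auxLaw sourceLaw
    rw [law_eq_sum, law_eq_sum, Fintype.sum_prod_type, sum_mul]
    refine sum_congr rfl fun s _ => ?_
    by_cases hs : (s.1, s.2.1 k, s.2.2 k) = (x, y, v)
    · rw [ind_of hs, mul_one]
      simp only [Prod.mk.injEq] at hs
      obtain ⟨h1, h2, h3⟩ := hs
      rw [← h3, ← sum_pi_prod_mul_ind (r := fun j => q j (s.2.2 j)) (hr s) k a, mul_sum]
      refine sum_congr rfl fun c _ => ?_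
      simp only [hQ, h1, h2, Prod.mk.injEq, true_and, mul_assoc]
    · rw [ind_of_not hs, mul_zero, zero_mul]
      refine sum_eq_zero fun c _ => ?_
      rw [ind_of_not, mul_zero]
      intro h
      simp only [Prod.mk.injEq] at h hs
      exact hs ⟨h.1, h.2.1, h.2.2.1⟩
  refine ⟨Q, ⟨⟨hQ0, ?_⟩, ?_, fun k => ?_⟩, hF⟩
  · rw [Fintype.sum_prod_type, ← hP.2]
    refine sum_congr rfl fun s _ => ?_
    simp only [hQ, ← mul_sum]
    rw [sum_pi_prod (r := fun j => q j (s.2.2 j)) (hr s), mul_one]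
  · funext s
    rw [law_eq_sum, Fintype.sum_prod_type, sum_eq_single s]
    · simp only [hQ]
      simp only [ind_of, mul_one, ← mul_sum]
      rw [sum_pi_prod (r := fun j => q j (s.2.2 j)) (hr s), mul_one]
    · intro s' _ hs
      refine sum_eq_zero fun c _ => ?_
      rw [ind_of_not hs, mul_zero]
    · simp
  · rintro ⟨x, y⟩ v a
    have h1 : law Q (fun z => ((z.1.1, z.1.2.1 k), z.1.2.2 k, z.2 k)) ((x, y), v, a)
        = sourceLaw P k x y v * q k v a := by
      rw [law_comp_aux (k := k) (fun w => ((w.1, w.2.1), w.2.2.1, w.2.2.2))]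
      simp [hF, ind, ite_and]
    have h2 : law Q (fun z => ((z.1.1, z.1.2.1 k), z.1.2.2 k)) ((x, y), v)
        = sourceLaw P k x y v := by
      rw [law_comp_aux (k := k) (fun w => ((w.1, w.2.1), w.2.2.1))]
      simp [hF, ind, ite_and, ← mul_sum, (hq _ _).2]
    have h3 : law Q (fun z => z.1.2.2 k) v = ∑ x, ∑ y, sourceLaw P k x y v := by
      rw [law_comp_aux (k := k) (fun w => w.2.2.1)]
      simp [hF, ind, ← mul_sum, (hq _ _).2]
    have h4 : law Q (fun z => (z.1.2.2 k, z.2 k)) (v, a)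
        = (∑ x, ∑ y, sourceLaw P k x y v) * q k v a := by
      rw [law_comp_aux (k := k) (fun w => (w.2.2.1, w.2.2.2))]
      simp [hF, ind, ite_and, sum_mul]
    rw [h1, h2, h3, h4]
    ring

end Auxiliary

/-! ### The two directions of the theorem -/

section Main

variable {K : ℕ} {X W : Type*} {Y V U : Fin K → Type*}
  [Fintype X] [Fintype W] [∀ k, Fintype (Y k)] [∀ k, Fintype (V k)] [∀ k, Fintype (U k)]
  {P : Letter X Y V → ℝ} {T : W → (∀ k, U k) → ℝ}

lemma nonempty_of_mem_stdSimplex {α : Type*} [Fintype α] {p : α → ℝ} (hp : p ∈ stdSimplex ℝ α) :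
    Nonempty α := by
  by_contra h
  rw [not_nonempty_iff] at h
  simpa using hp.2

lemma channelInfo_eq {PW : W → ℝ} (hPW : PW ∈ stdSimplex ℝ W)
    (hT : ∀ w, T w ∈ stdSimplex ℝ (∀ k, U k)) (k : Fin K) :
    ∑ w, ∑ u, PW w * receiverChannel T k w u *
      logb 2 (receiverChannel T k w u / outLaw PW (receiverChannel T k) u)
      = channelInfo PW T k := by
  have hlog := log_pos one_lt_two
  refine mul_right_cancel₀ hlog.ne' ?_
  rw [channelInfo_mul_log_two hPW hT k]
  have ht := receiverChannel_mem_stdSimplex hT k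
  set t := receiverChannel T k with htd
  have hpt : ∀ w u, PW w * t w u * logb 2 (t w u / outLaw PW t u) * log 2
      = PW w * (t w u * log (t w u / ∑ u, t w u)) - PW w * t w u * log (outLaw PW t u) := by
    intro w u
    rw [mul_assoc, logb_two_mul_log_two, (ht w).2, div_one]
    by_cases h0 : PW w * t w u = 0
    · rw [h0]
      rcases mul_eq_zero.1 h0 with h | h <;> simp [h]
    have h1 : 0 < outLaw PW t u := ((mul_nonneg (hPW.1 w) ((ht w).1 u)).lt_of_ne' h0).trans_le
      (single_le_sum (f := fun w => PW w * t w u)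
        (fun w _ => mul_nonneg (hPW.1 w) ((ht w).1 u)) (mem_univ w))
    rw [log_div (right_ne_zero_of_mul h0) h1.ne']
    ring
  have hsum : ∑ u, outLaw PW t u = 1 := by
    unfold outLaw
    rw [sum_comm]
    simp only [← mul_sum, (ht _).2, mul_one, hPW.2]
  simp only [sum_mul, hpt, sum_sub_distrib, ← mul_sum]
  rw [sum_comm]
  simp only [← sum_mul, sum_mul_log_div _ (ht _).1]
  have e : ∀ u, ∑ w, PW w * t w u = outLaw PW t u := fun u => rfl
  simp only [e, chanInfo, hEnt_of_sum_eq_one hsum, negMulLog]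
  simp only [mul_neg, sum_neg_distrib, neg_mul]
  ring

/-- Achievability. -/
theorem achievable_of_exists (hP : P ∈ stdSimplex ℝ (Letter X Y V))
    (hT : ∀ w, T w ∈ stdSimplex ℝ (∀ k, U k)) {κ : ℚ} (hκ : 0 < κ) {R : Fin K → ℝ}
    {PW : W → ℝ} (hPW : PW ∈ stdSimplex ℝ W) {m : Fin K → ℕ}
    {Q : Letter X Y V × (∀ k, Fin (m k)) → ℝ} (hQ : IsAuxiliary P m Q)
    (h : ∀ k, helperInfo m Q k < R k ∧ equivocation m Q k < κ * channelInfo PW T k) :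
    Achievable P T κ R := by
  classical
  intro ε hε
  have hκ' : (0 : ℝ) < κ := by exact_mod_cast hκ
  have hX : Nonempty X := ⟨(nonempty_of_mem_stdSimplex hP).some.1⟩
  -- Dividing by `K + 1` instead of `K` covers the case of no receivers.
  have hη : 0 < ε / (K + 1) := by positivity
  have hk : ∀ k, ∃ N : ℕ, ∀ ns nc : ℕ, N ≤ ns → N ≤ nc → (nc : ℝ) = κ * ns →
      ∃ B : ((Fin ns → X) → Fin nc → W) → ℝ,
        (∀ enc, ∃ (helper : (Fin ns → V k) → Fin (numMessages ns (R k)))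
          (dec : (Fin nc → U k) → (Fin ns → Y k) → Fin (numMessages ns (R k)) → Fin ns → X),
          codeError (blockPmf (Fin ns) (sourceLaw P k))
            (blockChannel (Fin nc) (receiverChannel T k)) enc helper dec ≤ B enc) ∧
        ∑ enc : (Fin ns → X) → Fin nc → W, (∏ x, ∏ i, PW (enc x i)) * B enc ≤ ε / (K + 1) := by
    intro k
    obtain ⟨q, hq, hq1, hF⟩ := exists_testChannel_of_isAuxiliary hQ k
    have hp := sourceLaw_nonneg hP k
    have hhelper := helperInfo_eq hF hp hq hq1
    refine exists_forall_codebook_bound hp (sum_sourceLaw hP k) hq hq1 hPW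
      (receiverChannel_mem_stdSimplex hT k) hκ' ?_ rfl (neg_neg _).symm (equivocation_eq hF)
      (channelInfo_eq hPW hT k) ?_ (h k).2 hη
    · exact (condMutualInfo_nonneg hQ.1.1 _ _ _).trans_lt (h k).1
    · rw [← hhelper]; exact (h k).1
  choose N hN using hk
  refine ⟨∑ k, N k, fun ns nc hns hnc hratio => ?_⟩
  -- Blocklength zero is excluded by the ratio, since division by zero would give `κ = 0`.
  have hns0 : (ns : ℚ) ≠ 0 := by
    intro h0
    rw [h0, div_zero] at hratio
    exact hκ.ne hratio
  have hnc' : (nc : ℝ) = κ * ns := by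
    rw [div_eq_iff hns0] at hratio
    exact_mod_cast hratio
  have hNk : ∀ k, N k ≤ ∑ k, N k := fun k => single_le_sum (fun _ _ => Nat.zero_le _) (mem_univ k)
  choose B hB hBsum using fun k => hN k ns nc ((hNk k).trans hns) ((hNk k).trans hnc) hnc'
  have hPWn : (fun w : Fin nc → W => ∏ i, PW (w i)) ∈ stdSimplex ℝ (Fin nc → W) :=
    prod_mem_stdSimplex hPW
  -- One channel codebook for all receivers: the sum of the bounds has mean at most `ε`, and each
  -- bound is nonnegative.
  obtain ⟨enc, henc⟩ := exists_le_of_sum_mul_le (F := fun enc => ∑ k, B k enc) (τ := ε)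
    (fun enc : (Fin ns → X) → Fin nc → W => prod_nonneg fun x _ => hPWn.1 (enc x))
    (sum_iid hPWn.2) (by
      simp only [mul_sum]
      rw [sum_comm]
      refine (sum_le_sum fun k _ => hBsum k).trans ?_
      rw [sum_const, card_univ, Fintype.card_fin, nsmul_eq_mul, mul_div_assoc',
        div_le_iff₀ (by positivity)]
      nlinarith)
  choose helper dec hdec using fun k => hB k enc
  refine ⟨⟨enc, helper, dec⟩, fun k => ?_⟩
  rw [errorProb_eq_codeError]
  have hB0 : ∀ k, 0 ≤ B k enc := fun k => le_trans (sum_nonneg fun x _ => sum_nonneg fun y _ =>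
    sum_nonneg fun v _ => sum_nonneg fun u _ => mul_nonneg (mul_nonneg
      (prod_nonneg fun i _ => sourceLaw_nonneg hP k _ _ _)
      (prod_nonneg fun i _ => (receiverChannel_mem_stdSimplex hT k _).1 _)) (ind_nonneg _))
      (hdec k)
  exact (hdec k).trans ((single_le_sum (f := fun k => B k enc) (fun k _ => hB0 k)
    (mem_univ k)).trans henc)

lemma continuous_chanInfo {W U : Type*} [Fintype W] [Fintype U] (t : W → U → ℝ) :
    Continuous fun pW : W → ℝ => chanInfo pW t := by
  unfold chanInfo outLaw
  exact (continuous_hEnt (by fun_prop)).sub (by fun_prop)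

lemma achievableInfinitelyOften_of_achievable {κ : ℚ} (hκ : 0 < κ) {R : Fin K → ℝ}
    (h : Achievable P T κ R) : AchievableInfinitelyOften P T κ R := by
  intro ε hε N
  obtain ⟨N₀, hN₀⟩ := h ε hε
  have hnum : 0 < κ.num.toNat := by
    have := Rat.num_pos.2 hκ
    omega
  -- Common multiples of the denominator and numerator of `κ` supply arbitrarily large blocklengths
  -- of the exact ratio.
  refine ⟨κ.den * (N + N₀ + 1), κ.num.toNat * (N + N₀ + 1), ?_, ?_, ?_, hN₀ _ _ ?_ ?_ ?_⟩
  case refine_3 | refine_6 =>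
    have h1 : ((κ.num.toNat : ℕ) : ℚ) = κ.num := by
      have : ((κ.num.toNat : ℕ) : ℤ) = κ.num := Int.toNat_of_nonneg (Rat.num_pos.2 hκ).le
      exact_mod_cast congrArg (fun z : ℤ => (z : ℚ)) this
    push_cast
    rw [h1, mul_div_mul_right _ _ (by positivity)]
    exact Rat.num_div_den κ
  all_goals nlinarith [κ.den_pos]

/-- The bound on one receiver provided by a code. -/
lemma exists_mem_hull_of_code (hP : P ∈ stdSimplex ℝ (Letter X Y V))
    (hT : ∀ w, T w ∈ stdSimplex ℝ (∀ k, U k)) {κ : ℚ} (hκ : 0 < κ) {R : Fin K → ℝ} {ns nc N : ℕ}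
    (hns : N + 1 ≤ ns) (hratio : (nc : ℚ) / ns = κ) (c : Code X W Y V U ns nc R) (k : Fin K)
    (hc : c.errorProb P T k ≤ 1 / (N + 1)) :
    ∃ a b, ((fun _ => (Fintype.card (V k) : ℝ)⁻¹), a, b) ∈ convexHull ℝ (tiltSet (sourceLaw P k)) ∧
      Fintype.card (V k) * a ≤ κ * chanInfo (inputLaw (law P Prod.fst) c.enc) (receiverChannel T k)
        + (log 2 + log (Fintype.card X)) * (1 / (N + 1)) ∧
      entXVY (sourceLaw P k) - R k * log 2 ≤ Fintype.card (V k) * b := by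
  obtain ⟨s₀⟩ := nonempty_of_mem_stdSimplex hP
  have hVk : Nonempty (V k) := ⟨s₀.2.2 k⟩
  have hX : Nonempty X := ⟨s₀.1⟩
  have hV : (0 : ℝ) < Fintype.card (V k) := by exact_mod_cast Fintype.card_pos
  have hns0 : (0 : ℝ) < ns := by exact_mod_cast (by omega : 0 < ns)
  have hN0 : (0 : ℝ) < N + 1 := by positivity
  have hnsN : (N : ℝ) + 1 ≤ ns := by exact_mod_cast hns
  have hκ' : (0 : ℝ) < κ := by exact_mod_cast hκ
  have hnc : (nc : ℝ) = κ * ns := by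
    rw [div_eq_iff (by exact_mod_cast hns0.ne')] at hratio
    exact_mod_cast hratio
  have hnc0 : 0 < nc := by
    have : (0 : ℝ) < nc := by rw [hnc]; positivity
    exact_mod_cast this
  obtain ⟨a, b, hab, ha, hb⟩ := exists_tiltCone_of_code (sourceLaw_nonneg hP k)
    (sum_sourceLaw hP k) (receiverChannel_mem_stdSimplex hT k) (sum_sum_sourceLaw P k) hnc0
    c.enc (c.helper k) (c.dec k)
  rw [← errorProb_eq_codeError] at ha
  refine ⟨_, _, exists_mem_hull_of_mem_tiltCone hns0 hab, ?_, ?_⟩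
  · have e : (Fintype.card (V k) : ℝ) * (a / (ns * Fintype.card (V k))) = a / ns := by field_simp
    rw [e, div_le_iff₀ hns0]
    refine ha.trans ?_
    have hlX : 0 ≤ log (Fintype.card X) := log_natCast_nonneg _
    have h1 : log 2 ≤ log 2 * (1 / (N + 1)) * ns := by
      rw [mul_assoc, one_div_mul_eq_div]
      exact le_mul_of_one_le_right (log_pos one_lt_two).le ((one_le_div hN0).2 hnsN)
    have h2 : c.errorProb P T k * (ns * log (Fintype.card X))
        ≤ 1 / (N + 1) * (ns * log (Fintype.card X)) :=
      mul_le_mul_of_nonneg_right hc (by positivity)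
    rw [hnc]
    nlinarith
  · have e : (Fintype.card (V k) : ℝ) * (b / (ns * Fintype.card (V k))) = b / ns := by field_simp
    rw [e, le_div_iff₀ hns0]
    refine le_trans ?_ hb
    -- The existence of a helper map already forces a nonempty message set, whatever the sign of the
    -- rate.
    have hM0 : 0 < numMessages ns (R k) := (c.helper k fun _ => s₀.2.2 k).pos
    have hM : log (numMessages ns (R k)) ≤ ns * R k * log 2 := by
      rw [← log_rpow (by norm_num)]
      exact log_le_log (by exact_mod_cast hM0) (Nat.floor_le (by positivity))
    nlinarith

/-- The converse. -/
theorem exists_of_achievableInfinitelyOften (hP : P ∈ stdSimplex ℝ (Letter X Y V))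
    (hT : ∀ w, T w ∈ stdSimplex ℝ (∀ k, U k)) {κ : ℚ} (hκ : 0 < κ) {R : Fin K → ℝ}
    (h : AchievableInfinitelyOften P T κ R) :
    ∃ PW ∈ stdSimplex ℝ W, ∃ (m : Fin K → ℕ) (Q : Letter X Y V × (∀ k, Fin (m k)) → ℝ),
      IsAuxiliary P m Q ∧
      ∀ k, helperInfo m Q k ≤ R k ∧ equivocation m Q k ≤ κ * channelInfo PW T k := by
  have hlog := log_pos one_lt_two
  obtain ⟨s₀⟩ := nonempty_of_mem_stdSimplex hP
  have hVk : ∀ k, Nonempty (V k) := fun k => ⟨s₀.2.2 k⟩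
  -- The input law and the hull points of all receivers form one point of a product, so that a
  -- single subsequence and a single limiting input law serve every receiver.
  have hseq : ∀ N : ℕ, ∃ z : (W → ℝ) × (∀ k, (V k → ℝ) × ℝ × ℝ),
      z ∈ stdSimplex ℝ W ×ˢ Set.univ.pi (fun k => convexHull ℝ (tiltSet (sourceLaw P k))) ∧
      ∀ k, (z.2 k).1 = (fun _ => (Fintype.card (V k) : ℝ)⁻¹) ∧
        Fintype.card (V k) * (z.2 k).2.1 ≤ κ * chanInfo z.1 (receiverChannel T k)
          + (log 2 + log (Fintype.card X)) * (1 / (N + 1)) ∧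
        entXVY (sourceLaw P k) - R k * log 2 ≤ Fintype.card (V k) * (z.2 k).2.2 := by
    intro N
    obtain ⟨ns, nc, hns, hnc, hratio, c, hc⟩ := h (1 / (N + 1)) (by positivity) (N + 1)
    choose a b hab ha hb using fun k => exists_mem_hull_of_code hP hT hκ hns hratio c k (hc k)
    exact ⟨(inputLaw (law P Prod.fst) c.enc,
      fun k => ((fun _ => (Fintype.card (V k) : ℝ)⁻¹), a k, b k)),
      ⟨inputLaw_mem_stdSimplex (by omega) ⟨law_nonneg hP.1 _, (sum_law _ _).trans hP.2⟩ c.enc,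
        fun k _ => hab k⟩, fun k => ⟨rfl, ha k, hb k⟩⟩
  choose z hz hzk using hseq
  have hcompact : IsCompact (stdSimplex ℝ W ×ˢ
      Set.univ.pi (fun k => convexHull ℝ (tiltSet (sourceLaw P k)))) :=
    (isCompact_stdSimplex ℝ W).prod (isCompact_univ_pi fun k => isCompact_convexHull_tiltSet _)
  obtain ⟨⟨PW, ζ⟩, ⟨hPW, hζ⟩, φ, hφ, hlim⟩ := hcompact.tendsto_subseq hz
  have hlimW : Filter.Tendsto (fun n => (z (φ n)).1) Filter.atTop (nhds PW) :=
    (continuous_fst.tendsto _).comp hlim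
  have hlimk : ∀ k, Filter.Tendsto (fun n => (z (φ n)).2 k) Filter.atTop (nhds (ζ k)) := fun k =>
    (((continuous_apply k).comp continuous_snd).tendsto _).comp hlim
  have hζ1 : ∀ k, (ζ k).1 = fun _ => (Fintype.card (V k) : ℝ)⁻¹ := by
    intro k
    refine tendsto_nhds_unique ((continuous_fst.tendsto _).comp (hlimk k)) ?_
    refine tendsto_const_nhds.congr fun n => ?_
    exact ((hzk (φ n) k).1).symm
  have hζa : ∀ k, Fintype.card (V k) * (ζ k).2.1 ≤ κ * chanInfo PW (receiverChannel T k) := by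
    intro k
    have h1 : Filter.Tendsto (fun n => (Fintype.card (V k) : ℝ) * ((z (φ n)).2 k).2.1)
        Filter.atTop (nhds (Fintype.card (V k) * (ζ k).2.1)) :=
      (((continuous_fst.comp continuous_snd).tendsto _).comp (hlimk k)).const_mul _
    have h2 : Filter.Tendsto (fun n => (κ : ℝ) * chanInfo (z (φ n)).1 (receiverChannel T k)
        + (log 2 + log (Fintype.card X)) * (1 / ((φ n : ℕ) + 1))) Filter.atTop
        (nhds (κ * chanInfo PW (receiverChannel T k) + (log 2 + log (Fintype.card X)) * 0)) :=
      ((((continuous_chanInfo _).tendsto _).comp hlimW).const_mul _).add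
        ((tendsto_one_div_add_atTop_nhds_zero_nat.comp hφ.tendsto_atTop).const_mul _)
    have h3 := le_of_tendsto_of_tendsto' h1 h2 fun n => (hzk (φ n) k).2.1
    simpa using h3
  have hζb : ∀ k, entXVY (sourceLaw P k) - R k * log 2 ≤ Fintype.card (V k) * (ζ k).2.2 := by
    intro k
    have h1 : Filter.Tendsto (fun n => (Fintype.card (V k) : ℝ) * ((z (φ n)).2 k).2.2)
        Filter.atTop (nhds (Fintype.card (V k) * (ζ k).2.2)) :=
      (((continuous_snd.comp continuous_snd).tendsto _).comp (hlimk k)).const_mul _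
    exact ge_of_tendsto' h1 fun n => (hzk (φ n) k).2.2
  have htest : ∀ k, ∃ (m : ℕ) (q : V k → Fin m → ℝ), (∀ v, q v ∈ stdSimplex ℝ (Fin m)) ∧
      ∑ j, entXY (fun x y v => sourceLaw P k x y v * q v j) = Fintype.card (V k) * (ζ k).2.1 ∧
      ∑ j, entXVY (fun x y v => sourceLaw P k x y v * q v j)
        = Fintype.card (V k) * (ζ k).2.2 := by
    intro k
    refine exists_testChannel_of_mem_hull ?_
    rw [← hζ1 k]
    exact hζ k (Set.mem_univ k)
  choose m q hq hqa hqb using htest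
  obtain ⟨Q, hQ, hF⟩ := exists_isAuxiliary hP hq
  refine ⟨PW, hPW, m, Q, hQ, fun k => ⟨?_, ?_⟩⟩
  · have h1 := helperInfo_mul_log_two (hF k) hQ.1.1 fun v => (hq k v).2
    have h2 := hζb k
    rw [hqb k] at h1
    exact le_of_mul_le_mul_right (by linarith) hlog
  · have h1 := equivocation_mul_log_two (hF k) hQ.1.1
    have h2 := hζa k
    have h3 := channelInfo_mul_log_two hPW hT k
    rw [hqa k] at h1
    refine le_of_mul_le_mul_right ?_ hlog
    rw [mul_assoc, h3, h1]
    exact h2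

end Main

end BSCoop

end

theorem theorem2 {K : ℕ} {X W : Type*} {Y V U : Fin K → Type*}
    [Fintype X] [Fintype W] [∀ k, Fintype (Y k)] [∀ k, Fintype (V k)] [∀ k, Fintype (U k)]
    (P : BSCoop.Letter X Y V → ℝ) (hP : P ∈ stdSimplex ℝ (BSCoop.Letter X Y V))
    (T : W → (∀ k, U k) → ℝ) (hT : ∀ w, T w ∈ stdSimplex ℝ (∀ k, U k))
    (κ : ℚ) (hκ : 0 < κ) (R : Fin K → ℝ) :
    -- achievability
    ((∃ PW ∈ stdSimplex ℝ W, ∃ (m : Fin K → ℕ) (Q : BSCoop.Letter X Y V × (∀ k, Fin (m k)) → ℝ),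
        BSCoop.IsAuxiliary P m Q ∧
        ∀ k, BSCoop.helperInfo m Q k < R k ∧
          BSCoop.equivocation m Q k < κ * BSCoop.channelInfo PW T k) →
      BSCoop.Achievable P T κ R) ∧
    -- converse
    (BSCoop.Achievable P T κ R →
      ∃ PW ∈ stdSimplex ℝ W, ∃ (m : Fin K → ℕ) (Q : BSCoop.Letter X Y V × (∀ k, Fin (m k)) → ℝ),
        BSCoop.IsAuxiliary P m Q ∧
        ∀ k, BSCoop.helperInfo m Q k ≤ R k ∧
          BSCoop.equivocation m Q k ≤ κ * BSCoop.channelInfo PW T k) ∧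
    -- converse, for codes that exist only at arbitrarily large blocklengths
    (BSCoop.AchievableInfinitelyOften P T κ R →
      ∃ PW ∈ stdSimplex ℝ W, ∃ (m : Fin K → ℕ) (Q : BSCoop.Letter X Y V × (∀ k, Fin (m k)) → ℝ),
        BSCoop.IsAuxiliary P m Q ∧
        ∀ k, BSCoop.helperInfo m Q k ≤ R k ∧
          BSCoop.equivocation m Q k ≤ κ * BSCoop.channelInfo PW T k) := by
  refine ⟨?_, fun h => ?_, BSCoop.exists_of_achievableInfinitelyOften hP hT hκ⟩
  · rintro ⟨PW, hPW, m, Q, hQ, h⟩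
    exact BSCoop.achievable_of_exists hP hT hκ hPW hQ h
  · exact BSCoop.exists_of_achievableInfinitelyOften hP hT hκ
      (BSCoop.achievableInfinitelyOften_of_achievable hκ h)
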